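/- **Notation.** For $\rho>0$ and $0<\theta<\pi/2$ let $D(\rho)=\{z\in\mathbb C: |\operatorname{Im} z|<\rho\}$ and $\Sigma(\theta)=\{z\in\mathbb C:\operatorname{Re} z\ge 0,\ |\operatorname{Im} z|\le \operatorname{Re} z\,\tan\theta\}$. $H^{0,\rho}$ is the space of analytic functions $f$ on $D(\rho)$ with $f(\cdot+iy)\in L^2(\mathbb R)$ for $|y|<\rho$ and $|f|_{0,\rho}=\sup_{|y|<\rho}\|f(\cdot+iy)\|_{L^2(\mathbb R)}<\infty$. For $\mu>0$ and an integer $l\ge 0$, $K^{l,\rho,\theta,\mu}$ is the space of functions $f(x,Y)$ that are analytic inside $D(\rho)\times\Sigma(\theta)$, with $\partial_Y^{\alpha_1}\partial_x^{\alpha_2}f\in C^0(\Sigma(\theta);H^{0,\rho})$ for $\alpha_1\le 2$, $\alpha_1+\alpha_2\le l$, and $$|f|_{l,\rho,\theta,\mu}=\sum_{\alpha_1\le 2,\ \alpha_1+\alpha_2\le l}\ \sup_{Y\in\Sigma(\theta)}e^{\mu\operatorname{Re}Y}\,|\partial_Y^{\alpha_1}\partial_x^{\alpha_2}f(\cdot,Y)|_{0,\rho}<\infty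 .$$ With the heat kernel $E(Y,t)=(4\pi t)^{-1/2}e^{-Y^2/(4t)}$ put $$(E_3(t)\varphi)(x,Y)=\int_0^t\Big(\int_0^\infty\big[E(Y-Y',t-s)+E(Y+Y',t-s)\big]\varphi(x,Y',s)\,dY'\Big)ds .$$ **Lemma 3.5.** Let $l\ge 1$, $T>0$, $\beta\ge 0$, $\rho,\mu>\beta T$ and $\beta T<\theta<\pi/4$. There is a constant $C>0$, depending only on $l,\rho,\theta,\mu,\beta,T$, such that the following holds. Let $u(t)\in K^{l,\rho-\beta t,\theta-\beta t,\mu-\beta t}$ for $0\le t\le T$, with $u$ Borel measurable in $(t,x,Y)$ on the set $\{0\le t\le T,\ x\in D(\rho-\beta t),\ Y\in\Sigma(\theta-\beta t)\}$. Then for all $0\le t\le T$, $0<\rho'<\rho-\beta t$, $0<\theta'<\theta-\beta t$, $0<\mu'<\mu-\beta t$, $$|E_3(t)\,\partial_Y u|_{l,\rho',\theta',\mu'}\ \le\ C\int_0^t\frac{1}{\sqrt{t-s}}\,|u(s)|_{l,\rho',\theta',\mu'}\,ds$$ in $[0,\infty]$. Moreover, for $x\in D(\rho')$ and $Y\in\Sigma(\theta')$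 the inner integral in $E_3(t)\partial_Y u$ converges absolutely for every $0\le s<t$, and, whenever the right-hand side above is finite, the outer one does too and $E_3(t)\,\partial_Y u\in K^{l,\rho',\theta',\mu'}$. -/

import Mathlib

open MeasureTheory Set Filter Topology
open scoped ENNReal

noncomputable section

namespace PrandtlRobin

/-- The strip `D(ρ) = {z : -ρ < Im z < ρ}`. -/
def strip (ρ : ℝ) : Set ℂ := {z | z.im ∈ Ioo (-ρ) ρ}

/-- The closed angular sector `Σ(θ) = {z : Re z ≥ 0, |Im z| ≤ Re z tan θ}`. -/
def sector (θ : ℝ) : Set ℂ := {z | 0 ≤ z.re ∧ |z.im| ≤ z.re * Real.tan θ}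

/-- The norm of `H^{l,ρ}`, with values in `[0,∞]`:
`∑_{α ≤ l} sup_{|y| < ρ} ‖∂_x^α f(· + iy)‖_{L²(ℝ)}`. -/
def hNorm (l : ℕ) (ρ : ℝ) (f : ℂ → ℂ) : ℝ≥0∞ :=
  ∑ α ∈ Finset.range (l + 1), ⨆ y ∈ Ioo (-ρ) ρ,
    eLpNorm (fun ξ : ℝ => iteratedDeriv α f ((ξ : ℂ) + (y : ℂ) * Complex.I)) 2 volume

/-- Membership in `H^{l,ρ}`. -/
structure MemH (l : ℕ) (ρ : ℝ) (f : ℂ → ℂ) : Prop where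
  analytic : AnalyticOnNhd ℂ f (strip ρ)
  memLp : ∀ α ≤ l, ∀ y ∈ Ioo (-ρ) ρ,
    MemLp (fun ξ : ℝ => iteratedDeriv α f ((ξ : ℂ) + (y : ℂ) * Complex.I)) 2 volume
  norm_lt_top : hNorm l ρ f < ∞

/-- The mixed derivative `∂_Y^{α₁} ∂_x^{α₂} f (x, Y)`. The `Y`-derivative is taken within the closed
sector, so it is the ordinary complex derivative at interior points and the one-sided one on the
boundary (in particular at `Y = 0`). -/
def mixedDeriv (θ : ℝ) (α₁ α₂ : ℕ) (f : ℂ → ℂ → ℂ) (x Y : ℂ) : ℂ :=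
  iteratedDerivWithin α₁ (fun Y' => iteratedDeriv α₂ (fun x' => f x' Y') x) (sector θ) Y

/-- The norm of `K^{l,ρ,θ,μ}`, with values in `[0,∞]`; the sum is over `α₁ ≤ 2`, `α₁ + α₂ ≤ l`. -/
def kNorm (l : ℕ) (ρ θ μ : ℝ) (f : ℂ → ℂ → ℂ) : ℝ≥0∞ :=
  ∑ α₁ ∈ Finset.range (min 2 l + 1), ∑ α₂ ∈ Finset.range (l - α₁ + 1),
    ⨆ Y ∈ sector θ, ENNReal.ofReal (Real.exp (μ * Y.re)) *
      hNorm 0 ρ (fun x => mixedDeriv θ α₁ α₂ f x Y)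

/-- Membership in `K^{l,ρ,θ,μ}`: `f` is analytic inside `D(ρ) × Σ(θ)`, the derivatives
`∂_Y^{α₁} ∂_x^{α₂} f` with `α₁ ≤ 2`, `α₁ + α₂ ≤ l` are in `C⁰(Σ(θ); H^{0,ρ})`, and the norm is
finite. -/
structure MemK (l : ℕ) (ρ θ μ : ℝ) (f : ℂ → ℂ → ℂ) : Prop where
  analytic : AnalyticOnNhd ℂ (fun p : ℂ × ℂ => f p.1 p.2) (strip ρ ×ˢ interior (sector θ))
  memH : ∀ α₁ α₂ : ℕ, α₁ ≤ 2 → α₁ + α₂ ≤ l → ∀ Y ∈ sector θ,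
    MemH 0 ρ (fun x => mixedDeriv θ α₁ α₂ f x Y)
  continuous : ∀ α₁ α₂ : ℕ, α₁ ≤ 2 → α₁ + α₂ ≤ l → ∀ Y₀ ∈ sector θ,
    Tendsto (fun Y => hNorm 0 ρ
      (fun x => mixedDeriv θ α₁ α₂ f x Y - mixedDeriv θ α₁ α₂ f x Y₀)) (𝓝[sector θ] Y₀) (𝓝 0)
  norm_lt_top : kNorm l ρ θ μ f < ∞

/-- The heat kernel `E(Y,t) = (4πt)^{-1/2} exp(-Y²/(4t))`, for complex `Y`. -/
def heatKernel (Y : ℂ) (t : ℝ) : ℂ :=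
  ((1 / Real.sqrt (4 * Real.pi * t) : ℝ) : ℂ) * Complex.exp (-Y ^ 2 / (4 * (t : ℂ)))

/-- The integrand `[E(Y-Y',t-s) + E(Y+Y',t-s)] φ(x,Y',s)`, for real `Y'`. -/
def E3Integrand (φ : ℝ → ℂ → ℂ → ℂ) (t : ℝ) (x Y : ℂ) (s Y' : ℝ) : ℂ :=
  (heatKernel (Y - (Y' : ℂ)) (t - s) + heatKernel (Y + (Y' : ℂ)) (t - s)) * φ s x (Y' : ℂ)

/-- The Duhamel operator `E₃(t)φ` with the even-reflected heat kernel, evaluated at `(x,Y)`, as an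
iterated integral: over `Y' ∈ (0,∞)` first, then over `s ∈ (0,t)`. -/
def E3 (t : ℝ) (φ : ℝ → ℂ → ℂ → ℂ) (x Y : ℂ) : ℂ :=
  ∫ s in (0 : ℝ)..t, ∫ Y' in Ioi (0 : ℝ), E3Integrand φ t x Y s Y'

/-- `∂_Y u` for a time-dependent function `u(s)(x,Y)`. It is only used at real `Y > 0`, which are
interior points of the sectors. -/
def dY (u : ℝ → ℂ → ℂ → ℂ) (s : ℝ) (x Y : ℂ) : ℂ := deriv (fun Y' => u s x Y') Y

/-- The set of `(s,x,Y)` with `0 ≤ s ≤ T`, `x ∈ D(ρ - βs)`, `Y ∈ Σ(θ - βs)`. -/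
def shrinkingDomain (ρ θ β T : ℝ) : Set (ℝ × ℂ × ℂ) :=
  {p | p.1 ∈ Icc 0 T ∧ p.2.1 ∈ strip (ρ - β * p.1) ∧ p.2.2 ∈ sector (θ - β * p.1)}

/-- `∫₀ᵗ (t-s)^{-1/2} |u(s)|_{l,ρ,θ,μ} ds`, with values in `[0,∞]`. -/
def singularIntegral (l : ℕ) (ρ θ μ t : ℝ) (u : ℝ → ℂ → ℂ → ℂ) : ℝ≥0∞ :=
  ∫⁻ s in Ioo 0 t, ENNReal.ofReal (1 / Real.sqrt (t - s)) * kNorm l ρ θ μ (u s)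

end PrandtlRobin

end

/-!
The estimate is a weighted `L¹` bound for `∂_Y E` combined with Minkowski's integral inequality in
`L²(dx)`; the rest of the argument makes `E₃(t) ∂_Y u` a legitimate element of the space.

Fix `0 < s < t`. Integrating by parts in `Y'` moves the derivative from `u` to the kernel. Each
further `Y`-derivative of the inner integral can be moved back onto `u`, alternating between the
even and the odd reflection, so that `∂_Y^a ∂_x^b` of the inner integral is the integral of
`∂_Y E(Y-Y') - (-1)^a ∂_Y E(Y+Y')` against `∂_Y^a ∂_x^b u(s)`, minus the boundary term
`2 E(Y) ∂_x^b u(s)(·, 0)` when `a = 0` (`duhamelSlice`, `hasDerivAt_duhamelSlice`). The integrand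
is holomorphic in `Y'` and decays exponentially, so for `Y = R ω` with `‖ω‖ = 1` the half line may be replaced by
the ray through `ω` (`integral_ray_eq`). There `Re ω²` is bounded below because `θ < π/4`, the
kernel is dominated by a Gaussian in `R ∓ r`, and its weighted `L¹` norm is `O((t-s)^{-1/2})`
(`exists_lintegral_reflKernel_le`). Minkowski's inequality then bounds the `L²` norm of the slice
on every line `Im x = y` (`lineNorm_duhamelSlice_le`).

The function `s ↦ |u(s)|` need not be measurable. It is replaced by the supremum of the weighted
norms over a countable dense set of lines and points of the sector, which is measurable, at most
`|u(s)|`, and by Fatou's lemma still a bound on all lines (`exists_majorant`). Hence the lower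
integral of `(t-s)^{-1/2} |u(s)|` controls the `L²` norms of the slices integrated in time.

If that integral is finite, the area mean value inequality (`exists_enorm_le_mul_hNorm`) turns the
`L²` bounds into pointwise bounds, locally uniform in `x`, and dominated convergence does the
rest: it gives holomorphy and differentiation under the time integral in `x`, one-sided
differentiability in `Y` within the closed sector (`hasDerivWithinAt_duhamelIntegral`), and
continuity in `Y` with values in `H^{0,ρ}` (`tendsto_hNorm_duhamelIntegral_sub`). Joint
analyticity follows from separate analyticity and local boundedness (`analyticAt_of_separately`).
-/

namespace PrandtlRobin

/-! ### Holomorphic parameter integrals -/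

/-- A family `g z a` of functions of `a`, holomorphic in `z` on `U` and locally uniformly in `z`
dominated by an integrable function of `a`. -/
structure DominatedHolomorphic {A : Type*} [MeasurableSpace A] (m : Measure A) (U : Set ℂ)
    (g : ℂ → A → ℂ) : Prop where
  meas : ∀ z ∈ U, AEStronglyMeasurable (g z) m
  diff : ∀ᵐ a ∂m, DifferentiableOn ℂ (fun z => g z a) U
  bound : ∀ z₀ ∈ U, ∃ r > 0, Metric.ball z₀ r ⊆ U ∧ ∃ b : A → ℝ, Integrable b m ∧
    ∀ᵐ a ∂m, ∀ z ∈ Metric.ball z₀ r, ‖g z a‖ ≤ b a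

namespace DominatedHolomorphic

variable {A : Type*} [MeasurableSpace A] {m : Measure A} {U : Set ℂ} {g : ℂ → A → ℂ}

lemma isOpen (h : DominatedHolomorphic m U g) : IsOpen U := by
  rw [Metric.isOpen_iff]
  intro z hz
  obtain ⟨r, hr, hU, -⟩ := h.bound z hz
  exact ⟨r, hr, hU⟩

lemma integrable (h : DominatedHolomorphic m U g) {z : ℂ} (hz : z ∈ U) : Integrable (g z) m := by
  obtain ⟨r, hr, hU, b, hb, hle⟩ := h.bound z hz
  refine hb.mono' (h.meas z hz) ?_
  filter_upwards [hle] with a ha using ha z (Metric.mem_ball_self hr)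

/-- The derivatives are again dominated, by Cauchy's estimate on a smaller disc. -/
lemma deriv (h : DominatedHolomorphic m U g) :
    DominatedHolomorphic m U (fun z a => deriv (fun z => g z a) z) := by
  have hU := h.isOpen
  refine ⟨fun z hz => ?_, ?_, fun z₀ hz₀ => ?_⟩
  · obtain ⟨r, hr, hrU, -⟩ := h.bound z hz
    -- the derivative is the limit of difference quotients along real steps `r / (n + 2)`
    set e : ℕ → ℂ := fun n => ((r / (n + 2) : ℝ) : ℂ) with he
    have hepos : ∀ n : ℕ, 0 < r / ((n : ℝ) + 2) := fun n => by positivity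
    have he0 : ∀ n, e n ≠ 0 := fun n => Complex.ofReal_ne_zero.2 (hepos n).ne'
    have helt : ∀ n, z + e n ∈ U := fun n => by
      apply hrU
      rw [Metric.mem_ball, dist_eq_norm, add_sub_cancel_left, Complex.norm_real, Real.norm_eq_abs,
        abs_of_pos (hepos n)]
      exact div_lt_self hr (by have : (0 : ℝ) ≤ n := n.cast_nonneg; linarith)
    have hetends : Tendsto e atTop (𝓝[≠] 0) := by
      refine tendsto_nhdsWithin_iff.2 ⟨?_, Eventually.of_forall he0⟩
      have : Tendsto (fun n : ℕ => r / ((n : ℝ) + 2)) atTop (𝓝 0) :=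
        tendsto_const_nhds.div_atTop
          (tendsto_atTop_add_const_right _ _ tendsto_natCast_atTop_atTop)
      have h2 := (Complex.continuous_ofReal.tendsto 0).comp this
      rwa [Complex.ofReal_zero] at h2
    refine aestronglyMeasurable_of_tendsto_ae atTop
      (f := fun n a => (e n)⁻¹ • (g (z + e n) a - g z a)) (fun n => ?_) ?_
    · exact AEStronglyMeasurable.const_smul ((h.meas _ (helt n)).sub (h.meas _ hz)) (e n)⁻¹
    · filter_upwards [h.diff] with a ha
      have hd := (ha.differentiableAt (hU.mem_nhds hz)).hasDerivAt
      exact (hasDerivAt_iff_tendsto_slope_zero.1 hd).comp hetends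
  · filter_upwards [h.diff] with a ha using ha.deriv hU
  · obtain ⟨r, hr, hrU, b, hb, hle⟩ := h.bound z₀ hz₀
    refine ⟨r / 2, by positivity, (Metric.ball_subset_ball (by linarith)).trans hrU,
      fun a => b a / (r / 4), hb.div_const _, ?_⟩
    filter_upwards [h.diff, hle] with a ha hba z hz
    have hsub : Metric.closedBall z (r / 4) ⊆ Metric.ball z₀ r := by
      intro y hy
      rw [Metric.mem_closedBall] at hy
      rw [Metric.mem_ball] at hz ⊢
      linarith [dist_triangle y z z₀]
    refine Complex.norm_deriv_le_of_forall_mem_sphere_norm_le (by positivity)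
      ((ha.mono (hsub.trans hrU)).diffContOnCl_ball subset_rfl) fun y hy => ?_
    exact hba y (hsub (Metric.sphere_subset_closedBall hy))

lemma hasDerivAt (h : DominatedHolomorphic m U g) {z : ℂ} (hz : z ∈ U) :
    HasDerivAt (fun z => ∫ a, g z a ∂m) (∫ a, _root_.deriv (fun z => g z a) z ∂m) z := by
  have hU := h.isOpen
  obtain ⟨r, hr, hrU, b, hb, hle⟩ := h.deriv.bound z hz
  refine (hasDerivAt_integral_of_dominated_loc_of_deriv_le (Metric.ball_mem_nhds z hr)
    (F' := fun z a => _root_.deriv (fun z => g z a) z) ?_ (h.integrable hz)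
    (h.deriv.meas z hz) hle hb ?_).2
  · filter_upwards [hU.mem_nhds hz] with y hy using h.meas y hy
  · filter_upwards [h.diff] with a ha y hy
    exact (ha.differentiableAt (hU.mem_nhds (hrU hy))).hasDerivAt

lemma iteratedDeriv (h : DominatedHolomorphic m U g) (k : ℕ) :
    DominatedHolomorphic m U (fun z a => iteratedDeriv k (fun z => g z a) z) := by
  induction k with
  | zero => simpa using h
  | succ k ih => simpa only [iteratedDeriv_succ] using ih.deriv

lemma differentiableOn (h : DominatedHolomorphic m U g) :
    DifferentiableOn ℂ (fun z => ∫ a, g z a ∂m) U := fun _ hz =>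
  (h.hasDerivAt hz).differentiableAt.differentiableWithinAt

lemma iteratedDeriv_integral (h : DominatedHolomorphic m U g) (k : ℕ) {z : ℂ} (hz : z ∈ U) :
    _root_.iteratedDeriv k (fun z => ∫ a, g z a ∂m) z =
      ∫ a, _root_.iteratedDeriv k (fun z => g z a) z ∂m := by
  induction k generalizing z with
  | zero => simp
  | succ k ih =>
    rw [iteratedDeriv_succ]
    have : _root_.iteratedDeriv k (fun z => ∫ a, g z a ∂m) =ᶠ[𝓝 z]
        fun z => ∫ a, _root_.iteratedDeriv k (fun z => g z a) z ∂m := by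
      filter_upwards [h.isOpen.mem_nhds hz] with y hy using ih hy
    rw [this.deriv_eq, ((h.iteratedDeriv k).hasDerivAt hz).deriv]
    simp only [iteratedDeriv_succ]

end DominatedHolomorphic

/-! ### Minkowski's integral inequality in `L²` -/

lemma lintegral_mul_le_sqrt_mul_sqrt {B : Type*} [MeasurableSpace B] {ν : Measure B}
    {f g : B → ℝ≥0∞} (hf : AEMeasurable f ν) (hg : AEMeasurable g ν) :
    ∫⁻ b, f b * g b ∂ν ≤ (∫⁻ b, f b ^ (2 : ℝ) ∂ν) ^ (1 / 2 : ℝ) *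
      (∫⁻ b, g b ^ (2 : ℝ) ∂ν) ^ (1 / 2 : ℝ) :=
  ENNReal.lintegral_mul_le_Lp_mul_Lq ν Real.HolderConjugate.two_two hf hg

/-- Minkowski's integral inequality in `L²`: expand the square of the inner integral and apply the
Cauchy–Schwarz inequality to each product. -/
lemma sqrt_lintegral_sq_lintegral_le {A B : Type*} [MeasurableSpace A] [MeasurableSpace B]
    {m : Measure A} {ν : Measure B} [SFinite m] [SFinite ν] {f : A → B → ℝ≥0∞}
    (hf : Measurable (Function.uncurry f)) :
    (∫⁻ b, (∫⁻ a, f a b ∂m) ^ (2 : ℝ) ∂ν) ^ (1 / 2 : ℝ) ≤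
      ∫⁻ a, (∫⁻ b, f a b ^ (2 : ℝ) ∂ν) ^ (1 / 2 : ℝ) ∂m := by
  set N : A → ℝ≥0∞ := fun a => (∫⁻ b, f a b ^ (2 : ℝ) ∂ν) ^ (1 / 2 : ℝ) with hN
  have hfa : ∀ a, Measurable (f a) := fun a => hf.comp measurable_prodMk_left
  have hfb : ∀ b, Measurable (fun a => f a b) := fun b => hf.comp measurable_prodMk_right
  have hNm : Measurable N := by
    have : Measurable (fun p : A × B => f p.1 p.2 ^ (2 : ℝ)) := hf.pow_const _
    exact this.lintegral_prod_right'.pow_const _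
  have hg : Measurable (fun b => ∫⁻ a, f a b ∂m) := by
    have : Measurable (fun p : B × A => f p.2 p.1) := hf.comp measurable_swap
    exact this.lintegral_prod_right'
  have key : ∫⁻ b, (∫⁻ a, f a b ∂m) ^ (2 : ℝ) ∂ν ≤ (∫⁻ a, N a ∂m) ^ (2 : ℝ) := by
    calc ∫⁻ b, (∫⁻ a, f a b ∂m) ^ (2 : ℝ) ∂ν
        = ∫⁻ b, ∫⁻ a, f a b * ∫⁻ a', f a' b ∂m ∂m ∂ν := by
          refine lintegral_congr fun b => ?_
          rw [lintegral_mul_const _ (hfb b), ENNReal.rpow_two, sq]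
      _ = ∫⁻ a, ∫⁻ b, f a b * ∫⁻ a', f a' b ∂m ∂ν ∂m := by
          refine lintegral_lintegral_swap (Measurable.aemeasurable ?_)
          exact (hf.comp measurable_swap).mul (hg.comp measurable_fst)
      _ = ∫⁻ a, ∫⁻ a', ∫⁻ b, f a b * f a' b ∂ν ∂m ∂m := by
          refine lintegral_congr fun a => ?_
          have h1 : ∀ b, f a b * ∫⁻ a', f a' b ∂m = ∫⁻ a', f a b * f a' b ∂m := fun b =>
            (lintegral_const_mul _ (hfb b)).symm
          simp_rw [h1]
          refine lintegral_lintegral_swap (Measurable.aemeasurable ?_)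
          exact ((hfa a).comp measurable_fst).mul (hf.comp measurable_swap)
      _ ≤ ∫⁻ a, ∫⁻ a', N a * N a' ∂m ∂m := by
          refine lintegral_mono fun a => lintegral_mono fun a' => ?_
          exact lintegral_mul_le_sqrt_mul_sqrt (hfa a).aemeasurable (hfa a').aemeasurable
      _ = (∫⁻ a, N a ∂m) ^ (2 : ℝ) := by
          simp_rw [lintegral_const_mul _ hNm]
          rw [lintegral_mul_const _ hNm, ENNReal.rpow_two, sq]
  calc _ ≤ ((∫⁻ a, N a ∂m) ^ (2 : ℝ)) ^ (1 / 2 : ℝ) := by gcongr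
    _ = _ := by rw [← ENNReal.rpow_mul]; norm_num

lemma eLpNorm_two_eq {B : Type*} [MeasurableSpace B] {ν : Measure B} (f : B → ℂ) :
    eLpNorm f 2 ν = (∫⁻ b, ‖f b‖ₑ ^ (2 : ℝ) ∂ν) ^ (1 / 2 : ℝ) := by
  rw [eLpNorm_eq_lintegral_rpow_enorm_toReal (by norm_num) (by norm_num)]
  norm_num

/-- Minkowski's integral inequality for Bochner integrals: the `L²` norm of an integral is at most
the integral of the `L²` norms. -/
lemma eLpNorm_integral_le {A B : Type*} [MeasurableSpace A] [MeasurableSpace B]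
    {m : Measure A} {ν : Measure B} [SFinite m] [SFinite ν] {f : A → B → ℂ}
    (hf : AEStronglyMeasurable (Function.uncurry f) (m.prod ν)) :
    eLpNorm (fun b => ∫ a, f a b ∂m) 2 ν ≤ ∫⁻ a, eLpNorm (f a) 2 ν ∂m := by
  obtain ⟨g, hg, hfg⟩ := hf
  have h1 : ∀ᵐ b ∂ν, ∀ᵐ a ∂m, f a b = g (a, b) := by
    have := (Measure.measurePreserving_swap (μ := ν) (ν := m)).quasiMeasurePreserving.ae hfg
    exact Measure.ae_ae_of_ae_prod this
  have h2 : ∀ᵐ a ∂m, ∀ᵐ b ∂ν, f a b = g (a, b) := Measure.ae_ae_of_ae_prod hfg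
  calc eLpNorm (fun b => ∫ a, f a b ∂m) 2 ν
      ≤ (∫⁻ b, (∫⁻ a, ‖g (a, b)‖ₑ ∂m) ^ (2 : ℝ) ∂ν) ^ (1 / 2 : ℝ) := by
        rw [eLpNorm_two_eq]
        refine ENNReal.rpow_le_rpow (lintegral_mono_ae ?_) (by norm_num)
        filter_upwards [h1] with b hb
        refine ENNReal.rpow_le_rpow ?_ (by norm_num)
        refine (enorm_integral_le_lintegral_enorm _).trans (le_of_eq ?_)
        exact lintegral_congr_ae (by filter_upwards [hb] with a ha; rw [ha])
    _ ≤ ∫⁻ a, (∫⁻ b, ‖g (a, b)‖ₑ ^ (2 : ℝ) ∂ν) ^ (1 / 2 : ℝ) ∂m :=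
        sqrt_lintegral_sq_lintegral_le (f := fun a b => ‖g (a, b)‖ₑ) hg.measurable.enorm
    _ = ∫⁻ a, eLpNorm (f a) 2 ν ∂m := by
        refine lintegral_congr_ae ?_
        filter_upwards [h2] with a ha
        rw [eLpNorm_two_eq]
        congr 1
        exact lintegral_congr_ae (by filter_upwards [ha] with b hb; rw [hb])

/-! ### Area mean value inequality and pointwise bounds on the strip -/

/-- Mean value inequality on circles, in the polar coordinates of `Complex.polarCoord`. -/
lemma two_pi_mul_enorm_le_lintegral_circle {f : ℂ → ℂ} {x : ℂ} {R r : ℝ} (hr : 0 < r) (hrR : r < R)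
    (hf : DifferentiableOn ℂ f (Metric.ball x R)) :
    ENNReal.ofReal (2 * Real.pi) * ‖f x‖ₑ ≤
      ∫⁻ φ in Ioo (-Real.pi) Real.pi, ‖f (x + Complex.polarCoord.symm (r, φ))‖ₑ := by
  have hd : DiffContOnCl ℂ f (Metric.ball x |r|) := by
    rw [abs_of_pos hr]
    exact (hf.mono (Metric.closedBall_subset_ball hrR)).diffContOnCl_ball subset_rfl
  have h1 := hd.circleAverage
  have hper : Function.Periodic (fun θ => f (circleMap x r θ)) (2 * Real.pi) := fun θ => by
    simp only [periodic_circleMap x r θ]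
  have h2 := hper.intervalIntegral_add_eq (-Real.pi) 0
  rw [Real.circleAverage_def] at h1
  rw [zero_add] at h2
  rw [← h2, show -Real.pi + 2 * Real.pi = Real.pi by ring,
    intervalIntegral.integral_of_le (by linarith [Real.pi_pos]),
    integral_Ioc_eq_integral_Ioo] at h1
  have h3 : ∀ φ, circleMap x r φ = x + Complex.polarCoord.symm (r, φ) := fun φ => by
    rw [Complex.polarCoord_symm_apply, circleMap, Complex.exp_mul_I]
    simp
  have h4 : ((2 * Real.pi : ℝ)) • f x =
      ∫ φ in Ioo (-Real.pi) Real.pi, f (x + Complex.polarCoord.symm (r, φ)) := by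
    rw [← h1, smul_inv_smul₀ (by positivity)]
    simp only [h3]
  calc ENNReal.ofReal (2 * Real.pi) * ‖f x‖ₑ = ‖(2 * Real.pi : ℝ) • f x‖ₑ := by
        rw [enorm_smul, Real.enorm_eq_ofReal (by positivity)]
    _ ≤ _ := by
        rw [h4]
        exact enorm_integral_le_lintegral_enorm _

/-- Mean value inequality on discs. -/
lemma enorm_mul_le_lintegral_ball {f : ℂ → ℂ} {x : ℂ} {R : ℝ} (hR : 0 < R)
    (hf : DifferentiableOn ℂ f (Metric.ball x R)) :
    ENNReal.ofReal (R / 2 * (R / 2) * (2 * Real.pi)) * ‖f x‖ₑ ≤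
      ∫⁻ z, (Metric.ball (0 : ℂ) R).indicator (fun z => ‖f (x + z)‖ₑ) z := by
  set G : ℂ → ℝ≥0∞ := (Metric.ball (0 : ℂ) R).indicator (fun z => ‖f (x + z)‖ₑ) with hG
  have hGm : Measurable G := by
    classical
    rw [hG, ← Set.piecewise_eq_indicator]
    refine ContinuousOn.measurable_piecewise ?_ continuousOn_const Metric.isOpen_ball.measurableSet
    refine ContinuousOn.enorm (hf.continuousOn.comp (by fun_prop) fun z hz => ?_)
    simpa using hz
  have hpm : Measurable (fun p : ℝ × ℝ => Complex.polarCoord.symm p) := by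
    simp only [Complex.polarCoord_symm_apply]
    fun_prop
  rw [← Complex.lintegral_comp_polarCoord_symm G]
  have htar : polarCoord.target = Ioi (0 : ℝ) ×ˢ Ioo (-Real.pi) Real.pi := rfl
  rw [htar, Measure.volume_eq_prod, ← Measure.prod_restrict, lintegral_prod]
  swap
  · exact (((ENNReal.measurable_ofReal.comp measurable_fst).smul
      (hGm.comp hpm))).aemeasurable
  calc ENNReal.ofReal (R / 2 * (R / 2) * (2 * Real.pi)) * ‖f x‖ₑ
      = ∫⁻ _ in Ioo (R / 2) R, ENNReal.ofReal (R / 2) * (ENNReal.ofReal (2 * Real.pi) * ‖f x‖ₑ) := by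
        rw [setLIntegral_const, Real.volume_Ioo, ENNReal.ofReal_mul (by positivity),
          ENNReal.ofReal_mul (by positivity), show R - R / 2 = R / 2 by ring]
        ring
    _ ≤ ∫⁻ r in Ioo (R / 2) R, ∫⁻ φ in Ioo (-Real.pi) Real.pi,
          ENNReal.ofReal r • G (Complex.polarCoord.symm (r, φ)) := by
        refine setLIntegral_mono' measurableSet_Ioo fun r hr => ?_
        have hr0 : 0 < r := by linarith [hr.1]
        have hrw : ∀ φ, G (Complex.polarCoord.symm (r, φ)) =
            ‖f (x + Complex.polarCoord.symm (r, φ))‖ₑ := fun φ => by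
          rw [hG, indicator_of_mem]
          rw [mem_ball_zero_iff, Complex.norm_polarCoord_symm, abs_of_pos hr0]
          exact hr.2
        simp only [hrw, smul_eq_mul]
        rw [lintegral_const_mul' _ _ ENNReal.ofReal_ne_top]
        gcongr
        · exact hr.1.le
        · exact two_pi_mul_enorm_le_lintegral_circle hr0 hr.2 hf
    _ ≤ _ := lintegral_mono_set fun r hr => by
        have := hr.1
        simp only [mem_Ioi]; linarith

/-- The `L¹` norm on a disc inside the strip is bounded by the norm of `H^{0,ρ}`: apply the
Cauchy–Schwarz inequality on each horizontal line. -/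
lemma lintegral_ball_le_of_strip {f : ℂ → ℂ} {x : ℂ} {R ρ : ℝ}
    (hsub : Metric.ball x R ⊆ strip ρ) (hf : ContinuousOn f (strip ρ)) :
    ∫⁻ z, (Metric.ball (0 : ℂ) R).indicator (fun z => ‖f (x + z)‖ₑ) z ≤
      ENNReal.ofReal (2 * R) * (ENNReal.ofReal (2 * R) ^ (1 / 2 : ℝ) * hNorm 0 ρ f) := by
  set G : ℂ → ℝ≥0∞ := (Metric.ball (0 : ℂ) R).indicator (fun z => ‖f (x + z)‖ₑ) with hG
  have hGm : Measurable G := by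
    classical
    rw [hG, ← Set.piecewise_eq_indicator]
    refine ContinuousOn.measurable_piecewise ?_ continuousOn_const Metric.isOpen_ball.measurableSet
    refine ContinuousOn.enorm ((hf.mono hsub).comp (by fun_prop) fun z hz => ?_)
    simpa using hz
  have hmp := Complex.volume_preserving_equiv_real_prod.symm
  have h1 : ∫⁻ z, G z = ∫⁻ p : ℝ × ℝ, G (Complex.measurableEquivRealProd.symm p) :=
    (hmp.lintegral_comp hGm).symm
  rw [h1, Measure.volume_eq_prod, lintegral_prod_symm]
  swap
  · exact (hGm.comp (MeasurableEquiv.measurable _)).aemeasurable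
  calc _ ≤ ∫⁻ y in Ioo (-R) R, ENNReal.ofReal (2 * R) ^ (1 / 2 : ℝ) * hNorm 0 ρ f := by
        rw [← lintegral_indicator measurableSet_Ioo]
        refine lintegral_mono fun y => ?_
        by_cases hy : y ∈ Ioo (-R) R
        · rw [indicator_of_mem hy]
          have hxy : x.im + y ∈ Ioo (-ρ) ρ := by
            have : x + y * Complex.I ∈ strip ρ := hsub (by
              rw [Metric.mem_ball, dist_eq_norm, add_sub_cancel_left, norm_mul, Complex.norm_I,
                mul_one, Complex.norm_real, Real.norm_eq_abs]
              exact abs_lt.2 hy)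
            simpa [strip] using this
          have hfy : Measurable (fun ξ : ℝ => ‖f ((ξ : ℂ) + ((x.im + y : ℝ) : ℂ) * Complex.I)‖ₑ) := by
            refine Continuous.measurable (Continuous.enorm ?_)
            refine hf.comp_continuous (by fun_prop) fun ξ => ?_
            simpa [strip] using hxy
          have hfx : Measurable (fun ξ : ℝ =>
              ‖f (((x.re + ξ : ℝ) : ℂ) + ((x.im + y : ℝ) : ℂ) * Complex.I)‖ₑ) :=
            hfy.comp (measurable_const_add x.re)
          calc ∫⁻ ξ, G (Complex.measurableEquivRealProd.symm (ξ, y))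
              ≤ ∫⁻ ξ, (Ioo (-R) R).indicator 1 ξ *
                ‖f (((x.re + ξ : ℝ) : ℂ) + ((x.im + y : ℝ) : ℂ) * Complex.I)‖ₑ := by
                refine lintegral_mono fun ξ => ?_
                rw [hG]
                refine indicator_apply_le' (fun h => ?_) (fun _ => zero_le)
                have hξ : ξ ∈ Ioo (-R) R := by
                  rw [mem_ball_zero_iff] at h
                  have := (Complex.abs_re_le_norm _).trans_lt h
                  exact abs_lt.1 (by simpa using this)
                rw [indicator_of_mem hξ, Pi.one_apply, one_mul]
                refine le_of_eq ?_
                congr 2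
                apply Complex.ext <;> simp
            _ ≤ (∫⁻ ξ, (Ioo (-R) R).indicator 1 ξ ^ (2 : ℝ)) ^ (1 / 2 : ℝ) *
                (∫⁻ ξ : ℝ, ‖f (((x.re + ξ : ℝ) : ℂ) +
                  ((x.im + y : ℝ) : ℂ) * Complex.I)‖ₑ ^ (2 : ℝ)) ^ (1 / 2 : ℝ) :=
                lintegral_mul_le_sqrt_mul_sqrt
                  ((measurable_one.indicator measurableSet_Ioo).aemeasurable) hfx.aemeasurable
            _ ≤ ENNReal.ofReal (2 * R) ^ (1 / 2 : ℝ) * hNorm 0 ρ f := by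
                gcongr
                · have : ∀ ξ : ℝ, ((Ioo (-R) R).indicator 1 ξ : ℝ≥0∞) ^ (2 : ℝ) =
                      (Ioo (-R) R).indicator 1 ξ := fun ξ => by
                    by_cases h : ξ ∈ Ioo (-R) R <;> simp [h]
                  simp_rw [this]
                  rw [lintegral_indicator_one measurableSet_Ioo, Real.volume_Ioo]
                  exact le_of_eq (by ring_nf)
                · rw [lintegral_add_left_eq_self (fun ξ : ℝ => ‖f ((ξ : ℂ) +
                    ((x.im + y : ℝ) : ℂ) * Complex.I)‖ₑ ^ (2 : ℝ)) x.re, ← eLpNorm_two_eq]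
                  unfold hNorm
                  simp only [zero_add, Finset.range_one, Finset.sum_singleton, iteratedDeriv_zero]
                  exact le_iSup₂ (f := fun (y : ℝ) (_ : y ∈ Ioo (-ρ) ρ) =>
                    eLpNorm (fun ξ : ℝ => f ((ξ : ℂ) + (y : ℂ) * Complex.I)) 2 volume) _ hxy
        · rw [indicator_of_notMem hy]
          refine le_of_eq (lintegral_eq_zero_of_ae_eq_zero (Eventually.of_forall fun ξ => ?_))
          rw [hG]
          refine indicator_of_notMem (fun h => hy ?_) _
          rw [mem_ball_zero_iff] at h
          have := (Complex.abs_im_le_norm _).trans_lt h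
          exact abs_lt.1 (by simpa using this)
    _ = _ := by
        rw [setLIntegral_const, Real.volume_Ioo, show R - -R = 2 * R by ring, mul_comm]

/-- Point evaluation is bounded for the norm of `H^{0,ρ}`, with a constant depending only on the
distance to the boundary of the strip. -/
lemma exists_enorm_le_mul_hNorm {R : ℝ} (hR : 0 < R) :
    ∃ C : ℝ, 0 ≤ C ∧ ∀ (ρ : ℝ) (f : ℂ → ℂ) (x : ℂ), Metric.ball x R ⊆ strip ρ →
      DifferentiableOn ℂ f (strip ρ) → ‖f x‖ₑ ≤ ENNReal.ofReal C * hNorm 0 ρ f := by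
  refine ⟨(R / 2 * (R / 2) * (2 * Real.pi))⁻¹ * (2 * R * (2 * R) ^ (1 / 2 : ℝ)), by positivity,
    fun ρ f x hsub hf => ?_⟩
  have h := (enorm_mul_le_lintegral_ball hR (hf.mono hsub)).trans
    (lintegral_ball_le_of_strip hsub hf.continuousOn)
  have hc : 0 < R / 2 * (R / 2) * (2 * Real.pi) := by positivity
  generalize R / 2 * (R / 2) * (2 * Real.pi) = c at h hc ⊢
  rw [ENNReal.ofReal_mul (by positivity), ENNReal.ofReal_mul (p := 2 * R) (by positivity),
    ← ENNReal.ofReal_rpow_of_pos (by positivity), mul_assoc, mul_assoc, ENNReal.ofReal_inv_of_pos hc,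
    mul_comm (ENNReal.ofReal _)⁻¹, ← div_eq_mul_inv]
  rw [ENNReal.le_div_iff_mul_le (Or.inl (by simpa using hc)) (Or.inl ENNReal.ofReal_ne_top), mul_comm]
  exact h

/-! ### Osgood's lemma in two variables -/

/-- The resolvent `x ↦ (e - x)⁻¹` in the Banach algebra `C(K, ℂ)` is analytic off the range of `e`.
-/
lemma analyticAt_ringInverse_sub {K : Type*} [TopologicalSpace K] [CompactSpace K] {e : C(K, ℂ)}
    {x : ℂ} (hx : ∀ k, e k ≠ x) :
    AnalyticAt ℂ (fun x : ℂ => Ring.inverse (e - algebraMap ℂ C(K, ℂ) x)) x := by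
  have hu : IsUnit (e - algebraMap ℂ C(K, ℂ) x) := by
    rw [ContinuousMap.isUnit_iff_forall_ne_zero]
    intro k
    simpa [sub_eq_zero] using hx k
  obtain ⟨v, hv⟩ := hu
  have h1 : AnalyticAt ℂ Ring.inverse (e - algebraMap ℂ C(K, ℂ) x) := hv ▸ analyticAt_inverse v
  have h2 : AnalyticAt ℂ (fun x : ℂ => e - algebraMap ℂ C(K, ℂ) x) x :=
    analyticAt_const.sub ((Algebra.linearMap ℂ C(K, ℂ)).mkContinuous 1 (fun z => by
      rw [Algebra.linearMap_apply, norm_algebraMap]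
      refine mul_le_mul_of_nonneg_right ?_ (norm_nonneg z) |>.trans_eq' (mul_comm _ _)
      exact (ContinuousMap.norm_le _ zero_le_one).2 fun k => by simp) |>.analyticAt x)
  exact AnalyticAt.fun_comp h1 h2

lemma ringInverse_sub_apply {K : Type*} [TopologicalSpace K] [CompactSpace K] {e : C(K, ℂ)}
    {x : ℂ} (hx : ∀ k, e k ≠ x) (k : K) :
    Ring.inverse (e - algebraMap ℂ C(K, ℂ) x) k = (e k - x)⁻¹ := by
  have hu : IsUnit (e - algebraMap ℂ C(K, ℂ) x) := by
    rw [ContinuousMap.isUnit_iff_forall_ne_zero]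
    intro k
    simpa [sub_eq_zero] using hx k
  have h := congrArg (fun f : C(K, ℂ) => f k) (Ring.inverse_mul_cancel _ hu)
  have hk : e k - x ≠ 0 := sub_ne_zero.2 (hx k)
  simp only [ContinuousMap.mul_apply, ContinuousMap.sub_apply, ContinuousMap.one_apply,
    algebraMap_apply, smul_eq_mul, mul_one] at h
  exact eq_inv_of_mul_eq_one_left h

/-- Integration over a compact space with a finite measure, as a continuous linear functional. -/
noncomputable def integralCLM (K : Type*) [TopologicalSpace K] [CompactSpace K] [MeasurableSpace K]
    [BorelSpace K] (m : Measure K) [IsFiniteMeasure m] : C(K, ℂ) →L[ℂ] ℂ :=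
  LinearMap.mkContinuous
    { toFun := fun f => ∫ k, f k ∂m
      map_add' := fun f g => integral_add (f.continuous.integrable_of_hasCompactSupport
        (HasCompactSupport.of_compactSpace _)) (g.continuous.integrable_of_hasCompactSupport
        (HasCompactSupport.of_compactSpace _))
      map_smul' := fun c f => integral_smul c _ }
    (m.real univ) fun f => by
      rw [mul_comm]
      exact norm_integral_le_of_norm_le_const (Eventually.of_forall fun k => f.norm_coe_le_norm k)

lemma circleIntegral_eq_integral_subtype (h : ℂ → ℂ) (c : ℂ) (r : ℝ) :
    ∮ z in C(c, r), h z = ∫ k : Icc (0 : ℝ) (2 * Real.pi),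
      deriv (circleMap c r) k * h (circleMap c r k) ∂(Measure.comap Subtype.val volume) := by
  rw [integral_subtype_comap measurableSet_Icc
    (fun k => deriv (circleMap c r) k * h (circleMap c r k)), integral_Icc_eq_integral_Ioc,
    ← intervalIntegral.integral_of_le (by positivity)]
  rfl

/-- **Osgood's lemma** in two variables: a bounded separately holomorphic function is analytic.
The double Cauchy integral writes `f` as a continuous linear functional applied to the product of
two resolvents in the Banach algebra `C(K, ℂ)`, which depend analytically on `(x, Y)`. -/
lemma analyticAt_of_separately {f : ℂ → ℂ → ℂ} {x₀ Y₀ : ℂ} {R B : ℝ} (hR : 0 < R)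
    (hx : ∀ Y ∈ Metric.ball Y₀ R, DifferentiableOn ℂ (fun x => f x Y) (Metric.ball x₀ R))
    (hY : ∀ x ∈ Metric.ball x₀ R, DifferentiableOn ℂ (f x) (Metric.ball Y₀ R))
    (hB : ∀ x ∈ Metric.ball x₀ R, ∀ Y ∈ Metric.ball Y₀ R, ‖f x Y‖ ≤ B) :
    AnalyticAt ℂ (fun p : ℂ × ℂ => f p.1 p.2) (x₀, Y₀) := by
  -- joint continuity: `f` is Lipschitz in `x`, uniformly in `Y`, by Cauchy's estimate
  have hcont : ContinuousOn (fun p : ℂ × ℂ => f p.1 p.2)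
      (Metric.closedBall x₀ (R / 2) ×ˢ Metric.closedBall Y₀ (R / 2)) := by
    refine continuousOn_prod_of_continuousOn_lipschitzOnWith _ (Real.toNNReal (B / (R / 4))) ?_ ?_
    · intro x hx'
      exact (hY x (Metric.closedBall_subset_ball (by linarith) hx')).continuousOn.mono
        (Metric.closedBall_subset_ball (by linarith))
    · intro Y hY'
      have hYb := Metric.closedBall_subset_ball (show R / 2 < R by linarith) hY'
      refine (convex_closedBall x₀ (R / 2)).lipschitzOnWith_of_nnnorm_deriv_le (𝕜 := ℂ) ?_ ?_
      · intro x hx'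
        exact (hx Y hYb).differentiableAt (Metric.isOpen_ball.mem_nhds
          (Metric.closedBall_subset_ball (by linarith) hx'))
      · intro x hx'
        have hsub : Metric.closedBall x (R / 4) ⊆ Metric.ball x₀ R := by
          intro y hy
          rw [Metric.mem_closedBall] at hy hx'
          rw [Metric.mem_ball]
          linarith [dist_triangle y x x₀]
        have := Complex.norm_deriv_le_of_forall_mem_sphere_norm_le (f := fun x => f x Y)
          (show 0 < R / 4 by positivity) (((hx Y hYb).mono hsub).diffContOnCl_ball subset_rfl)
          (C := B) (fun z hz => hB z (hsub (Metric.sphere_subset_closedBall hz)) Y hYb)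
        rw [← NNReal.coe_le_coe, coe_nnnorm]
        exact this.trans (Real.le_coe_toNNReal _)
  -- the integration variables, two angles, form the compact space `I × I`
  set r := R / 2 with hr
  have hr0 : 0 < r := by positivity
  let I := Icc (0 : ℝ) (2 * Real.pi)
  let m : Measure I := Measure.comap Subtype.val volume
  have : IsFiniteMeasure m := ⟨by
    rw [Measure.comap_apply _ Subtype.val_injective
      (fun s hs => measurableSet_Icc.subtype_image hs) _ MeasurableSet.univ, image_univ,
      Subtype.range_val]
    exact measure_Icc_lt_top⟩
  let e₁ : C(I × I, ℂ) := ⟨fun k => circleMap x₀ r k.1, by fun_prop⟩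
  let e₂ : C(I × I, ℂ) := ⟨fun k => circleMap Y₀ r k.2, by fun_prop⟩
  let h : C(I × I, ℂ) := ⟨fun k => deriv (circleMap x₀ r) k.1 * (deriv (circleMap Y₀ r) k.2 *
    f (circleMap x₀ r k.1) (circleMap Y₀ r k.2)), by
      have : Continuous fun k : I × I => f (circleMap x₀ r k.1) (circleMap Y₀ r k.2) :=
        hcont.comp_continuous (f := fun k : I × I => (circleMap x₀ r k.1, circleMap Y₀ r k.2))
          (by fun_prop) fun k => ⟨circleMap_mem_closedBall _ hr0.le _,
            circleMap_mem_closedBall _ hr0.le _⟩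
      have h1 : Continuous fun k : I × I => circleMap 0 r (k.1 : ℝ) :=
        (continuous_circleMap 0 r).comp (by fun_prop)
      have h2 : Continuous fun k : I × I => circleMap 0 r (k.2 : ℝ) :=
        (continuous_circleMap 0 r).comp (by fun_prop)
      simp only [deriv_circleMap]
      exact (h1.mul continuous_const).mul ((h2.mul continuous_const).mul this)⟩
  have hne : ∀ (c x : ℂ) (θ : ℝ), x ∈ Metric.ball c r → circleMap c r θ ≠ x := fun c x θ hx' he => by
    have := circleMap_mem_sphere c hr0.le θ
    rw [he, Metric.mem_sphere] at this
    rw [Metric.mem_ball] at hx'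
    linarith
  have han : AnalyticAt ℂ (fun p : ℂ × ℂ => (2 * Real.pi * Complex.I : ℂ)⁻¹ *
      ((2 * Real.pi * Complex.I : ℂ)⁻¹ * integralCLM (I × I) (m.prod m)
      (h * (Ring.inverse (e₁ - algebraMap ℂ C(I × I, ℂ) p.1) *
        Ring.inverse (e₂ - algebraMap ℂ C(I × I, ℂ) p.2))))) (x₀, Y₀) := by
    have a1 : AnalyticAt ℂ (fun p : ℂ × ℂ => Ring.inverse (e₁ - algebraMap ℂ C(I × I, ℂ) p.1))
        (x₀, Y₀) :=
      AnalyticAt.fun_comp (g := fun x : ℂ => Ring.inverse (e₁ - algebraMap ℂ C(I × I, ℂ) x))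
        (f := fun p : ℂ × ℂ => p.1)
        (analyticAt_ringInverse_sub fun k => hne _ _ _ (Metric.mem_ball_self hr0)) analyticAt_fst
    have a2 : AnalyticAt ℂ (fun p : ℂ × ℂ => Ring.inverse (e₂ - algebraMap ℂ C(I × I, ℂ) p.2))
        (x₀, Y₀) :=
      AnalyticAt.fun_comp (g := fun x : ℂ => Ring.inverse (e₂ - algebraMap ℂ C(I × I, ℂ) x))
        (f := fun p : ℂ × ℂ => p.2)
        (analyticAt_ringInverse_sub fun k => hne _ _ _ (Metric.mem_ball_self hr0)) analyticAt_snd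
    refine analyticAt_const.mul (analyticAt_const.mul ?_)
    exact AnalyticAt.fun_comp ((integralCLM (I × I) (m.prod m)).analyticAt _)
      (analyticAt_const.mul (a1.mul a2))
  refine han.congr ?_
  have hnhds : Metric.ball x₀ r ×ˢ Metric.ball Y₀ r ∈ 𝓝 (x₀, Y₀) :=
    prod_mem_nhds (Metric.ball_mem_nhds _ hr0) (Metric.ball_mem_nhds _ hr0)
  filter_upwards [hnhds] with p hp
  obtain ⟨x, Y⟩ := p
  obtain ⟨hpx, hpY⟩ := hp
  simp only at hpx hpY ⊢
  have hrR : r < R := by rw [hr]; linarith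
  have hpi : (2 * Real.pi * Complex.I : ℂ) ≠ 0 := by simp [Real.pi_ne_zero]
  have c1 : ∮ z in C(x₀, r), (z - x)⁻¹ • f z Y = (2 * Real.pi * Complex.I) • f x Y :=
    DiffContOnCl.circleIntegral_sub_inv_smul
      (((hx Y (Metric.ball_subset_ball hrR.le hpY)).mono
        (Metric.closedBall_subset_ball hrR)).diffContOnCl_ball subset_rfl) hpx
  have c2 : ∀ z ∈ Metric.closedBall x₀ r, ∮ η in C(Y₀, r), (η - Y)⁻¹ • f z η =
      (2 * Real.pi * Complex.I) • f z Y := fun z hz =>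
    DiffContOnCl.circleIntegral_sub_inv_smul
      (((hY z (Metric.closedBall_subset_ball hrR hz)).mono
        (Metric.closedBall_subset_ball hrR)).diffContOnCl_ball subset_rfl) hpY
  have hint : integralCLM (I × I) (m.prod m)
      (h * (Ring.inverse (e₁ - algebraMap ℂ C(I × I, ℂ) x) *
        Ring.inverse (e₂ - algebraMap ℂ C(I × I, ℂ) Y))) =
      (2 * Real.pi * Complex.I) * ((2 * Real.pi * Complex.I) * f x Y) := by
    set g : C(I × I, ℂ) := h * (Ring.inverse (e₁ - algebraMap ℂ C(I × I, ℂ) x) *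
        Ring.inverse (e₂ - algebraMap ℂ C(I × I, ℂ) Y)) with hg
    have : integralCLM (I × I) (m.prod m) g = ∫ k, g k ∂(m.prod m) := rfl
    rw [this, integral_prod _ (g.continuous.integrable_of_hasCompactSupport
        (HasCompactSupport.of_compactSpace _))]
    have hgk : ∀ k l : I, g (k, l) = deriv (circleMap x₀ r) k * (circleMap x₀ r k - x)⁻¹ *
        (deriv (circleMap Y₀ r) l * ((circleMap Y₀ r l - Y)⁻¹ • f (circleMap x₀ r k)
          (circleMap Y₀ r l))) := fun k l => by
      rw [hg, ContinuousMap.mul_apply, ContinuousMap.mul_apply,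
        ringInverse_sub_apply (fun k => hne _ _ _ hpx), ringInverse_sub_apply (fun k => hne _ _ _ hpY)]
      simp only [h, e₁, e₂, ContinuousMap.coe_mk, smul_eq_mul]
      ring
    simp_rw [hgk, integral_const_mul]
    have hin : ∀ k : I, ∫ l : I, deriv (circleMap Y₀ r) l * ((circleMap Y₀ r l - Y)⁻¹ •
        f (circleMap x₀ r k) (circleMap Y₀ r l)) ∂m =
        (2 * Real.pi * Complex.I) * f (circleMap x₀ r k) Y := fun k => by
      have := circleIntegral_eq_integral_subtype
        (fun η => (η - Y)⁻¹ • f (circleMap x₀ r k) η) Y₀ r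
      rw [c2 _ (circleMap_mem_closedBall _ hr0.le _)] at this
      exact this.symm
    simp_rw [hin]
    have := circleIntegral_eq_integral_subtype (fun z => (z - x)⁻¹ • f z Y) x₀ r
    rw [c1] at this
    rw [← smul_eq_mul _ (f x Y), this, ← integral_const_mul]
    refine integral_congr_ae (Eventually.of_forall fun k => ?_)
    simp only [smul_eq_mul]
    ring
  rw [hint]
  field_simp

/-! ### Geometry of strips and sectors -/

/-- The open sector `{z : Re z > 0, |Im z| < Re z tan θ}`. -/
def openSector (θ : ℝ) : Set ℂ := {z | 0 < z.re ∧ |z.im| < z.re * Real.tan θ}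

lemma isOpen_strip (ρ : ℝ) : IsOpen (strip ρ) := isOpen_Ioo.preimage Complex.continuous_im

lemma isOpen_openSector (θ : ℝ) : IsOpen (openSector θ) :=
  (isOpen_lt continuous_const Complex.continuous_re).inter
    (isOpen_lt (Complex.continuous_im.abs) (Complex.continuous_re.mul continuous_const))

lemma openSector_subset_sector (θ : ℝ) : openSector θ ⊆ sector θ := fun _ hz => ⟨hz.1.le, hz.2.le⟩

lemma openSector_subset_interior (θ : ℝ) : openSector θ ⊆ interior (sector θ) :=
  interior_maximal (openSector_subset_sector θ) (isOpen_openSector θ)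

lemma zero_mem_sector (θ : ℝ) : (0 : ℂ) ∈ sector θ := by simp [sector]

lemma convex_openSector (θ : ℝ) : Convex ℝ (openSector θ) := by
  intro z hz w hw a b ha hb hab
  simp only [openSector, mem_ofPred_eq, Complex.add_re, Complex.add_im, Complex.real_smul,
    Complex.re_ofReal_mul, Complex.im_ofReal_mul] at hz hw ⊢
  rcases ha.eq_or_lt with rfl | ha'
  · obtain rfl : b = 1 := by linarith
    simpa using hw
  · refine ⟨by nlinarith [hz.1, hw.1], ?_⟩
    calc |a * z.im + b * w.im| ≤ a * |z.im| + b * |w.im| := by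
          refine (abs_add_le _ _).trans ?_
          rw [abs_mul, abs_mul, abs_of_nonneg ha, abs_of_nonneg hb]
      _ < (a * z.re + b * w.re) * Real.tan θ := by nlinarith [hz.2, hw.2]

lemma convex_sector (θ : ℝ) : Convex ℝ (sector θ) := by
  intro z hz w hw a b ha hb hab
  simp only [sector, mem_ofPred_eq, Complex.add_re, Complex.add_im, Complex.real_smul,
    Complex.re_ofReal_mul, Complex.im_ofReal_mul] at hz hw ⊢
  refine ⟨by nlinarith [hz.1, hw.1], ?_⟩
  calc |a * z.im + b * w.im| ≤ a * |z.im| + b * |w.im| := by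
        refine (abs_add_le _ _).trans ?_
        rw [abs_mul, abs_mul, abs_of_nonneg ha, abs_of_nonneg hb]
    _ ≤ (a * z.re + b * w.re) * Real.tan θ := by nlinarith [hz.2, hw.2]

lemma ofReal_mem_openSector {θ : ℝ} (hθ : 0 < Real.tan θ) {r : ℝ} (hr : 0 < r) :
    (r : ℂ) ∈ openSector θ := by
  simp only [openSector, mem_ofPred_eq, Complex.ofReal_re, Complex.ofReal_im, abs_zero]
  exact ⟨hr, by positivity⟩

lemma mul_ofReal_mem_openSector {θ : ℝ} {z : ℂ} (hz : z ∈ openSector θ) {r : ℝ} (hr : 0 < r) :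
    (r : ℂ) * z ∈ openSector θ := by
  simp only [openSector, mem_ofPred_eq, Complex.re_ofReal_mul, Complex.im_ofReal_mul, abs_mul,
    abs_of_pos hr] at hz ⊢
  exact ⟨mul_pos hr hz.1, by nlinarith [hz.2]⟩

lemma mul_ofReal_mem_sector {θ : ℝ} {z : ℂ} (hz : z ∈ sector θ) {r : ℝ} (hr : 0 ≤ r) :
    (r : ℂ) * z ∈ sector θ := by
  simp only [sector, mem_ofPred_eq, Complex.re_ofReal_mul, Complex.im_ofReal_mul, abs_mul,
    abs_of_nonneg hr] at hz ⊢
  exact ⟨mul_nonneg hr hz.1, by nlinarith [hz.2]⟩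

lemma re_pos_of_mem_sector {θ : ℝ} {z : ℂ} (hz : z ∈ sector θ) (h0 : z ≠ 0) : 0 < z.re := by
  refine hz.1.lt_of_ne' fun h => h0 (Complex.ext h ?_)
  have := hz.2
  rw [h, zero_mul] at this
  exact abs_nonpos_iff.1 this

lemma sector_diff_zero_subset {θ' θ : ℝ} (h : Real.tan θ' < Real.tan θ) :
    sector θ' \ {0} ⊆ openSector θ := fun z hz => by
  have hre := re_pos_of_mem_sector hz.1 hz.2
  exact ⟨hre, hz.1.2.trans_lt (mul_lt_mul_of_pos_left h hre)⟩

lemma add_ofReal_mem_sector {θ : ℝ} (hθ : 0 < Real.tan θ) {z : ℂ} (hz : z ∈ sector θ) {r : ℝ}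
    (hr : 0 ≤ r) : z + (r : ℂ) ∈ sector θ := by
  simp only [sector, mem_ofPred_eq, Complex.add_re, Complex.add_im, Complex.ofReal_re,
    Complex.ofReal_im, add_zero] at hz ⊢
  exact ⟨by linarith [hz.1], by nlinarith [hz.2]⟩

lemma uniqueDiffOn_sector {θ : ℝ} (hθ : 0 < Real.tan θ) : UniqueDiffOn ℂ (sector θ) := by
  have : UniqueDiffOn ℝ (sector θ) := uniqueDiffOn_convex (convex_sector θ)
    ⟨((1 : ℝ) : ℂ), openSector_subset_interior θ (ofReal_mem_openSector hθ one_pos)⟩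
  exact this.mono_field

lemma isClosed_sector (θ : ℝ) : IsClosed (sector θ) :=
  (isClosed_le continuous_const Complex.continuous_re).inter
    (isClosed_le (Complex.continuous_im.abs) (Complex.continuous_re.mul continuous_const))

/-- In a sector of half-angle less than `π/4` the real part of `z²` is comparable to `‖z‖²`. -/
lemma mul_normSq_le_re_sq {θ : ℝ} (hθ0 : 0 < Real.tan θ) (hθ : Real.tan θ < 1) {z : ℂ}
    (hz : z ∈ sector θ) :
    (1 - Real.tan θ ^ 2) / 2 * ‖z‖ ^ 2 ≤ (z ^ 2).re := by
  rw [← Complex.normSq_eq_norm_sq, Complex.normSq_apply, sq z, Complex.mul_re]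
  obtain ⟨h1, h2⟩ := hz
  have h3 : z.im ^ 2 ≤ z.re ^ 2 * Real.tan θ ^ 2 := by
    rw [← sq_abs z.im, ← mul_pow]
    exact pow_le_pow_left₀ (abs_nonneg _) h2 2
  have h4 : Real.tan θ ^ 2 < 1 := by nlinarith
  have h5 : z.im ^ 2 ≤ z.re ^ 2 := h3.trans (mul_le_of_le_one_right (sq_nonneg _) h4.le)
  have h6 : (1 - Real.tan θ ^ 2) / 2 * (z.re * z.re + z.im * z.im) ≤
      (1 - Real.tan θ ^ 2) / 2 * (2 * z.re ^ 2) :=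
    mul_le_mul_of_nonneg_left (by nlinarith) (by linarith)
  nlinarith

/-- Every point of the sector lies on a ray through a point of modulus one of the sector. -/
lemma exists_eq_mul_of_mem_sector {θ : ℝ} (hθ : 0 < Real.tan θ) {Y : ℂ} (hY : Y ∈ sector θ) :
    ∃ ω ∈ sector θ, ‖ω‖ = 1 ∧ ∃ R : ℝ, 0 ≤ R ∧ Y = R * ω := by
  by_cases h0 : Y = 0
  · refine ⟨1, ?_, by simp, 0, le_rfl, by simp [h0]⟩
    simpa using openSector_subset_sector θ (ofReal_mem_openSector hθ one_pos)
  · have hn : 0 < ‖Y‖ := norm_pos_iff.2 h0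
    refine ⟨((‖Y‖⁻¹ : ℝ) : ℂ) * Y, mul_ofReal_mem_sector hY (by positivity), ?_, ‖Y‖, hn.le, ?_⟩
    · rw [norm_mul, Complex.norm_real, norm_inv, norm_norm, inv_mul_cancel₀ hn.ne']
    · rw [← mul_assoc, ← Complex.ofReal_mul, mul_inv_cancel₀ hn.ne', Complex.ofReal_one, one_mul]

/-! ### The heat kernel -/

/-- The derivative `∂_Y E(Y,t) = -Y/(2t) E(Y,t)` of the heat kernel. -/
noncomputable def heatKernelDeriv (Y : ℂ) (t : ℝ) : ℂ := -(Y / (2 * (t : ℂ))) * heatKernel Y t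

lemma hasDerivAt_heatKernel (Y : ℂ) (t : ℝ) :
    HasDerivAt (fun Y => heatKernel Y t) (heatKernelDeriv Y t) Y := by
  have h : HasDerivAt (fun Y : ℂ => -Y ^ 2 / (4 * (t : ℂ))) (-(Y / (2 * (t : ℂ)))) Y := by
    have := ((hasDerivAt_pow 2 Y).neg).div_const (4 * (t : ℂ))
    refine this.congr_deriv ?_
    push_cast
    ring
  refine ((h.cexp).const_mul (((1 / Real.sqrt (4 * Real.pi * t) : ℝ) : ℂ))).congr_deriv ?_
  rw [heatKernelDeriv, heatKernel]
  ring

lemma continuous_heatKernel (t : ℝ) : Continuous (fun Y => heatKernel Y t) := by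
  unfold heatKernel; fun_prop

lemma norm_heatKernel (Y : ℂ) (t : ℝ) :
    ‖heatKernel Y t‖ = 1 / Real.sqrt (4 * Real.pi * t) * Real.exp (-(Y ^ 2).re / (4 * t)) := by
  rw [heatKernel, norm_mul, Complex.norm_real, Complex.norm_exp, Real.norm_eq_abs,
    abs_of_nonneg (by positivity)]
  congr 2
  have : -Y ^ 2 / (4 * (t : ℂ)) = (-Y ^ 2) / ((4 * t : ℝ) : ℂ) := by push_cast; ring
  rw [this, Complex.div_ofReal_re, Complex.neg_re]

lemma norm_heatKernelDeriv (Y : ℂ) {t : ℝ} (ht : 0 < t) :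
    ‖heatKernelDeriv Y t‖ = ‖Y‖ / (2 * t) * ‖heatKernel Y t‖ := by
  rw [heatKernelDeriv, norm_mul, norm_neg, norm_div, norm_mul, Complex.norm_real, Real.norm_eq_abs,
    abs_of_pos ht]
  simp

/-- The kernel `∂_Y E(Y-z,t) - (-1)^a ∂_Y E(Y+z,t)` that acts on the `a`-th `Y`-derivative. The
reflection alternates with `a` because moving a derivative from `Y` to `z` changes the relative sign
of the two terms. -/
noncomputable def reflKernel (a : ℕ) (t : ℝ) (Y z : ℂ) : ℂ :=
  heatKernelDeriv (Y - z) t + (-1) ^ (a + 1) * heatKernelDeriv (Y + z) t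

lemma norm_reflKernel_le (a : ℕ) (t : ℝ) (Y z : ℂ) :
    ‖reflKernel a t Y z‖ ≤ ‖heatKernelDeriv (Y - z) t‖ + ‖heatKernelDeriv (Y + z) t‖ := by
  refine (norm_add_le _ _).trans ?_
  simp

lemma continuous_reflKernel (a : ℕ) (t : ℝ) {X : Type*} [TopologicalSpace X] {f g : X → ℂ}
    (hf : Continuous f) (hg : Continuous g) : Continuous (fun r => reflKernel a t (f r) (g r)) := by
  unfold reflKernel heatKernelDeriv heatKernel; fun_prop

/-- For bounded `Y` the kernels decay at least exponentially along every direction `z` with `Re z²`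
comparable to `‖z‖²`. -/
lemma exists_norm_heatKernel_sub_le {c t R : ℝ} (hc : 0 < c) (ht : 0 < t) (hR : 0 ≤ R) :
    ∃ A : ℝ, 0 ≤ A ∧ ∀ Y z : ℂ, ‖Y‖ ≤ R → c * ‖z‖ ^ 2 ≤ (z ^ 2).re →
      ‖heatKernel (Y - z) t‖ ≤ A * Real.exp (-‖z‖) ∧
      ‖heatKernelDeriv (Y - z) t‖ ≤ A * Real.exp (-‖z‖) := by
  set N := 1 / Real.sqrt (4 * Real.pi * t) with hN
  set A₀ := (R ^ 2 + (R + 4 * t) ^ 2 / c) / (4 * t) with hA₀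
  have hN0 : 0 ≤ N := by positivity
  have hA0 : 0 ≤ N * Real.exp A₀ := by positivity
  have hB0 : 0 ≤ N * Real.exp A₀ * ((R + 1) / (2 * t)) := by positivity
  refine ⟨N * Real.exp A₀ + N * Real.exp A₀ * ((R + 1) / (2 * t)), by positivity,
    fun Y z hY hz => ?_⟩
  have hexp : -((Y - z) ^ 2).re / (4 * t) ≤ A₀ + -(2 * ‖z‖) := by
    rw [hA₀, div_add' _ _ _ (by positivity)]
    refine div_le_div_of_nonneg_right ?_ (by positivity)
    have h1 : ((Y - z) ^ 2).re = (Y ^ 2).re - 2 * (Y * z).re + (z ^ 2).re := by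
      rw [show (Y - z) ^ 2 = Y ^ 2 - ((2 : ℝ) : ℂ) * (Y * z) + z ^ 2 by push_cast; ring,
        Complex.add_re, Complex.sub_re, Complex.re_ofReal_mul]
    have h2 : -(R ^ 2) ≤ (Y ^ 2).re := by
      have := (abs_le.1 (Complex.abs_re_le_norm (Y ^ 2))).1
      rw [norm_pow] at this
      nlinarith [norm_nonneg Y]
    have h3 : (Y * z).re ≤ R * ‖z‖ := by
      refine (Complex.re_le_norm _).trans ?_
      rw [norm_mul]
      exact mul_le_mul_of_nonneg_right hY (norm_nonneg _)
    -- completing the square in `‖z‖`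
    have h4 : 2 * (R + 4 * t) * ‖z‖ - c * ‖z‖ ^ 2 ≤ (R + 4 * t) ^ 2 / c := by
      rw [le_div_iff₀ hc]
      nlinarith [sq_nonneg (R + 4 * t - c * ‖z‖)]
    rw [h1]
    linarith
  have hE : ‖heatKernel (Y - z) t‖ ≤ N * Real.exp A₀ * Real.exp (-(2 * ‖z‖)) := by
    rw [norm_heatKernel, mul_assoc N, ← Real.exp_add]
    exact mul_le_mul_of_nonneg_left (Real.exp_le_exp.2 hexp) hN0
  have he2 : Real.exp (-(2 * ‖z‖)) = Real.exp (-‖z‖) * Real.exp (-‖z‖) := by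
    rw [← Real.exp_add]; ring_nf
  have he1 : Real.exp (-‖z‖) ≤ 1 := Real.exp_le_one_iff.2 (by simp)
  constructor
  · calc _ ≤ _ := hE
      _ ≤ N * Real.exp A₀ * Real.exp (-‖z‖) := by
        rw [he2]
        refine mul_le_mul_of_nonneg_left ?_ hA0
        exact mul_le_of_le_one_left (Real.exp_pos _).le he1
      _ ≤ _ := by
        refine mul_le_mul_of_nonneg_right ?_ (Real.exp_pos _).le
        linarith
  · rw [norm_heatKernelDeriv _ ht]
    have hz1 : (R + ‖z‖) * Real.exp (-‖z‖) ≤ R + 1 := by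
      have h5 : ‖z‖ * Real.exp (-‖z‖) ≤ 1 := by
        have := Real.add_one_le_exp ‖z‖
        rw [Real.exp_neg, ← div_eq_mul_inv, div_le_one (Real.exp_pos _)]
        linarith
      nlinarith
    have hYz : ‖Y - z‖ ≤ R + ‖z‖ := (norm_sub_le _ _).trans (by linarith)
    calc ‖Y - z‖ / (2 * t) * ‖heatKernel (Y - z) t‖
        ≤ (R + ‖z‖) / (2 * t) * (N * Real.exp A₀ * Real.exp (-(2 * ‖z‖))) := by gcongr
      _ = N * Real.exp A₀ * (((R + ‖z‖) * Real.exp (-‖z‖)) / (2 * t)) * Real.exp (-‖z‖) := by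
          rw [he2]; ring
      _ ≤ N * Real.exp A₀ * ((R + 1) / (2 * t)) * Real.exp (-‖z‖) := by gcongr
      _ ≤ _ := by
        refine mul_le_mul_of_nonneg_right ?_ (Real.exp_pos _).le
        linarith

/-- The derivative of the heat kernel along a ray of direction `ω`, multiplied by an exponential
weight, is dominated by a Gaussian. -/
lemma norm_heatKernelDeriv_ray_le {c t T μ ν q : ℝ} {ω : ℂ} (hc : 0 < c) (ht : 0 < t) (htT : t ≤ T)
    (hν : 0 ≤ ν) (hνμ : ν ≤ μ) (hω : ‖ω‖ = 1) (hωc : c ≤ (ω ^ 2).re) :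
    ‖heatKernelDeriv (q * ω) t‖ * Real.exp (ν * |q|) ≤
      1 / (2 * t) * (1 / Real.sqrt (4 * Real.pi * t)) * Real.exp (2 * T * μ ^ 2 / c) *
        (1 / Real.sqrt (c / (8 * t))) * Real.exp (-(c / (16 * t)) * q ^ 2) := by
  have ha : 0 < c / (8 * t) := by positivity
  have hsa : 0 < Real.sqrt (c / (8 * t)) := Real.sqrt_pos.2 ha
  have h1 : ((q * ω : ℂ) ^ 2).re = q ^ 2 * (ω ^ 2).re := by
    rw [mul_pow, ← Complex.ofReal_pow, Complex.re_ofReal_mul]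
  -- a quarter of the Gaussian exponent absorbs the linear factor `|q|`
  have h2 : |q| ≤ 1 / Real.sqrt (c / (8 * t)) * Real.exp (c / (16 * t) * q ^ 2) := by
    rw [one_div, ← div_eq_inv_mul, le_div_iff₀ hsa]
    have := Real.add_one_le_exp (c / (16 * t) * q ^ 2)
    have h3 : (|q| * Real.sqrt (c / (8 * t))) ^ 2 = 2 * (c / (16 * t) * q ^ 2) := by
      rw [mul_pow, sq_abs, Real.sq_sqrt ha.le]
      field_simp
      ring
    nlinarith [sq_nonneg (|q| * Real.sqrt (c / (8 * t)) - 1)]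
  have h4 : -((q * ω : ℂ) ^ 2).re / (4 * t) + ν * |q| ≤
      2 * T * μ ^ 2 / c + -(c / (8 * t)) * q ^ 2 := by
    rw [h1]
    have h5 : -(q ^ 2 * (ω ^ 2).re) / (4 * t) ≤ -(2 * (c / (8 * t)) * q ^ 2) := by
      rw [div_le_iff₀ (by positivity)]
      have : -(2 * (c / (8 * t)) * q ^ 2) * (4 * t) = -(q ^ 2 * c) := by field_simp; ring
      rw [this]
      nlinarith [sq_nonneg q]
    -- half of the Gaussian exponent absorbs the exponential weight
    have h6 : ν * |q| ≤ 2 * t * ν ^ 2 / c + c / (8 * t) * q ^ 2 := by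
      have : 2 * t * ν ^ 2 / c + c / (8 * t) * q ^ 2 - ν * |q| =
          (4 * t * ν - c * |q|) ^ 2 / (8 * t * c) := by
        rw [sub_sq, mul_pow _ |q|, sq_abs]
        field_simp
        ring
      have h7 : 0 ≤ (4 * t * ν - c * |q|) ^ 2 / (8 * t * c) := by positivity
      linarith
    have hT : 0 ≤ T := ht.le.trans htT
    have h8 : 2 * t * ν ^ 2 / c ≤ 2 * T * μ ^ 2 / c := by gcongr
    linarith
  rw [norm_heatKernelDeriv _ ht, norm_mul, Complex.norm_real, hω, mul_one, norm_heatKernel,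
    Real.norm_eq_abs]
  calc |q| / (2 * t) * (1 / Real.sqrt (4 * Real.pi * t) *
        Real.exp (-((q * ω : ℂ) ^ 2).re / (4 * t))) * Real.exp (ν * |q|)
      = 1 / (2 * t) * (1 / Real.sqrt (4 * Real.pi * t)) * (|q| *
        Real.exp (-((q * ω : ℂ) ^ 2).re / (4 * t) + ν * |q|)) := by
        rw [Real.exp_add]; ring
    _ ≤ 1 / (2 * t) * (1 / Real.sqrt (4 * Real.pi * t)) *
        ((1 / Real.sqrt (c / (8 * t)) * Real.exp (c / (16 * t) * q ^ 2)) *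
          Real.exp (2 * T * μ ^ 2 / c + -(c / (8 * t)) * q ^ 2)) := by gcongr
    _ = _ := by
        rw [Real.exp_add, show -(c / (16 * t)) * q ^ 2 = c / (16 * t) * q ^ 2 +
          -(c / (8 * t)) * q ^ 2 by field_simp; ring, Real.exp_add]
        ring

lemma lintegral_gaussian {b : ℝ} (hb : 0 < b) :
    ∫⁻ q : ℝ, ENNReal.ofReal (Real.exp (-b * q ^ 2)) = ENNReal.ofReal (Real.sqrt (Real.pi / b)) := by
  rw [← ofReal_integral_eq_lintegral_ofReal (integrable_exp_neg_mul_sq hb)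
    (Eventually.of_forall fun q => (Real.exp_pos _).le), integral_gaussian]

/-- The weighted `L¹` norm of the kernel along the ray through `Y`, and the weighted size of the
boundary term, are `O(t^{-1/2})`, uniformly in `Y`. -/
lemma exists_lintegral_reflKernel_le {c T μ : ℝ} (hc : 0 < c) (hT : 0 < T) :
    ∃ C : ℝ, 0 < C ∧ ∀ t ∈ Ioc 0 T, ∀ ν ∈ Icc 0 μ, ∀ ω : ℂ, ‖ω‖ = 1 → c ≤ (ω ^ 2).re →
      ∀ R : ℝ, 0 ≤ R →
      ENNReal.ofReal (‖heatKernel (R * ω) t‖ * Real.exp (ν * R)) ≤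
        ENNReal.ofReal (C * (1 / Real.sqrt t)) ∧
      ∀ a : ℕ, ∫⁻ r in Ioi (0 : ℝ), ENNReal.ofReal
        (‖reflKernel a t (R * ω) (r * ω)‖ * Real.exp (ν * (R - r))) ≤
          ENNReal.ofReal (C * (1 / Real.sqrt t)) := by
  set K := Real.exp (2 * T * μ ^ 2 / c) with hK
  have hK0 : 0 < K := Real.exp_pos _
  set C₁ := 1 / Real.sqrt (4 * Real.pi) * K with hC₁
  set C₂ := 2 * (C₁ * (8 * Real.sqrt 2 * Real.sqrt Real.pi / (2 * c))) with hC₂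
  have hC₁0 : 0 < C₁ := by positivity
  have hC₂0 : 0 < C₂ := by positivity
  refine ⟨C₁ + C₂, by positivity, fun t ht ν hν ω hω hωc R hR => ⟨?_, fun a => ?_⟩⟩
  · refine ENNReal.ofReal_le_ofReal ?_
    have ht0 := ht.1
    have h1 : ((R * ω : ℂ) ^ 2).re = R ^ 2 * (ω ^ 2).re := by
      rw [mul_pow, ← Complex.ofReal_pow, Complex.re_ofReal_mul]
    have h2 : -((R * ω : ℂ) ^ 2).re / (4 * t) + ν * R ≤ 2 * T * μ ^ 2 / c := by
      rw [h1]
      have h5 : -(R ^ 2 * (ω ^ 2).re) / (4 * t) ≤ -(2 * (c / (8 * t)) * R ^ 2) := by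
        rw [div_le_iff₀ (by positivity)]
        have : -(2 * (c / (8 * t)) * R ^ 2) * (4 * t) = -(R ^ 2 * c) := by field_simp; ring
        rw [this]
        nlinarith [sq_nonneg R]
      have h6 : ν * R ≤ 2 * t * ν ^ 2 / c + c / (8 * t) * R ^ 2 := by
        have : 2 * t * ν ^ 2 / c + c / (8 * t) * R ^ 2 - ν * R =
            (4 * t * ν - c * R) ^ 2 / (8 * t * c) := by
          field_simp
          ring
        have h7 : 0 ≤ (4 * t * ν - c * R) ^ 2 / (8 * t * c) := by positivity
        linarith
      have h8 : 2 * t * ν ^ 2 / c ≤ 2 * T * μ ^ 2 / c := by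
        have := hν.1; have := hν.2; have := ht.2
        gcongr
      have h9 : 0 ≤ c / (8 * t) * R ^ 2 := by positivity
      linarith
    rw [norm_heatKernel, mul_assoc, ← Real.exp_add]
    calc 1 / Real.sqrt (4 * Real.pi * t) * Real.exp (-((R * ω : ℂ) ^ 2).re / (4 * t) + ν * R)
        ≤ 1 / Real.sqrt (4 * Real.pi * t) * K :=
          mul_le_mul_of_nonneg_left (Real.exp_le_exp.2 h2) (by positivity)
      _ = C₁ * (1 / Real.sqrt t) := by
          rw [Real.sqrt_mul (by positivity), hC₁]
          field_simp
      _ ≤ (C₁ + C₂) * (1 / Real.sqrt t) := by gcongr; linarith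
  · have ht0 := ht.1
    set D := 1 / (2 * t) * (1 / Real.sqrt (4 * Real.pi * t)) * K *
        (1 / Real.sqrt (c / (8 * t))) with hD
    have hD0 : 0 < D := by positivity
    set G : ℝ → ℝ≥0∞ := fun q => ENNReal.ofReal D *
      ENNReal.ofReal (Real.exp (-(c / (16 * t)) * q ^ 2)) with hG
    have hGint : ∫⁻ q, G q = ENNReal.ofReal (C₂ / 2 * (1 / Real.sqrt t)) := by
      rw [hG, lintegral_const_mul' _ _ ENNReal.ofReal_ne_top, lintegral_gaussian (by positivity),
        ← ENNReal.ofReal_mul hD0.le]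
      congr 1
      have s1 : Real.sqrt (4 * Real.pi * t) = Real.sqrt (4 * Real.pi) * Real.sqrt t :=
        Real.sqrt_mul (by positivity) t
      have s2 : Real.sqrt (Real.pi / (c / (16 * t))) =
          Real.sqrt Real.pi * Real.sqrt 2 / Real.sqrt (c / (8 * t)) := by
        rw [show Real.pi / (c / (16 * t)) = Real.pi * 2 / (c / (8 * t)) by field_simp; ring,
          Real.sqrt_div (by positivity), Real.sqrt_mul (by positivity)]
      rw [hD, hC₂, hC₁, s1, s2]
      have hs : Real.sqrt (c / (8 * t)) * Real.sqrt (c / (8 * t)) = c / (8 * t) :=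
        Real.mul_self_sqrt (by positivity)
      have hs0 : Real.sqrt (c / (8 * t)) ≠ 0 := (Real.sqrt_pos.2 (by positivity)).ne'
      calc _ = 1 / (2 * t) * (1 / (Real.sqrt (4 * Real.pi) * Real.sqrt t)) * K *
            (Real.sqrt Real.pi * Real.sqrt 2) /
              (Real.sqrt (c / (8 * t)) * Real.sqrt (c / (8 * t))) := by
            field_simp
        _ = _ := by
            rw [hs]
            field_simp
    have hpt : ∀ r ∈ Ioi (0 : ℝ), ENNReal.ofReal
        (‖reflKernel a t (R * ω) (r * ω)‖ * Real.exp (ν * (R - r))) ≤ G (R - r) + G (R + r) := by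
      intro r hr
      have hr0 : 0 < r := hr
      have e1 := norm_heatKernelDeriv_ray_le (q := R - r) hc ht0 ht.2 hν.1 hν.2 hω hωc
      have e2 := norm_heatKernelDeriv_ray_le (q := R + r) hc ht0 ht.2 hν.1 hν.2 hω hωc
      rw [hG]
      simp only
      rw [← ENNReal.ofReal_mul hD0.le, ← ENNReal.ofReal_mul hD0.le, ← ENNReal.ofReal_add
        (by positivity) (by positivity)]
      refine ENNReal.ofReal_le_ofReal ?_
      refine le_trans ?_ (add_le_add e1 e2)
      have hw1 : ν * (R - r) ≤ ν * |R - r| := mul_le_mul_of_nonneg_left (le_abs_self _) hν.1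
      have hw2 : ν * (R - r) ≤ ν * |R + r| := by
        refine mul_le_mul_of_nonneg_left ?_ hν.1
        exact le_trans (by linarith) (le_abs_self _)
      have hk := norm_reflKernel_le a t (R * ω) (r * ω)
      rw [← sub_mul, ← add_mul, ← Complex.ofReal_sub, ← Complex.ofReal_add] at hk
      calc _ ≤ (‖heatKernelDeriv (((R - r : ℝ) : ℂ) * ω) t‖ +
            ‖heatKernelDeriv (((R + r : ℝ) : ℂ) * ω) t‖) * Real.exp (ν * (R - r)) := by gcongr
        _ ≤ _ := by
          rw [add_mul]
          gcongr
    have hGm : Measurable G := by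
      rw [hG]; fun_prop
    calc _ ≤ ∫⁻ r in Ioi (0 : ℝ), (G (R - r) + G (R + r)) :=
          setLIntegral_mono' measurableSet_Ioi hpt
      _ ≤ ∫⁻ r, (G (R - r) + G (R + r)) := setLIntegral_le_lintegral _ _
      _ = ENNReal.ofReal (C₂ * (1 / Real.sqrt t)) := by
          rw [lintegral_add_left (by fun_prop), lintegral_sub_left_eq_self G R,
            lintegral_add_left_eq_self G R, hGint, ← ENNReal.ofReal_add (by positivity)
            (by positivity)]
          congr 1
          ring
      _ ≤ _ := by
          refine ENNReal.ofReal_le_ofReal ?_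
          gcongr
          linarith

/-! ### Heat kernels against bounded functions on the half line -/

lemma integrableOn_Ioi_of_norm_le_exp {f : ℝ → ℂ} {A : ℝ} (hf : ContinuousOn f (Ioi 0))
    (hA : ∀ r ∈ Ioi (0 : ℝ), ‖f r‖ ≤ A * Real.exp (-r)) : IntegrableOn f (Ioi 0) := by
  have h1 : IntegrableOn (fun r : ℝ => A * Real.exp (-r)) (Ioi 0) :=
    (integrableOn_exp_neg_Ioi 0).const_mul A
  refine Integrable.mono' h1 (hf.aestronglyMeasurable measurableSet_Ioi) ?_
  exact (ae_restrict_iff' measurableSet_Ioi).2 (Eventually.of_forall hA)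

/-- Uniform exponential decay of the heat kernels at `Y ∓ r` for bounded `Y` and real `r`. -/
lemma exists_norm_heatKernel_real_le {t R : ℝ} (ht : 0 < t) (hR : 0 ≤ R) :
    ∃ A : ℝ, 0 ≤ A ∧ ∀ Y : ℂ, ‖Y‖ ≤ R → ∀ r ∈ Ioi (0 : ℝ),
      ‖heatKernel (Y - r) t‖ ≤ A * Real.exp (-r) ∧ ‖heatKernel (Y + r) t‖ ≤ A * Real.exp (-r) ∧
      ‖heatKernelDeriv (Y - r) t‖ ≤ A * Real.exp (-r) ∧
      ‖heatKernelDeriv (Y + r) t‖ ≤ A * Real.exp (-r) := by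
  obtain ⟨A, hA, h⟩ := exists_norm_heatKernel_sub_le (c := 1) one_pos ht hR
  refine ⟨A, hA, fun Y hY r hr => ?_⟩
  have hr0 : (0 : ℝ) < r := hr
  have h1 := h Y r hY (by
    rw [Complex.norm_real, Real.norm_eq_abs, sq_abs, ← Complex.ofReal_pow, Complex.ofReal_re,
      one_mul])
  have h2 := h Y (-r) hY (by
    rw [norm_neg, neg_sq, Complex.norm_real, Real.norm_eq_abs, sq_abs, ← Complex.ofReal_pow,
      Complex.ofReal_re, one_mul])
  rw [norm_neg, sub_neg_eq_add] at h2
  rw [Complex.norm_real, Real.norm_eq_abs, abs_of_pos hr0] at h1 h2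
  exact ⟨h1.1, h2.1, h1.2, h2.2⟩

lemma norm_add_mul_mul_le {p q s v : ℂ} {A B e : ℝ} (hp : ‖p‖ ≤ A * e) (hq : ‖q‖ ≤ A * e)
    (hv : ‖v‖ ≤ B) : ‖(p + s * q) * v‖ ≤ (A + ‖s‖ * A) * B * e := by
  have he : 0 ≤ A * e := (norm_nonneg p).trans hp
  rw [norm_mul]
  calc _ ≤ (A * e + ‖s‖ * (A * e)) * B := by
        refine mul_le_mul ?_ hv (norm_nonneg _) (by positivity)
        refine (norm_add_le _ _).trans ?_
        rw [norm_mul]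
        gcongr
    _ = _ := by ring

section HalfLine

variable {t : ℝ} {V : ℝ → ℂ} {B : ℝ}

/-- Differentiation in `Y` of the heat extension of a bounded function on the half line, for the
odd (`s = -1`) and even (`s = 1`) reflections. -/
lemma hasDerivAt_integral_heatKernel (ht : 0 < t) (hV : ContinuousOn V (Ioi 0))
    (hB : ∀ r ∈ Ioi (0 : ℝ), ‖V r‖ ≤ B) (s : ℂ) (Y : ℂ) :
    HasDerivAt (fun Y : ℂ => ∫ r in Ioi (0 : ℝ),
        (heatKernel (Y - r) t + s * heatKernel (Y + r) t) * V r)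
      (∫ r in Ioi (0 : ℝ), (heatKernelDeriv (Y - r) t + s * heatKernelDeriv (Y + r) t) * V r) Y := by
  have hd : ∀ (Y : ℂ) (r : ℝ), HasDerivAt
      (fun Y : ℂ => (heatKernel (Y - r) t + s * heatKernel (Y + r) t) * V r)
      ((heatKernelDeriv (Y - r) t + s * heatKernelDeriv (Y + r) t) * V r) Y := fun Y r =>
    (((hasDerivAt_heatKernel (Y - r) t).comp_sub_const Y (r : ℂ)).add
      (((hasDerivAt_heatKernel (Y + r) t).comp_add_const Y (r : ℂ)).const_mul s)).mul_const _
  have hB0 : 0 ≤ B := (norm_nonneg _).trans (hB 1 (by simp))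
  have hc : ∀ Y : ℂ, ContinuousOn
      (fun r : ℝ => (heatKernel (Y - r) t + s * heatKernel (Y + r) t) * V r) (Ioi 0) := fun Y => by
    refine ContinuousOn.mul (Continuous.continuousOn ?_) hV
    unfold heatKernel
    fun_prop
  have hdom : DominatedHolomorphic (volume.restrict (Ioi (0 : ℝ))) univ
      (fun (Y : ℂ) (r : ℝ) => (heatKernel (Y - r) t + s * heatKernel (Y + r) t) * V r) := by
    refine ⟨fun Y _ => (hc Y).aestronglyMeasurable measurableSet_Ioi, Eventually.of_forall
      fun r Y _ => (hd Y r).differentiableAt.differentiableWithinAt, fun Y₀ _ => ?_⟩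
    obtain ⟨A, hA, h⟩ := exists_norm_heatKernel_real_le (R := ‖Y₀‖ + 1) ht (by positivity)
    refine ⟨1, one_pos, subset_univ _, fun r => (A + ‖s‖ * A) * B * Real.exp (-r),
      (integrableOn_exp_neg_Ioi 0).const_mul _, ?_⟩
    refine (ae_restrict_iff' measurableSet_Ioi).2 (Eventually.of_forall fun r hr Y hY => ?_)
    have hYn : ‖Y‖ ≤ ‖Y₀‖ + 1 := by
      have := norm_le_norm_add_norm_sub' Y Y₀
      rw [Metric.mem_ball, dist_eq_norm] at hY
      linarith
    obtain ⟨h1, h2, -⟩ := h Y hYn r hr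
    exact norm_add_mul_mul_le h1 h2 (hB r hr)
  have := hdom.hasDerivAt (mem_univ Y)
  simpa only [(hd _ _).deriv] using this

/-- Both the heat kernel and its derivative are integrable against a bounded function. -/
lemma integrableOn_heatKernel_mul (ht : 0 < t) (hV : ContinuousOn V (Ioi 0))
    (hB : ∀ r ∈ Ioi (0 : ℝ), ‖V r‖ ≤ B) (s : ℂ) (Y : ℂ) :
    IntegrableOn (fun r : ℝ => (heatKernel (Y - r) t + s * heatKernel (Y + r) t) * V r)
      (Ioi 0) ∧
    IntegrableOn (fun r : ℝ => (heatKernelDeriv (Y - r) t + s * heatKernelDeriv (Y + r) t) * V r)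
      (Ioi 0) := by
  obtain ⟨A, hA, h⟩ := exists_norm_heatKernel_real_le (R := ‖Y‖) ht (norm_nonneg _)
  constructor
  · refine integrableOn_Ioi_of_norm_le_exp (A := (A + ‖s‖ * A) * B)
      (ContinuousOn.mul (Continuous.continuousOn ?_) hV) fun r hr => ?_
    · unfold heatKernel; fun_prop
    · obtain ⟨h1, h2, -⟩ := h Y le_rfl r hr
      exact norm_add_mul_mul_le h1 h2 (hB r hr)
  · refine integrableOn_Ioi_of_norm_le_exp (A := (A + ‖s‖ * A) * B)
      (ContinuousOn.mul (Continuous.continuousOn ?_) hV) fun r hr => ?_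
    · unfold heatKernelDeriv heatKernel; fun_prop
    · obtain ⟨-, -, h1, h2⟩ := h Y le_rfl r hr
      exact norm_add_mul_mul_le h1 h2 (hB r hr)

/-- Integration by parts on the half line with the kernel `E(Y-r) + s E(Y+r)`; the boundary value at
`r = 0` is the limit of the product. -/
lemma integral_heatKernel_mul_deriv (ht : 0 < t) {V' : ℝ → ℂ} {B' : ℝ}
    (hd : ∀ r ∈ Ioi (0 : ℝ), HasDerivAt V (V' r) r) (hV' : ContinuousOn V' (Ioi 0))
    (hB : ∀ r ∈ Ioi (0 : ℝ), ‖V r‖ ≤ B) (hB' : ∀ r ∈ Ioi (0 : ℝ), ‖V' r‖ ≤ B') (s : ℂ) (Y : ℂ)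
    {v : ℂ} (hv : Tendsto (fun r : ℝ => (heatKernel (Y - r) t + s * heatKernel (Y + r) t) * V r)
      (𝓝[>] 0) (𝓝 v)) :
    ∫ r in Ioi (0 : ℝ), (heatKernel (Y - r) t + s * heatKernel (Y + r) t) * V' r =
      -v + ∫ r in Ioi (0 : ℝ), (heatKernelDeriv (Y - r) t - s * heatKernelDeriv (Y + r) t) * V r := by
  have hV : ContinuousOn V (Ioi 0) := fun r hr => (hd r hr).continuousAt.continuousWithinAt
  have hk : ∀ r : ℝ, HasDerivAt (fun r : ℝ => heatKernel (Y - r) t + s * heatKernel (Y + r) t)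
      (-(heatKernelDeriv (Y - r) t - s * heatKernelDeriv (Y + r) t)) r := fun r => by
    have h1 := ((hasDerivAt_heatKernel (Y - r) t).comp_const_sub Y (r : ℂ)).comp_ofReal
    have h2 := ((hasDerivAt_heatKernel (Y + r) t).comp_const_add Y (r : ℂ)).comp_ofReal
    refine (h1.add (h2.const_mul s)).congr_deriv ?_
    ring
  have hlim : Tendsto (fun r : ℝ => (heatKernel (Y - r) t + s * heatKernel (Y + r) t) * V r)
      atTop (𝓝 0) := by
    obtain ⟨A, hA, h⟩ := exists_norm_heatKernel_real_le (R := ‖Y‖) ht (norm_nonneg _)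
    have hexp : Tendsto (fun r : ℝ => (A + ‖s‖ * A) * B * Real.exp (-r)) atTop (𝓝 0) := by
      simpa using (Real.tendsto_exp_neg_atTop_nhds_zero).const_mul ((A + ‖s‖ * A) * B)
    refine squeeze_zero_norm' ?_ hexp
    filter_upwards [Ioi_mem_atTop (0 : ℝ)] with r hr
    obtain ⟨h1, h2, -⟩ := h Y le_rfl r hr
    exact norm_add_mul_mul_le h1 h2 (hB r hr)
  have i1 := (integrableOn_heatKernel_mul ht hV' hB' s Y).1
  have i2 := (integrableOn_heatKernel_mul ht hV hB (-s) Y).2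
  have i3 : IntegrableOn (fun r : ℝ =>
      -(heatKernelDeriv (Y - r) t - s * heatKernelDeriv (Y + r) t) * V r) (Ioi 0) := by
    refine i2.neg.congr_fun (fun r _ => ?_) measurableSet_Ioi
    simp only [Pi.neg_apply]
    ring
  have := integral_Ioi_mul_deriv_eq_deriv_mul (fun r _ => hk r) hd i1 i3 hv hlim
  rw [this, zero_sub]
  simp only [neg_mul, integral_neg]
  ring

end HalfLine

/-! ### Rotation of the contour -/

/-- The integral of a holomorphic, exponentially decaying function along a ray of a sector equals
the one along the positive half line: as a function of the direction the ray integral is holomorphic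
and, by scaling, constant on the positive reals. -/
lemma integral_ray_eq {θ A : ℝ} (hθ : 0 < Real.tan θ) {h : ℂ → ℂ}
    (hd : DifferentiableOn ℂ h (openSector θ))
    (hA : ∀ z ∈ openSector θ, ‖h z‖ ≤ A * Real.exp (-‖z‖)) {ω : ℂ} (hω : ω ∈ openSector θ) :
    ∫ r in Ioi (0 : ℝ), h (r * ω) * ω = ∫ r in Ioi (0 : ℝ), h r := by
  have hA0 : 0 ≤ A := by
    have := (norm_nonneg _).trans (hA ω hω)
    exact nonneg_of_mul_nonneg_left this (Real.exp_pos _)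
  have hdom : DominatedHolomorphic (volume.restrict (Ioi (0 : ℝ))) (openSector θ)
      (fun (σ : ℂ) (r : ℝ) => h (r * σ) * σ) := by
    refine ⟨fun σ hσ => ?_, ?_, fun σ₀ hσ₀ => ?_⟩
    · refine ContinuousOn.aestronglyMeasurable ?_ measurableSet_Ioi
      refine ContinuousOn.mul ?_ continuousOn_const
      exact hd.continuousOn.comp (by fun_prop) fun r hr => mul_ofReal_mem_openSector hσ hr
    · refine (ae_restrict_iff' measurableSet_Ioi).2 (Eventually.of_forall fun r hr => ?_)
      refine DifferentiableOn.mul ?_ differentiableOn_id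
      exact hd.comp (by fun_prop) fun σ hσ => mul_ofReal_mem_openSector hσ hr
    · obtain ⟨e, he, hsub⟩ := Metric.isOpen_iff.1 (isOpen_openSector θ) σ₀ hσ₀
      have hσ0 : 0 < ‖σ₀‖ := norm_pos_iff.2 fun h0 => by simpa [h0] using hσ₀.1
      set d := ‖σ₀‖ / 2 with hd'
      have hd0 : 0 < d := by positivity
      refine ⟨min e d, lt_min he hd0, (Metric.ball_subset_ball (min_le_left _ _)).trans hsub,
        fun r => A * (‖σ₀‖ + d) * Real.exp (-d * r),
        (exp_neg_integrableOn_Ioi 0 hd0).const_mul _, ?_⟩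
      refine (ae_restrict_iff' measurableSet_Ioi).2 (Eventually.of_forall fun r hr σ hσ => ?_)
      have hr0 : (0 : ℝ) < r := hr
      have hσe : σ ∈ openSector θ := hsub (Metric.ball_subset_ball (min_le_left _ _) hσ)
      have hσd : ‖σ - σ₀‖ < d := by
        have := Metric.ball_subset_ball (min_le_right e d) hσ
        rwa [Metric.mem_ball, dist_eq_norm] at this
      have h1 : ‖σ‖ ≤ ‖σ₀‖ + d := by
        have := norm_le_norm_add_norm_sub' σ σ₀
        linarith
      have h2 : d ≤ ‖σ‖ := by
        have := norm_le_norm_add_norm_sub σ σ₀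
        linarith
      rw [norm_mul]
      calc ‖h (r * σ)‖ * ‖σ‖ ≤ (A * Real.exp (-‖(r : ℂ) * σ‖)) * (‖σ₀‖ + d) :=
            mul_le_mul (hA _ (mul_ofReal_mem_openSector hσe hr0)) h1 (norm_nonneg _) (by positivity)
        _ ≤ (A * Real.exp (-d * r)) * (‖σ₀‖ + d) := by
            gcongr
            rw [norm_mul, Complex.norm_real, Real.norm_eq_abs, abs_of_pos hr0]
            nlinarith
        _ = _ := by ring
  have han : AnalyticOnNhd ℂ (fun σ : ℂ => ∫ r in Ioi (0 : ℝ), h (r * σ) * σ) (openSector θ) :=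
    hdom.differentiableOn.analyticOnNhd (isOpen_openSector θ)
  have hone : (1 : ℂ) ∈ openSector θ := by simpa using ofReal_mem_openSector hθ one_pos
  have hreal : ∀ a : ℝ, 0 < a → ∫ r in Ioi (0 : ℝ), h (r * a) * a = ∫ r in Ioi (0 : ℝ), h r := by
    intro a ha
    have := integral_comp_mul_right_Ioi (fun r : ℝ => h r) 0 ha
    rw [zero_mul] at this
    rw [integral_mul_const]
    simp only [Complex.ofReal_mul] at this
    rw [this, Complex.real_smul, Complex.ofReal_inv, mul_comm, mul_inv_cancel_left₀
      (Complex.ofReal_ne_zero.2 ha.ne')]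
  have hfreq : ∃ᶠ σ : ℂ in 𝓝[≠] 1, (∫ r in Ioi (0 : ℝ), h (r * σ) * σ) =
      ∫ r in Ioi (0 : ℝ), h r := by
    have ht : Tendsto (fun n : ℕ => ((1 + 1 / ((n : ℝ) + 1) : ℝ) : ℂ)) atTop (𝓝[≠] 1) := by
      refine tendsto_nhdsWithin_iff.2 ⟨?_, Eventually.of_forall fun n => ?_⟩
      · have h1 : Tendsto (fun n : ℕ => 1 + 1 / ((n : ℝ) + 1)) atTop (𝓝 (1 + 0)) :=
          tendsto_const_nhds.add tendsto_one_div_add_atTop_nhds_zero_nat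
        have h2 := (Complex.continuous_ofReal.tendsto _).comp h1
        simpa [Function.comp_def] using h2
      · have : (0 : ℝ) < 1 / ((n : ℝ) + 1) := by positivity
        rw [mem_compl_singleton_iff, ← Complex.ofReal_one, Ne, Complex.ofReal_inj]
        linarith
    refine ht.frequently (Eventually.frequently (Eventually.of_forall fun n => ?_))
    exact hreal _ (by positivity)
  exact han.eqOn_of_preconnected_of_frequently_eq analyticOnNhd_const
    (convex_openSector θ).isPreconnected hone hfreq hω

/-! ### Mixed derivatives of jointly analytic functions -/

/-- The mixed derivative `∂_Y^a ∂_x^b w (x, Y)` with unrestricted `Y`-derivatives; it agrees with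
`mixedDeriv` at interior points of the sector, and for `a = 0` everywhere. -/
noncomputable def fullDeriv (a b : ℕ) (w : ℂ → ℂ → ℂ) (x Y : ℂ) : ℂ :=
  iteratedDeriv a (fun Y' => iteratedDeriv b (fun x' => w x' Y') x) Y

lemma analyticOnNhd_deriv_fst {U : Set (ℂ × ℂ)} (hU : IsOpen U) {g : ℂ × ℂ → ℂ}
    (hg : AnalyticOnNhd ℂ g U) :
    AnalyticOnNhd ℂ (fun p : ℂ × ℂ => deriv (fun x => g (x, p.2)) p.1) U := by
  have h : AnalyticOnNhd ℂ (fun p => fderiv ℂ g p (1, 0)) U := fun p hp =>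
    ((ContinuousLinearMap.apply ℂ ℂ (((1, 0) : ℂ × ℂ))).analyticAt _).fun_comp (hg.fderiv p hp)
  refine h.congr hU fun p hp => ?_
  have h1 : HasDerivAt (fun x : ℂ => (x, p.2)) ((1 : ℂ), (0 : ℂ)) p.1 :=
    (hasDerivAt_id p.1).prodMk (hasDerivAt_const p.1 p.2)
  have h2 : HasFDerivAt g (fderiv ℂ g p) (p.1, p.2) := (hg p hp).differentiableAt.hasFDerivAt
  exact (h2.comp_hasDerivAt p.1 h1).deriv.symm

lemma analyticOnNhd_deriv_snd {U : Set (ℂ × ℂ)} (hU : IsOpen U) {g : ℂ × ℂ → ℂ}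
    (hg : AnalyticOnNhd ℂ g U) :
    AnalyticOnNhd ℂ (fun p : ℂ × ℂ => deriv (fun Y => g (p.1, Y)) p.2) U := by
  have h : AnalyticOnNhd ℂ (fun p => fderiv ℂ g p (0, 1)) U := fun p hp =>
    ((ContinuousLinearMap.apply ℂ ℂ (((0, 1) : ℂ × ℂ))).analyticAt _).fun_comp (hg.fderiv p hp)
  refine h.congr hU fun p hp => ?_
  have h1 : HasDerivAt (fun Y : ℂ => (p.1, Y)) ((0 : ℂ), (1 : ℂ)) p.2 :=
    (hasDerivAt_const p.2 p.1).prodMk (hasDerivAt_id p.2)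
  have h2 : HasFDerivAt g (fderiv ℂ g p) (p.1, p.2) := (hg p hp).differentiableAt.hasFDerivAt
  exact (h2.comp_hasDerivAt p.2 h1).deriv.symm

lemma analyticOnNhd_fullDeriv {U : Set (ℂ × ℂ)} (hU : IsOpen U) {w : ℂ → ℂ → ℂ}
    (hw : AnalyticOnNhd ℂ (fun p : ℂ × ℂ => w p.1 p.2) U) (a b : ℕ) :
    AnalyticOnNhd ℂ (fun p : ℂ × ℂ => fullDeriv a b w p.1 p.2) U := by
  have hb : AnalyticOnNhd ℂ (fun p : ℂ × ℂ => iteratedDeriv b (fun x' => w x' p.2) p.1) U := by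
    induction b with
    | zero => simpa using hw
    | succ b ih => simpa only [iteratedDeriv_succ] using analyticOnNhd_deriv_fst hU ih
  unfold fullDeriv
  induction a with
  | zero => simpa using hb
  | succ a ih => simpa only [iteratedDeriv_succ] using analyticOnNhd_deriv_snd hU ih

lemma analyticOnNhd_slice_fst {S T : Set ℂ} {g : ℂ → ℂ → ℂ}
    (hg : AnalyticOnNhd ℂ (fun p : ℂ × ℂ => g p.1 p.2) (S ×ˢ T)) {Y : ℂ} (hY : Y ∈ T) :
    AnalyticOnNhd ℂ (fun x => g x Y) S := fun x hx =>
  AnalyticAt.fun_comp (g := fun p : ℂ × ℂ => g p.1 p.2) (f := fun x => (x, Y)) (hg (x, Y) ⟨hx, hY⟩)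
    (analyticAt_id.prod analyticAt_const)

lemma analyticOnNhd_slice_snd {S T : Set ℂ} {g : ℂ → ℂ → ℂ}
    (hg : AnalyticOnNhd ℂ (fun p : ℂ × ℂ => g p.1 p.2) (S ×ˢ T)) {x : ℂ} (hx : x ∈ S) :
    AnalyticOnNhd ℂ (fun Y => g x Y) T := fun Y hY =>
  AnalyticAt.fun_comp (g := fun p : ℂ × ℂ => g p.1 p.2) (f := fun Y => (x, Y)) (hg (x, Y) ⟨hx, hY⟩)
    (analyticAt_const.prod analyticAt_id)

lemma fullDeriv_zero_zero (w : ℂ → ℂ → ℂ) : fullDeriv 0 0 w = w := by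
  funext x Y; simp [fullDeriv]

lemma fullDeriv_succ (a b : ℕ) (w : ℂ → ℂ → ℂ) (x Y : ℂ) :
    fullDeriv (a + 1) b w x Y = deriv (fun Y => fullDeriv a b w x Y) Y := by
  simp only [fullDeriv, iteratedDeriv_succ]

lemma mixedDeriv_zero (θ : ℝ) (b : ℕ) (w : ℂ → ℂ → ℂ) (x Y : ℂ) :
    mixedDeriv θ 0 b w x Y = fullDeriv 0 b w x Y := by
  simp [mixedDeriv, fullDeriv]

lemma mixedDeriv_eq_of_mem_interior {θ : ℝ} (a b : ℕ) (w : ℂ → ℂ → ℂ) (x : ℂ) {Y : ℂ}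
    (hY : Y ∈ interior (sector θ)) : mixedDeriv θ a b w x Y = fullDeriv a b w x Y := by
  have h : sector θ =ᶠ[𝓝 Y] univ := by
    rw [eventuallyEq_univ]
    exact mem_interior_iff_mem_nhds.1 hY
  rw [mixedDeriv, iteratedDerivWithin, iteratedFDerivWithin_congr_set h, iteratedFDerivWithin_univ]
  rfl

/-- The derivatives within a closed sector are the unrestricted ones where the function is analytic
on a larger open sector, in particular at nonzero boundary points. -/
lemma mixedDeriv_eq_of_analytic {θ θ' P : ℝ} (hθ' : 0 < Real.tan θ') {w : ℂ → ℂ → ℂ}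
    (hw : AnalyticOnNhd ℂ (fun p : ℂ × ℂ => w p.1 p.2) (strip P ×ˢ openSector θ)) (a b : ℕ)
    {x Y : ℂ} (hx : x ∈ strip P) (hY : Y ∈ openSector θ) (hY' : Y ∈ sector θ') :
    mixedDeriv θ' a b w x Y = fullDeriv a b w x Y := by
  have h := analyticOnNhd_fullDeriv ((isOpen_strip P).prod (isOpen_openSector θ)) hw 0 b
  have h1 := (analyticOnNhd_slice_snd h hx Y hY).contDiffAt (n := a)
  exact iteratedDerivWithin_eq_iteratedDeriv (uniqueDiffOn_sector hθ') h1 hY'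

/-! ### Profiles at a fixed time -/

/-- The pointwise consequences of membership in `K^{l,P,θ,·}` that the analysis at a fixed time
uses: joint analyticity, local boundedness of the admissible derivatives, and continuity of the
`x`-derivatives up to `Y = 0`. -/
structure IsProfile (l : ℕ) (P θ : ℝ) (w : ℂ → ℂ → ℂ) : Prop where
  analytic : AnalyticOnNhd ℂ (fun p : ℂ × ℂ => w p.1 p.2) (strip P ×ˢ openSector θ)
  bounded : ∀ a b : ℕ, a ≤ 2 → a + b ≤ l → ∀ x ∈ strip P, ∃ r > 0, Metric.ball x r ⊆ strip P ∧
    ∃ B : ℝ, 0 ≤ B ∧ ∀ x' ∈ Metric.ball x r, ∀ Y ∈ openSector θ, ‖fullDeriv a b w x' Y‖ ≤ B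
  tendsto_zero : ∀ b ≤ l, ∀ x ∈ strip P,
    Tendsto (fullDeriv 0 b w x) (𝓝[openSector θ] 0) (𝓝 (fullDeriv 0 b w x 0))
  analytic_zero : AnalyticOnNhd ℂ (fun x => w x 0) (strip P)

/-- The `L²` norm of `f` along the horizontal line `Im x = y`. -/
noncomputable def lineNorm (y : ℝ) (f : ℂ → ℂ) : ℝ≥0∞ :=
  eLpNorm (fun ξ : ℝ => f ((ξ : ℂ) + (y : ℂ) * Complex.I)) 2 volume

lemma hNorm_zero (ρ : ℝ) (f : ℂ → ℂ) : hNorm 0 ρ f = ⨆ y ∈ Ioo (-ρ) ρ, lineNorm y f := by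
  simp [hNorm, lineNorm]

lemma lineNorm_le_hNorm {ρ y : ℝ} (f : ℂ → ℂ) (hy : y ∈ Ioo (-ρ) ρ) :
    lineNorm y f ≤ hNorm 0 ρ f := by
  rw [hNorm_zero]
  exact le_iSup₂ (f := fun (y : ℝ) (_ : y ∈ Ioo (-ρ) ρ) => lineNorm y f) y hy

lemma ofReal_add_mul_I_mem_strip {ρ y : ℝ} (hy : y ∈ Ioo (-ρ) ρ) (ξ : ℝ) :
    (ξ : ℂ) + (y : ℂ) * Complex.I ∈ strip ρ := by
  simpa [strip] using hy

lemma lineNorm_congr {ρ y : ℝ} (hy : y ∈ Ioo (-ρ) ρ) {f g : ℂ → ℂ} (h : EqOn f g (strip ρ)) :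
    lineNorm y f = lineNorm y g := by
  unfold lineNorm
  congr 1
  funext ξ
  exact h (ofReal_add_mul_I_mem_strip hy ξ)

lemma continuous_line {ρ y : ℝ} (hy : y ∈ Ioo (-ρ) ρ) {f : ℂ → ℂ} (hf : ContinuousOn f (strip ρ)) :
    Continuous (fun ξ : ℝ => f ((ξ : ℂ) + (y : ℂ) * Complex.I)) :=
  hf.comp_continuous (by fun_prop) (ofReal_add_mul_I_mem_strip hy)

lemma lineNorm_sub_le {ρ y : ℝ} (hy : y ∈ Ioo (-ρ) ρ) {f g : ℂ → ℂ} (hf : ContinuousOn f (strip ρ))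
    (hg : ContinuousOn g (strip ρ)) :
    lineNorm y (fun x => f x - g x) ≤ lineNorm y f + lineNorm y g :=
  eLpNorm_sub_le (continuous_line hy hf).aestronglyMeasurable
    (continuous_line hy hg).aestronglyMeasurable (by norm_num)

lemma lineNorm_const_mul (y : ℝ) (c : ℂ) (f : ℂ → ℂ) :
    lineNorm y (fun x => c * f x) = ‖c‖ₑ * lineNorm y f :=
  eLpNorm_const_smul c (fun ξ : ℝ => f ((ξ : ℂ) + (y : ℂ) * Complex.I)) 2 volume

lemma hNorm_congr {ρ : ℝ} {f g : ℂ → ℂ} (h : EqOn f g (strip ρ)) : hNorm 0 ρ f = hNorm 0 ρ g := by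
  rw [hNorm_zero, hNorm_zero]
  exact biSup_congr fun y hy => lineNorm_congr hy h

lemma exists_ball_subset_strip {ρ : ℝ} {x : ℂ} (hx : x ∈ strip ρ) : ∃ r > 0,
    ∀ x' ∈ Metric.ball x r, Metric.ball x' r ⊆ strip ρ := by
  obtain ⟨e, he, hsub⟩ := Metric.isOpen_iff.1 (isOpen_strip ρ) x hx
  refine ⟨e / 2, by positivity, fun x' hx' y hy => hsub ?_⟩
  rw [Metric.mem_ball] at hx' hy ⊢
  linarith [dist_triangle y x' x]

/-- Each term of the sum defining `kNorm` is at most the sum. -/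
lemma mul_hNorm_le_kNorm {l : ℕ} {ρ θ μ : ℝ} (w : ℂ → ℂ → ℂ) {a b : ℕ} (ha : a ≤ 2)
    (hab : a + b ≤ l) {Y : ℂ} (hY : Y ∈ sector θ) :
    ENNReal.ofReal (Real.exp (μ * Y.re)) * hNorm 0 ρ (fun x => mixedDeriv θ a b w x Y) ≤
      kNorm l ρ θ μ w := by
  unfold kNorm
  have h1 : a ∈ Finset.range (min 2 l + 1) := by simp; omega
  have h2 : b ∈ Finset.range (l - a + 1) := by simp; omega
  refine le_trans ?_ (Finset.single_le_sum (f := fun a => ∑ b ∈ Finset.range (l - a + 1),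
    ⨆ Y ∈ sector θ, ENNReal.ofReal (Real.exp (μ * Y.re)) *
      hNorm 0 ρ (fun x => mixedDeriv θ a b w x Y)) (fun _ _ => zero_le) h1)
  refine le_trans ?_ (Finset.single_le_sum (f := fun b =>
    ⨆ Y ∈ sector θ, ENNReal.ofReal (Real.exp (μ * Y.re)) *
      hNorm 0 ρ (fun x => mixedDeriv θ a b w x Y)) (fun _ _ => zero_le) h2)
  exact le_iSup₂ (f := fun (Y : ℂ) (_ : Y ∈ sector θ) => ENNReal.ofReal (Real.exp (μ * Y.re)) *
      hNorm 0 ρ (fun x => mixedDeriv θ a b w x Y)) Y hY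

/-- The pointwise bounds come from the `L²` bounds through the boundedness of point evaluations. -/
lemma MemK.isProfile {l : ℕ} {P θ μ : ℝ} {w : ℂ → ℂ → ℂ} (hw : MemK l P θ μ w) (hμ : 0 ≤ μ) :
    IsProfile l P θ w := by
  have han : AnalyticOnNhd ℂ (fun p : ℂ × ℂ => w p.1 p.2) (strip P ×ˢ openSector θ) :=
    hw.analytic.mono (prod_mono subset_rfl (openSector_subset_interior θ))
  refine ⟨han, fun a b ha hab x hx => ?_, fun b hb x hx => ?_, ?_⟩
  · obtain ⟨r, hr, hsub⟩ := exists_ball_subset_strip hx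
    obtain ⟨C, hC, hCb⟩ := exists_enorm_le_mul_hNorm hr
    refine ⟨r, hr, hsub x (Metric.mem_ball_self hr), C * (kNorm l P θ μ w).toReal, by positivity,
      fun x' hx' Y hY => ?_⟩
    have h1 := analyticOnNhd_slice_fst
      (analyticOnNhd_fullDeriv ((isOpen_strip P).prod (isOpen_openSector θ)) han a b) hY
    have h2 := hCb P (fun x => fullDeriv a b w x Y) x' (hsub x' hx') h1.differentiableOn
    have h3 : hNorm 0 P (fun x => fullDeriv a b w x Y) ≤ kNorm l P θ μ w := by
      have h4 := mul_hNorm_le_kNorm (ρ := P) (μ := μ) w ha hab (openSector_subset_sector θ hY)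
      simp only [mixedDeriv_eq_of_mem_interior a b w _ (openSector_subset_interior θ hY)] at h4
      refine le_trans ?_ h4
      refine le_mul_of_one_le_left zero_le ?_
      rw [ENNReal.one_le_ofReal]
      exact Real.one_le_exp (mul_nonneg hμ hY.1.le)
    have h5 : ‖fullDeriv a b w x' Y‖ₑ ≤ ENNReal.ofReal (C * (kNorm l P θ μ w).toReal) := by
      rw [ENNReal.ofReal_mul hC, ENNReal.ofReal_toReal hw.norm_lt_top.ne]
      exact h2.trans (by gcongr)
    rwa [← ofReal_norm, ENNReal.ofReal_le_ofReal_iff (by positivity)] at h5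
  · obtain ⟨r, hr, hsub⟩ := exists_ball_subset_strip hx
    obtain ⟨C, hC, hCb⟩ := exists_enorm_le_mul_hNorm hr
    have h1 := hw.continuous 0 b (by norm_num) (by omega) 0 (zero_mem_sector θ)
    simp only [mixedDeriv_zero] at h1
    have h2 := h1.mono_left (nhdsWithin_mono 0 (openSector_subset_sector θ))
    have h3 := ENNReal.Tendsto.const_mul (a := ENNReal.ofReal C) h2 (Or.inr ENNReal.ofReal_ne_top)
    rw [mul_zero] at h3
    rw [tendsto_iff_edist_tendsto_0]
    refine tendsto_of_tendsto_of_tendsto_of_le_of_le' tendsto_const_nhds h3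
      (Eventually.of_forall fun _ => zero_le) ?_
    filter_upwards [self_mem_nhdsWithin] with Y hY
    rw [edist_eq_enorm_sub]
    refine hCb P (fun x => fullDeriv 0 b w x Y - fullDeriv 0 b w x 0) x
      (hsub x (Metric.mem_ball_self hr)) ?_
    have e1 := (hw.memH 0 b (by norm_num) (by omega) Y (openSector_subset_sector θ hY)).analytic
    have e2 := (hw.memH 0 b (by norm_num) (by omega) 0 (zero_mem_sector θ)).analytic
    simp only [mixedDeriv_zero] at e1 e2
    exact (e1.sub e2).differentiableOn
  · have e2 := (hw.memH 0 0 (by norm_num) (by omega) 0 (zero_mem_sector θ)).analytic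
    simpa only [mixedDeriv_zero, fullDeriv_zero_zero] using e2

/-! ### The Duhamel integrand at a fixed time -/

/-- The mixed derivative `∂_Y^a ∂_x^b` of the inner integral of `E₃ ∂_Y w` at time distance `t`,
after integration by parts: one derivative sits on the kernel and `w` is differentiated `a ≤ 2`
times in `Y`. For `a = 0` this leaves a boundary term at `Y' = 0`. -/
noncomputable def duhamelSlice (a b : ℕ) (t : ℝ) (w : ℂ → ℂ → ℂ) (x Y : ℂ) : ℂ :=
  (∫ r in Ioi (0 : ℝ), reflKernel a t Y r * fullDeriv a b w x r) -
    if a = 0 then 2 * heatKernel Y t * fullDeriv 0 b w x 0 else 0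

namespace IsProfile

variable {l : ℕ} {P θ t : ℝ} {w : ℂ → ℂ → ℂ} {a b : ℕ} {x : ℂ}

lemma analytic_fullDeriv (hw : IsProfile l P θ w) (a b : ℕ) :
    AnalyticOnNhd ℂ (fun p : ℂ × ℂ => fullDeriv a b w p.1 p.2) (strip P ×ˢ openSector θ) :=
  analyticOnNhd_fullDeriv ((isOpen_strip P).prod (isOpen_openSector θ)) hw.analytic a b

lemma exists_bound (hw : IsProfile l P θ w) (ha : a ≤ 2) (hab : a + b ≤ l) (hx : x ∈ strip P) :
    ∃ B : ℝ, 0 ≤ B ∧ ∀ Y ∈ openSector θ, ‖fullDeriv a b w x Y‖ ≤ B := by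
  obtain ⟨r, hr, -, B, hB, h⟩ := hw.bounded a b ha hab x hx
  exact ⟨B, hB, fun Y hY => h x (Metric.mem_ball_self hr) Y hY⟩

lemma hasDerivAt_real (hw : IsProfile l P θ w) (hθ : 0 < Real.tan θ) (a b : ℕ) (hx : x ∈ strip P)
    {r : ℝ} (hr : 0 < r) :
    HasDerivAt (fun r : ℝ => fullDeriv a b w x r) (fullDeriv (a + 1) b w x r) r := by
  have h := analyticOnNhd_slice_snd (hw.analytic_fullDeriv a b) hx r (ofReal_mem_openSector hθ hr)
  have := h.differentiableAt.hasDerivAt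
  rw [← fullDeriv_succ] at this
  exact this.comp_ofReal

lemma continuousOn_real (hw : IsProfile l P θ w) (hθ : 0 < Real.tan θ) (a b : ℕ)
    (hx : x ∈ strip P) : ContinuousOn (fun r : ℝ => fullDeriv a b w x r) (Ioi 0) := fun _ hr =>
  (hw.hasDerivAt_real hθ a b hx hr).continuousAt.continuousWithinAt

/-- The inner integral of the Duhamel operator converges absolutely. -/
lemma integrableOn_heatKernel (hw : IsProfile l P θ w) (hθ : 0 < Real.tan θ) (ht : 0 < t)
    (hb : 1 + b ≤ l) (hx : x ∈ strip P) (Y : ℂ) :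
    IntegrableOn (fun r : ℝ => (heatKernel (Y - r) t + heatKernel (Y + r) t) *
      fullDeriv 1 b w x r) (Ioi 0) := by
  obtain ⟨B, hB0, hB⟩ := hw.exists_bound (a := 1) one_le_two hb hx
  have := (integrableOn_heatKernel_mul ht (hw.continuousOn_real hθ 1 b hx)
    (fun r hr => hB r (ofReal_mem_openSector hθ hr)) 1 Y).1
  simpa only [one_mul] using this

/-- Integration by parts with the even reflection. -/
lemma duhamelSlice_zero_eq (hw : IsProfile l P θ w) (hθ : 0 < Real.tan θ) (ht : 0 < t)
    (hb : 1 + b ≤ l) (hx : x ∈ strip P) (Y : ℂ) :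
    duhamelSlice 0 b t w x Y = ∫ r in Ioi (0 : ℝ),
      (heatKernel (Y - r) t + 1 * heatKernel (Y + r) t) * fullDeriv 1 b w x r := by
  obtain ⟨B, hB0, hB⟩ := hw.exists_bound (a := 0) (b := b) (by norm_num) (by omega) hx
  obtain ⟨B', hB0', hB'⟩ := hw.exists_bound (a := 1) one_le_two hb hx
  have hlim : Tendsto (fun r : ℝ => (heatKernel (Y - r) t + 1 * heatKernel (Y + r) t) *
      fullDeriv 0 b w x r) (𝓝[>] 0) (𝓝 (2 * heatKernel Y t * fullDeriv 0 b w x 0)) := by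
    have h1 : Tendsto (fun r : ℝ => heatKernel (Y - r) t + 1 * heatKernel (Y + r) t) (𝓝[>] 0)
        (𝓝 (2 * heatKernel Y t)) := by
      have hc : Continuous (fun r : ℝ => heatKernel (Y - r) t + 1 * heatKernel (Y + r) t) := by
        unfold heatKernel; fun_prop
      have := (hc.tendsto 0).mono_left (nhdsWithin_le_nhds (s := Ioi 0))
      simpa [two_mul] using this
    refine h1.mul ((hw.tendsto_zero b (by omega) x hx).comp ?_)
    refine tendsto_nhdsWithin_iff.2 ⟨?_, ?_⟩
    · have := (Complex.continuous_ofReal.tendsto 0).mono_left (nhdsWithin_le_nhds (s := Ioi 0))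
      simpa using this
    · filter_upwards [self_mem_nhdsWithin] with r hr using ofReal_mem_openSector hθ hr
  rw [integral_heatKernel_mul_deriv ht (fun r hr => hw.hasDerivAt_real hθ 0 b hx hr)
    (hw.continuousOn_real hθ 1 b hx) (fun r hr => hB r (ofReal_mem_openSector hθ hr))
    (fun r hr => hB' r (ofReal_mem_openSector hθ hr)) 1 Y hlim]
  simp only [duhamelSlice, reflKernel, if_true, zero_add, pow_one]
  rw [sub_eq_neg_add]
  congr 1
  refine setIntegral_congr_fun measurableSet_Ioi fun r _ => ?_
  ring

/-- Integration by parts with the odd reflection, for which the boundary term vanishes. -/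
lemma duhamelSlice_one_eq (hw : IsProfile l P θ w) (hθ : 0 < Real.tan θ) (ht : 0 < t)
    (hb : 2 + b ≤ l) (hx : x ∈ strip P) (Y : ℂ) :
    duhamelSlice 1 b t w x Y = ∫ r in Ioi (0 : ℝ),
      (heatKernel (Y - r) t + (-1) * heatKernel (Y + r) t) * fullDeriv 2 b w x r := by
  obtain ⟨B, hB0, hB⟩ := hw.exists_bound (a := 1) (b := b) (by norm_num) (by omega) hx
  obtain ⟨B', hB0', hB'⟩ := hw.exists_bound (a := 2) le_rfl hb hx
  have hlim : Tendsto (fun r : ℝ => (heatKernel (Y - r) t + (-1) * heatKernel (Y + r) t) *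
      fullDeriv 1 b w x r) (𝓝[>] 0) (𝓝 0) := by
    have h1 : Tendsto (fun r : ℝ => heatKernel (Y - r) t + (-1) * heatKernel (Y + r) t) (𝓝[>] 0)
        (𝓝 0) := by
      have hc : Continuous (fun r : ℝ => heatKernel (Y - r) t + (-1) * heatKernel (Y + r) t) := by
        unfold heatKernel; fun_prop
      have := (hc.tendsto 0).mono_left (nhdsWithin_le_nhds (s := Ioi 0))
      simpa using this
    refine h1.zero_mul_isBoundedUnder_le (isBoundedUnder_of_eventually_le (a := B) ?_)
    filter_upwards [self_mem_nhdsWithin] with r hr using hB r (ofReal_mem_openSector hθ hr)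
  rw [integral_heatKernel_mul_deriv ht (fun r hr => hw.hasDerivAt_real hθ 1 b hx hr)
    (hw.continuousOn_real hθ 2 b hx) (fun r hr => hB r (ofReal_mem_openSector hθ hr))
    (fun r hr => hB' r (ofReal_mem_openSector hθ hr)) (-1) Y hlim]
  simp only [duhamelSlice, reflKernel, one_ne_zero, if_false, sub_zero, neg_zero, zero_add]
  refine setIntegral_congr_fun measurableSet_Ioi fun r _ => ?_
  ring

/-- The slices are entire in `Y`, with the expected derivatives. -/
lemma hasDerivAt_duhamelSlice (hw : IsProfile l P θ w) (hθ : 0 < Real.tan θ) (ht : 0 < t)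
    (ha : a + 1 ≤ 2) (hab : a + 1 + b ≤ l) (hx : x ∈ strip P) (Y : ℂ) :
    HasDerivAt (duhamelSlice a b t w x) (duhamelSlice (a + 1) b t w x Y) Y := by
  obtain ⟨B, hB0, hB⟩ := hw.exists_bound ha hab hx
  have key := fun s => hasDerivAt_integral_heatKernel ht (hw.continuousOn_real hθ (a + 1) b hx)
    (fun r hr => hB r (ofReal_mem_openSector hθ hr)) s Y
  have ha1 : a ≤ 1 := by omega
  interval_cases a
  · have h1 : duhamelSlice 0 b t w x = _ := funext fun Y =>
      hw.duhamelSlice_zero_eq hθ ht (by omega) hx Y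
    rw [h1]
    refine (key 1).congr_deriv ?_
    simp [duhamelSlice, reflKernel]
  · have h1 : duhamelSlice 1 b t w x = _ := funext fun Y =>
      hw.duhamelSlice_one_eq hθ ht (by omega) hx Y
    rw [h1]
    refine (key (-1)).congr_deriv ?_
    simp [duhamelSlice, reflKernel, pow_succ]

/-- Exponential decay of the reflected kernel in a sector of half-angle less than `π/4`. -/
lemma exists_norm_reflKernel_le (hθ : 0 < Real.tan θ) (hθ1 : Real.tan θ < 1) (ht : 0 < t)
    (a : ℕ) {R : ℝ} (hR : 0 ≤ R) :
    ∃ A : ℝ, 0 ≤ A ∧ ∀ Y : ℂ, ‖Y‖ ≤ R → ∀ z ∈ openSector θ,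
      ‖reflKernel a t Y z‖ ≤ A * Real.exp (-‖z‖) := by
  have hc : 0 < (1 - Real.tan θ ^ 2) / 2 := by nlinarith
  obtain ⟨A, hA, h⟩ := exists_norm_heatKernel_sub_le hc ht hR
  refine ⟨A + A, by positivity, fun Y hY z hz => ?_⟩
  have hz2 := mul_normSq_le_re_sq hθ hθ1 (openSector_subset_sector θ hz)
  have h1 := (h Y z hY hz2).2
  have h2 := (h Y (-z) hY (by rwa [norm_neg, neg_sq])).2
  rw [norm_neg, sub_neg_eq_add] at h2
  calc _ ≤ _ := norm_reflKernel_le a t Y z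
    _ ≤ (A + A) * Real.exp (-‖z‖) := by rw [add_mul]; exact add_le_add h1 h2

/-- The integral defining a slice may be differentiated in `x`. -/
lemma dominatedHolomorphic_slice (hw : IsProfile l P θ w) (hθ : 0 < Real.tan θ)
    (hθ1 : Real.tan θ < 1) (ht : 0 < t) (ha : a ≤ 2) (hab : a + b ≤ l) (Y : ℂ) :
    DominatedHolomorphic (volume.restrict (Ioi (0 : ℝ))) (strip P)
      (fun (x : ℂ) (r : ℝ) => reflKernel a t Y r * fullDeriv a b w x r) := by
  have hkc : Continuous (fun r : ℝ => reflKernel a t Y r) :=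
    continuous_reflKernel a t continuous_const Complex.continuous_ofReal
  obtain ⟨A, hA, hk⟩ := exists_norm_reflKernel_le hθ hθ1 ht a (norm_nonneg Y)
  refine ⟨fun x hx => ?_, ?_, fun x hx => ?_⟩
  · exact (hkc.continuousOn.mul (hw.continuousOn_real hθ a b hx)).aestronglyMeasurable
      measurableSet_Ioi
  · refine (ae_restrict_iff' measurableSet_Ioi).2 (Eventually.of_forall fun r hr => ?_)
    have := (analyticOnNhd_slice_fst (g := fullDeriv a b w) (hw.analytic_fullDeriv a b)
      (ofReal_mem_openSector hθ hr)).differentiableOn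
    exact this.const_mul _
  · obtain ⟨r, hr, hsub, B, hB0, hB⟩ := hw.bounded a b ha hab x hx
    refine ⟨r, hr, hsub, fun r => A * B * Real.exp (-r), (integrableOn_exp_neg_Ioi 0).const_mul _, ?_⟩
    refine (ae_restrict_iff' measurableSet_Ioi).2 (Eventually.of_forall fun s hs x' hx' => ?_)
    have hs0 : (0 : ℝ) < s := hs
    have h1 := hk Y le_rfl s (ofReal_mem_openSector hθ hs)
    rw [Complex.norm_real, Real.norm_eq_abs, abs_of_pos hs0] at h1
    rw [norm_mul]
    calc _ ≤ (A * Real.exp (-s)) * B := mul_le_mul h1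
          (hB x' hx' s (ofReal_mem_openSector hθ hs)) (norm_nonneg _) (by positivity)
      _ = _ := by ring

lemma analyticOnNhd_iteratedDeriv_zero (hw : IsProfile l P θ w) (b : ℕ) :
    AnalyticOnNhd ℂ (fun x => fullDeriv 0 b w x 0) (strip P) := by
  have : (fun x => fullDeriv 0 b w x 0) = iteratedDeriv b (fun x => w x 0) := by
    funext x; simp [fullDeriv]
  rw [this, iteratedDeriv_eq_iterate]
  exact hw.analytic_zero.iterated_deriv b

lemma differentiableOn_duhamelSlice (hw : IsProfile l P θ w) (hθ : 0 < Real.tan θ)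
    (hθ1 : Real.tan θ < 1) (ht : 0 < t) (ha : a ≤ 2) (hab : a + b ≤ l) (Y : ℂ) :
    DifferentiableOn ℂ (fun x => duhamelSlice a b t w x Y) (strip P) := by
  unfold duhamelSlice
  refine (hw.dominatedHolomorphic_slice hθ hθ1 ht ha hab Y).differentiableOn.sub ?_
  split_ifs
  · exact (hw.analyticOnNhd_iteratedDeriv_zero b).differentiableOn.const_mul _
  · exact differentiableOn_const _

lemma iteratedDeriv_duhamelSlice (hw : IsProfile l P θ w) (hθ : 0 < Real.tan θ)
    (hθ1 : Real.tan θ < 1) (ht : 0 < t) (b : ℕ) (hx : x ∈ strip P) (Y : ℂ) :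
    iteratedDeriv b (fun x => duhamelSlice 0 0 t w x Y) x = duhamelSlice 0 b t w x Y := by
  have hd := hw.dominatedHolomorphic_slice hθ hθ1 ht (a := 0) (b := 0) (by norm_num) (by omega) Y
  have h0 : AnalyticAt ℂ (fun x => w x 0) x := hw.analytic_zero x hx
  simp only [duhamelSlice, if_true, fullDeriv_zero_zero] at hd ⊢
  have h1 : ContDiffAt ℂ b (fun x => ∫ r in Ioi (0 : ℝ), reflKernel 0 t Y r * w x r) x :=
    (hd.differentiableOn.analyticOnNhd hd.isOpen x hx).contDiffAt
  have h2 : ContDiffAt ℂ b (fun x => 2 * heatKernel Y t * w x 0) x :=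
    contDiffAt_const.mul h0.contDiffAt
  rw [iteratedDeriv_fun_sub h1 h2, hd.iteratedDeriv_integral b hx,
    iteratedDeriv_const_mul _ h0.contDiffAt]
  congr 1
  · refine setIntegral_congr_fun measurableSet_Ioi fun r hr => ?_
    rw [iteratedDeriv_const_mul]
    · simp [fullDeriv]
    · exact (analyticOnNhd_slice_fst hw.analytic (ofReal_mem_openSector hθ hr) x hx).contDiffAt

/-- The integral part of the slice, taken along an arbitrary ray of the sector. -/
lemma integral_reflKernel_ray (hw : IsProfile l P θ w) (hθ : 0 < Real.tan θ)
    (hθ1 : Real.tan θ < 1) (ht : 0 < t) (ha : a ≤ 2) (hab : a + b ≤ l) (hx : x ∈ strip P) (Y : ℂ)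
    {ω : ℂ} (hω : ω ∈ openSector θ) :
    ∫ r in Ioi (0 : ℝ), reflKernel a t Y r * fullDeriv a b w x r =
      ∫ r in Ioi (0 : ℝ), reflKernel a t Y (r * ω) * ω * fullDeriv a b w x (r * ω) := by
  obtain ⟨A, hA, hk⟩ := exists_norm_reflKernel_le hθ hθ1 ht a (norm_nonneg Y)
  obtain ⟨B, hB0, hB⟩ := hw.exists_bound ha hab hx
  have hkd : Differentiable ℂ (reflKernel a t Y) := by
    unfold reflKernel heatKernelDeriv heatKernel
    fun_prop
  have := integral_ray_eq (A := A * B) hθ (h := fun z => reflKernel a t Y z * fullDeriv a b w x z)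
    (hkd.differentiableOn.mul
      (analyticOnNhd_slice_snd (hw.analytic_fullDeriv a b) hx).differentiableOn)
    (fun z hz => by
      rw [norm_mul]
      calc _ ≤ (A * Real.exp (-‖z‖)) * B := mul_le_mul (hk Y le_rfl z hz) (hB z hz)
            (norm_nonneg _) (by positivity)
        _ = _ := by ring) hω
  rw [← this]
  refine setIntegral_congr_fun measurableSet_Ioi fun r _ => ?_
  ring

end IsProfile

/-! ### `L²` bounds for the slices -/

/-- Minkowski's inequality for a scalar kernel on the half line. -/
lemma eLpNorm_integral_Ioi_mul_le {κ : ℝ → ℂ} (hκ : Continuous κ) {W : ℝ → ℝ → ℂ}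
    (hW : ContinuousOn (Function.uncurry W) (Ioi 0 ×ˢ univ)) :
    eLpNorm (fun ξ => ∫ r in Ioi (0 : ℝ), κ r * W r ξ) 2 volume ≤
      ∫⁻ r in Ioi (0 : ℝ), ‖κ r‖ₑ * eLpNorm (W r) 2 volume := by
  have hm : AEStronglyMeasurable (Function.uncurry fun r ξ => κ r * W r ξ)
      ((volume.restrict (Ioi (0 : ℝ))).prod volume) := by
    have h1 : ContinuousOn (Function.uncurry fun r ξ => κ r * W r ξ) (Ioi (0 : ℝ) ×ˢ (univ : Set ℝ)) :=
      ContinuousOn.mul (hκ.comp continuous_fst).continuousOn hW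
    have h2 := h1.aestronglyMeasurable (μ := (volume : Measure ℝ).prod (volume : Measure ℝ))
      (measurableSet_Ioi.prod MeasurableSet.univ)
    rwa [← Measure.prod_restrict, Measure.restrict_univ] at h2
  refine (eLpNorm_integral_le hm).trans (le_of_eq ?_)
  refine lintegral_congr fun r => ?_
  exact eLpNorm_const_smul (κ r) (W r) 2 volume

namespace IsProfile

variable {l : ℕ} {P θ t : ℝ} {w : ℂ → ℂ → ℂ} {a b : ℕ} {y : ℝ}

lemma lineNorm_integral_mul_le (hw : IsProfile l P θ w) (a b : ℕ) (hy : y ∈ Ioo (-P) P) {ω : ℂ}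
    (hω : ω ∈ openSector θ) {κ : ℝ → ℂ} (hκ : Continuous κ) :
    lineNorm y (fun x => ∫ r in Ioi (0 : ℝ), κ r * fullDeriv a b w x (r * ω)) ≤
      ∫⁻ r in Ioi (0 : ℝ), ‖κ r‖ₑ * lineNorm y (fun x => fullDeriv a b w x (r * ω)) := by
  refine eLpNorm_integral_Ioi_mul_le hκ (W := fun (r : ℝ) (ξ : ℝ) =>
    fullDeriv a b w ((ξ : ℂ) + (y : ℂ) * Complex.I) (r * ω)) ?_
  refine (hw.analytic_fullDeriv a b).continuousOn.comp
    (f := fun p : ℝ × ℝ => (((p.2 : ℂ) + (y : ℂ) * Complex.I), (p.1 : ℂ) * ω)) (by fun_prop) ?_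
  intro p hp
  exact ⟨ofReal_add_mul_I_mem_strip hy _, mul_ofReal_mem_openSector hω hp.1⟩

/-- Separation of a slice, or of a difference of slices, into the integral part and the boundary
term. -/
lemma lineNorm_sub_boundary_le (hw : IsProfile l P θ w) (hy : y ∈ Ioo (-P) P) {f : ℂ → ℂ}
    (hf : ContinuousOn f (strip P)) (c : ℂ) {N : ℝ≥0∞}
    (hN0 : a = 0 → lineNorm y (fun x => fullDeriv 0 b w x 0) ≤ N) :
    lineNorm y (fun x => f x - if a = 0 then 2 * c * fullDeriv 0 b w x 0 else 0) ≤
      lineNorm y f + 2 * ‖c‖ₑ * N := by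
  split_ifs with h0
  · have hc := (hw.analyticOnNhd_iteratedDeriv_zero b).continuousOn
    refine (lineNorm_sub_le (g := fun x => 2 * c * fullDeriv 0 b w x 0) hy hf
      (continuousOn_const.mul hc)).trans ?_
    rw [lineNorm_const_mul, enorm_mul]
    gcongr
    · rw [← ofReal_norm]; simp
    · exact hN0 h0
  · simp

/-- `L²` bound for a slice at `Y = R ω` by `L²` bounds along the ray of direction `ω`. -/
lemma lineNorm_duhamelSlice_le (hw : IsProfile l P θ w) (hθ : 0 < Real.tan θ)
    (hθ1 : Real.tan θ < 1) (ht : 0 < t) (ha : a ≤ 2) (hab : a + b ≤ l)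
    (hy : y ∈ Ioo (-P) P) {ω : ℂ} (hω : ω ∈ openSector θ) (hω1 : ‖ω‖ = 1) {R ν : ℝ} {K N : ℝ≥0∞}
    (hN : ∀ r : ℝ, 0 < r → ENNReal.ofReal (Real.exp (ν * r)) *
      lineNorm y (fun x => fullDeriv a b w x (r * ω)) ≤ N)
    (hN0 : a = 0 → lineNorm y (fun x => fullDeriv 0 b w x 0) ≤ N)
    (hK0 : ENNReal.ofReal (‖heatKernel (R * ω) t‖ * Real.exp (ν * R)) ≤ K)
    (hK : ∫⁻ r in Ioi (0 : ℝ), ENNReal.ofReal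
        (‖reflKernel a t (R * ω) (r * ω)‖ * Real.exp (ν * (R - r))) ≤ K) :
    ENNReal.ofReal (Real.exp (ν * R)) *
      lineNorm y (fun x => duhamelSlice a b t w x (R * ω)) ≤ 3 * (K * N) := by
  have hk0 : Continuous fun r : ℝ => reflKernel a t (R * ω) (r * ω) :=
    continuous_reflKernel a t continuous_const (Complex.continuous_ofReal.mul continuous_const)
  have hI : lineNorm y (fun x => ∫ r in Ioi (0 : ℝ),
      reflKernel a t (R * ω) r * fullDeriv a b w x r) ≤ ∫⁻ r in Ioi (0 : ℝ),
        ‖reflKernel a t (R * ω) (r * ω) * ω‖ₑ * lineNorm y (fun x => fullDeriv a b w x (r * ω)) := by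
    rw [lineNorm_congr hy fun x hx =>
      hw.integral_reflKernel_ray hθ hθ1 ht ha hab hx (R * ω) hω]
    exact hw.lineNorm_integral_mul_le a b hy hω (hk0.mul continuous_const)
  have hb1 : ENNReal.ofReal (Real.exp (ν * R)) * lineNorm y (fun x => ∫ r in Ioi (0 : ℝ),
      reflKernel a t (R * ω) r * fullDeriv a b w x r) ≤ K * N := by
    refine (mul_le_mul_right hI _).trans ?_
    rw [← lintegral_const_mul' _ _ ENNReal.ofReal_ne_top]
    calc _ ≤ ∫⁻ r in Ioi (0 : ℝ), ENNReal.ofReal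
          (‖reflKernel a t (R * ω) (r * ω)‖ * Real.exp (ν * (R - r))) * N := by
          refine setLIntegral_mono' measurableSet_Ioi fun r hr => ?_
          have e1 : ENNReal.ofReal (Real.exp (ν * R)) = ENNReal.ofReal (Real.exp (ν * (R - r))) *
              ENNReal.ofReal (Real.exp (ν * r)) := by
            rw [← ENNReal.ofReal_mul (Real.exp_pos _).le, ← Real.exp_add]
            congr 2
            ring
          have e2 : ‖reflKernel a t (R * ω) (r * ω) * ω‖ₑ =
              ENNReal.ofReal ‖reflKernel a t (R * ω) (r * ω)‖ := by
            rw [← ofReal_norm, norm_mul, hω1, mul_one]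
          rw [e1, e2, ENNReal.ofReal_mul (norm_nonneg _), mul_mul_mul_comm,
            mul_comm (ENNReal.ofReal (Real.exp (ν * (R - r))))]
          exact mul_le_mul_right (hN r hr) _
      _ = (∫⁻ r in Ioi (0 : ℝ), ENNReal.ofReal
          (‖reflKernel a t (R * ω) (r * ω)‖ * Real.exp (ν * (R - r)))) * N :=
          lintegral_mul_const _ (by fun_prop)
      _ ≤ K * N := by gcongr
  have hdiff := (hw.dominatedHolomorphic_slice hθ hθ1 ht ha hab (R * ω)).differentiableOn
  have hsep := hw.lineNorm_sub_boundary_le (a := a) hy hdiff.continuousOn (heatKernel (R * ω) t) hN0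
  unfold duhamelSlice
  refine (mul_le_mul_right hsep _).trans ?_
  rw [mul_add, show (3 : ℝ≥0∞) * (K * N) = K * N + 2 * (K * N) by ring]
  refine add_le_add hb1 ?_
  rw [ENNReal.ofReal_mul (norm_nonneg _), ofReal_norm] at hK0
  calc ENNReal.ofReal (Real.exp (ν * R)) * (2 * ‖heatKernel (R * ω) t‖ₑ * N)
      = 2 * (‖heatKernel (R * ω) t‖ₑ * ENNReal.ofReal (Real.exp (ν * R)) * N) := by ring
    _ ≤ 2 * (K * N) := by gcongr

/-- `L²` bound for the difference of a slice at two points, by the `L¹` distance of the kernels. -/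
lemma lineNorm_duhamelSlice_sub_le (hw : IsProfile l P θ w) (hθ : 0 < Real.tan θ)
    (hθ1 : Real.tan θ < 1) (ht : 0 < t) (ha : a ≤ 2) (hab : a + b ≤ l)
    (hy : y ∈ Ioo (-P) P) {N : ℝ≥0∞}
    (hN : ∀ r : ℝ, 0 < r → lineNorm y (fun x => fullDeriv a b w x r) ≤ N)
    (hN0 : a = 0 → lineNorm y (fun x => fullDeriv 0 b w x 0) ≤ N) (Y Y₀ : ℂ) :
    lineNorm y (fun x => duhamelSlice a b t w x Y - duhamelSlice a b t w x Y₀) ≤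
      ((∫⁻ r in Ioi (0 : ℝ), ‖reflKernel a t Y r - reflKernel a t Y₀ r‖ₑ) +
        2 * ‖heatKernel Y t - heatKernel Y₀ t‖ₑ) * N := by
  have hkc : ∀ Y, Continuous (fun r : ℝ => reflKernel a t Y r) := fun Y =>
    continuous_reflKernel a t continuous_const Complex.continuous_ofReal
  have hκc : Continuous (fun r : ℝ => reflKernel a t Y r - reflKernel a t Y₀ r) :=
    (hkc Y).sub (hkc Y₀)
  have hd := fun Y => hw.dominatedHolomorphic_slice hθ hθ1 ht ha hab Y
  have hone : (1 : ℂ) ∈ openSector θ := by simpa using ofReal_mem_openSector hθ one_pos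
  have hI : EqOn (fun x => duhamelSlice a b t w x Y - duhamelSlice a b t w x Y₀)
      (fun x => (∫ r in Ioi (0 : ℝ), (reflKernel a t Y r - reflKernel a t Y₀ r) *
        fullDeriv a b w x r) - if a = 0 then 2 * (heatKernel Y t - heatKernel Y₀ t) *
        fullDeriv 0 b w x 0 else 0) (strip P) := fun x hx => by
    simp only [sub_mul, duhamelSlice]
    rw [integral_sub ((hd Y).integrable hx) ((hd Y₀).integrable hx)]
    split_ifs <;> ring
  have hI2 : EqOn (fun x => ∫ r in Ioi (0 : ℝ), (reflKernel a t Y r - reflKernel a t Y₀ r) *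
        fullDeriv a b w x r) (fun x => (∫ r in Ioi (0 : ℝ), reflKernel a t Y r *
        fullDeriv a b w x r) - ∫ r in Ioi (0 : ℝ), reflKernel a t Y₀ r *
        fullDeriv a b w x r) (strip P) := fun x hx => by
    simp only [sub_mul]
    rw [integral_sub ((hd Y).integrable hx) ((hd Y₀).integrable hx)]
  have hcont := (((hd Y).differentiableOn.continuousOn).sub
    ((hd Y₀).differentiableOn.continuousOn)).congr hI2
  rw [lineNorm_congr hy hI, add_mul]
  refine (hw.lineNorm_sub_boundary_le (a := a) hy hcont _ hN0).trans (add_le_add ?_ le_rfl)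
  have h1 := hw.lineNorm_integral_mul_le a b hy hone hκc
  simp only [mul_one] at h1
  refine h1.trans ?_
  rw [← lintegral_mul_const _ hκc.enorm.measurable]
  exact setLIntegral_mono' measurableSet_Ioi fun r hr => mul_le_mul_right (hN r hr) _

end IsProfile

/-! ### Measurability in time -/

lemma IsProfile.mono_strip {l : ℕ} {P P' θ : ℝ} {w : ℂ → ℂ → ℂ} (hw : IsProfile l P θ w)
    (h : P' ≤ P) : IsProfile l P' θ w := by
  have hsub : strip P' ⊆ strip P := fun z hz =>
    ⟨by linarith [hz.1], by linarith [hz.2]⟩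
  refine ⟨hw.analytic.mono (prod_mono hsub subset_rfl), fun a b ha hab x hx => ?_,
    fun b hb x hx => hw.tendsto_zero b hb x (hsub hx), hw.analytic_zero.mono hsub⟩
  obtain ⟨r, hr, -, B, hB, hle⟩ := hw.bounded a b ha hab x (hsub hx)
  obtain ⟨e, he, hes⟩ := Metric.isOpen_iff.1 (isOpen_strip P') x hx
  exact ⟨min r e, lt_min hr he, (Metric.ball_subset_ball (min_le_right _ _)).trans hes, B, hB,
    fun x' hx' => hle x' (Metric.ball_subset_ball (min_le_left _ _) hx')⟩

/-- The set of `(s,x,Y)` with `0 < s < t`, `x` in the strip and `Y ≠ 0` in the closed sector. It is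
invariant under positive real translations in `x` and `Y`. -/
def timeDomain (ρ θ t : ℝ) : Set (ℝ × ℂ × ℂ) := Ioo 0 t ×ˢ strip ρ ×ˢ (sector θ \ {0})

/-- A measurable family of profiles on a common strip, each defined on a sector larger than
`Σ(θ)`. -/
structure IsProfileFamily (l : ℕ) (ρ θ t : ℝ) (u : ℝ → ℂ → ℂ → ℂ) : Prop where
  tan_pos : 0 < Real.tan θ
  profile : ∀ s ∈ Ioo 0 t, ∃ Θ, Real.tan θ < Real.tan Θ ∧ Real.tan Θ < 1 ∧ IsProfile l ρ Θ (u s)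
  measurable : Measurable ((timeDomain ρ θ t).domRestrict
    (fun p : ℝ × ℂ × ℂ => u p.1 p.2.1 p.2.2))

lemma measurableSet_timeDomain (ρ θ t : ℝ) : MeasurableSet (timeDomain ρ θ t) :=
  measurableSet_Ioo.prod ((isOpen_strip ρ).measurableSet.prod
    ((isClosed_sector θ).measurableSet.diff (measurableSet_singleton 0)))

lemma measurable_indicator_of_domRestrict {α : Type*} [MeasurableSpace α] {S : Set α}
    (hS : MeasurableSet S) {f : α → ℂ} (hf : Measurable (S.domRestrict f)) :
    Measurable (S.indicator f) := by
  classical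
  have h := Measurable.dite (s := S) hf (measurable_const (a := (0 : ℂ))) hS
  convert h using 1
  funext p
  by_cases hp : p ∈ S <;> simp [hp]

/-- Limits of difference quotients along translations preserving `S` are measurable on `S`. -/
lemma measurable_domRestrict_of_tendsto {S : Set (ℝ × ℂ × ℂ)} {f g : ℝ × ℂ × ℂ → ℂ}
    {e : ℕ → ℝ × ℂ × ℂ} {c : ℕ → ℂ} (he : ∀ n, ∀ p ∈ S, p + e n ∈ S)
    (hf : Measurable (S.domRestrict f))
    (hlim : ∀ p ∈ S, Tendsto (fun n => c n * (f (p + e n) - f p)) atTop (𝓝 (g p))) :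
    Measurable (S.domRestrict g) := by
  refine measurable_of_tendsto_metrizable (f := fun n (p : S) => c n * (f (p + e n) - f p))
    (fun n => ?_) (tendsto_pi_nhds.2 fun p => hlim p p.2)
  have h1 : Measurable (fun p : S => (⟨p + e n, he n p p.2⟩ : S)) :=
    (measurable_subtype_coe.add_const _).subtype_mk
  exact ((hf.comp h1).sub hf).const_mul _

lemma tendsto_one_div_nhdsNE :
    Tendsto (fun n : ℕ => (((1 / ((n : ℝ) + 1)) : ℝ) : ℂ)) atTop (𝓝[≠] 0) := by
  refine tendsto_nhdsWithin_iff.2 ⟨?_, Eventually.of_forall fun n => ?_⟩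
  · have h2 := (Complex.continuous_ofReal.tendsto 0).comp
      (tendsto_one_div_add_atTop_nhds_zero_nat (𝕜 := ℝ))
    rwa [Complex.ofReal_zero] at h2
  · exact Complex.ofReal_ne_zero.2 (by positivity)

lemma add_ofReal_mem_strip {ρ : ℝ} {x : ℂ} (hx : x ∈ strip ρ) (r : ℝ) : x + (r : ℂ) ∈ strip ρ := by
  simpa [strip] using hx

lemma add_ofReal_mem_sector_diff {θ : ℝ} (hθ : 0 < Real.tan θ) {z : ℂ} (hz : z ∈ sector θ \ {0})
    {r : ℝ} (hr : 0 ≤ r) : z + (r : ℂ) ∈ sector θ \ {0} := by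
  refine ⟨add_ofReal_mem_sector hθ hz.1 hr, fun h => ?_⟩
  have h1 := re_pos_of_mem_sector hz.1 hz.2
  have h2 := congrArg Complex.re (mem_singleton_iff.1 h)
  simp only [Complex.add_re, Complex.ofReal_re, Complex.zero_re] at h2
  linarith

lemma ofReal_mem_sector_diff {θ : ℝ} (hθ : 0 < Real.tan θ) {r : ℝ} (hr : 0 < r) :
    (r : ℂ) ∈ sector θ \ {0} :=
  ⟨openSector_subset_sector θ (ofReal_mem_openSector hθ hr), Complex.ofReal_ne_zero.2 hr.ne'⟩

/-- Fatou's lemma: an `L²` bound passes to pointwise limits. -/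
lemma eLpNorm_le_of_tendsto {f : ℕ → ℝ → ℂ} {g : ℝ → ℂ} {N : ℝ≥0∞} (hf : ∀ n, Continuous (f n))
    (hlim : ∀ ξ, Tendsto (fun n => f n ξ) atTop (𝓝 (g ξ)))
    (hN : ∀ n, eLpNorm (f n) 2 volume ≤ N) : eLpNorm g 2 volume ≤ N :=
  (Lp.eLpNorm_lim_le_liminf_eLpNorm (fun n => (hf n).aestronglyMeasurable) g
    (Eventually.of_forall hlim)).trans
    (liminf_le_of_frequently_le' (Eventually.frequently (Eventually.of_forall hN)))

namespace IsProfileFamily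

variable {l : ℕ} {ρ θ t : ℝ} {u : ℝ → ℂ → ℂ → ℂ}

lemma analytic_fullDeriv (hu : IsProfileFamily l ρ θ t u) (a b : ℕ) {s : ℝ} (hs : s ∈ Ioo 0 t)
    {p : ℂ × ℂ} (hp : p ∈ strip ρ ×ˢ (sector θ \ {0})) :
    AnalyticAt ℂ (fun p : ℂ × ℂ => fullDeriv a b (u s) p.1 p.2) p := by
  obtain ⟨Θ, h1, -, hw⟩ := hu.profile s hs
  exact hw.analytic_fullDeriv a b p ⟨hp.1, sector_diff_zero_subset h1 hp.2⟩

lemma hasDerivAt_fst (hu : IsProfileFamily l ρ θ t u) (b : ℕ) {s : ℝ} (hs : s ∈ Ioo 0 t)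
    {x Y : ℂ} (hx : x ∈ strip ρ) (hY : Y ∈ sector θ \ {0}) :
    HasDerivAt (fun x => fullDeriv 0 b (u s) x Y) (fullDeriv 0 (b + 1) (u s) x Y) x := by
  have h : AnalyticAt ℂ (fun x => fullDeriv 0 b (u s) x Y) x :=
    AnalyticAt.fun_comp (g := fun p : ℂ × ℂ => fullDeriv 0 b (u s) p.1 p.2) (f := fun x => (x, Y))
      (hu.analytic_fullDeriv 0 b hs ⟨hx, hY⟩) (analyticAt_id.prod analyticAt_const)
  refine h.differentiableAt.hasDerivAt.congr_deriv ?_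
  simp [fullDeriv, iteratedDeriv_succ]

lemma hasDerivAt_snd (hu : IsProfileFamily l ρ θ t u) (a b : ℕ) {s : ℝ} (hs : s ∈ Ioo 0 t)
    {x Y : ℂ} (hx : x ∈ strip ρ) (hY : Y ∈ sector θ \ {0}) :
    HasDerivAt (fun Y => fullDeriv a b (u s) x Y) (fullDeriv (a + 1) b (u s) x Y) Y := by
  have h : AnalyticAt ℂ (fun Y => fullDeriv a b (u s) x Y) Y :=
    AnalyticAt.fun_comp (g := fun p : ℂ × ℂ => fullDeriv a b (u s) p.1 p.2) (f := fun Y => (x, Y))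
      (hu.analytic_fullDeriv a b hs ⟨hx, hY⟩) (analyticAt_const.prod analyticAt_id)
  rw [fullDeriv_succ]
  exact h.differentiableAt.hasDerivAt

/-- Derivatives are limits of difference quotients along the real translations that preserve
`timeDomain`. -/
lemma measurable_fullDeriv_restrict (hu : IsProfileFamily l ρ θ t u) (a b : ℕ) :
    Measurable ((timeDomain ρ θ t).domRestrict
      (fun p : ℝ × ℂ × ℂ => fullDeriv a b (u p.1) p.2.1 p.2.2)) := by
  induction a with
  | zero =>
    induction b with
    | zero => simpa only [fullDeriv_zero_zero] using hu.measurable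
    | succ b ih =>
      refine measurable_domRestrict_of_tendsto
        (e := fun n : ℕ => (0, (((1 / ((n : ℝ) + 1)) : ℝ) : ℂ), 0))
        (c := fun n : ℕ => ((((1 / ((n : ℝ) + 1)) : ℝ) : ℂ))⁻¹) (fun n p hp => ?_) ih
        fun p hp => ?_
      · refine ⟨by simpa using hp.1, ?_, by simpa using hp.2.2⟩
        exact add_ofReal_mem_strip hp.2.1 _
      · have h := hasDerivAt_iff_tendsto_slope_zero.1 (hu.hasDerivAt_fst b hp.1 hp.2.1 hp.2.2)
        have := h.comp tendsto_one_div_nhdsNE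
        simpa [Function.comp_def] using this
  | succ a ih =>
    refine measurable_domRestrict_of_tendsto
      (e := fun n : ℕ => (0, 0, (((1 / ((n : ℝ) + 1)) : ℝ) : ℂ)))
      (c := fun n : ℕ => ((((1 / ((n : ℝ) + 1)) : ℝ) : ℂ))⁻¹) (fun n p hp => ?_) ih
      fun p hp => ?_
    · refine ⟨by simpa using hp.1, by simpa using hp.2.1, ?_⟩
      exact add_ofReal_mem_sector_diff hu.tan_pos hp.2.2 (by positivity)
    · have h := hasDerivAt_iff_tendsto_slope_zero.1 (hu.hasDerivAt_snd a b hp.1 hp.2.1 hp.2.2)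
      have := h.comp tendsto_one_div_nhdsNE
      simpa [Function.comp_def] using this

lemma measurable_fullDeriv (hu : IsProfileFamily l ρ θ t u) (a b : ℕ) :
    Measurable ((timeDomain ρ θ t).indicator
      (fun p : ℝ × ℂ × ℂ => fullDeriv a b (u p.1) p.2.1 p.2.2)) :=
  measurable_indicator_of_domRestrict (measurableSet_timeDomain ρ θ t)
    (hu.measurable_fullDeriv_restrict a b)

lemma tendsto_fullDeriv_zero (hu : IsProfileFamily l ρ θ t u) {b : ℕ} (hb : b ≤ l) {s : ℝ}
    (hs : s ∈ Ioo 0 t) {x : ℂ} (hx : x ∈ strip ρ) :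
    Tendsto (fun n : ℕ => fullDeriv 0 b (u s) x (((1 / ((n : ℝ) + 1)) : ℝ) : ℂ)) atTop
      (𝓝 (fullDeriv 0 b (u s) x 0)) := by
  obtain ⟨Θ, h1, -, hw⟩ := hu.profile s hs
  refine (hw.tendsto_zero b hb x hx).comp (tendsto_nhdsWithin_iff.2
    ⟨tendsto_nhds_of_tendsto_nhdsWithin tendsto_one_div_nhdsNE, Eventually.of_forall fun n => ?_⟩)
  exact ofReal_mem_openSector (hu.tan_pos.trans h1) (by positivity)

/-- The slices of the Duhamel integrand agree on the strip with a jointly measurable function of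
time and `x`. -/
lemma exists_measurable_duhamelSlice (hu : IsProfileFamily l ρ θ t u) {a b : ℕ} (hb : b ≤ l)
    (Y : ℂ) : ∃ g : ℝ × ℂ → ℂ, StronglyMeasurable g ∧ ∀ s ∈ Ioo 0 t, ∀ x ∈ strip ρ,
      g (s, x) = duhamelSlice a b (t - s) (u s) x Y := by
  set D := (timeDomain ρ θ t).indicator
    (fun p : ℝ × ℂ × ℂ => fullDeriv a b (u p.1) p.2.1 p.2.2) with hD
  have hDm : Measurable D := hu.measurable_fullDeriv a b
  have hk : Measurable (fun p : (ℝ × ℂ) × ℝ => reflKernel a (t - p.1.1) Y p.2 *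
      D (p.1.1, p.1.2, (p.2 : ℂ))) := by
    refine Measurable.mul ?_ (hDm.comp (by fun_prop))
    unfold reflKernel heatKernelDeriv heatKernel
    fun_prop
  have h1 : StronglyMeasurable (fun p : ℝ × ℂ => ∫ r in Ioi (0 : ℝ),
      reflKernel a (t - p.1) Y r * D (p.1, p.2, (r : ℂ))) :=
    hk.stronglyMeasurable.integral_prod_right'
  -- the boundary values at `Y = 0` are limits of values at `1 / (n + 1)`
  have h0 : ∃ g₀ : ℝ × ℂ → ℂ, Measurable g₀ ∧ ∀ s ∈ Ioo 0 t, ∀ x ∈ strip ρ,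
      g₀ (s, x) = fullDeriv 0 b (u s) x 0 := by
    set S : Set (ℝ × ℂ) := Ioo 0 t ×ˢ strip ρ with hS
    have hSm : MeasurableSet S := measurableSet_Ioo.prod (isOpen_strip ρ).measurableSet
    refine ⟨S.indicator (fun p => fullDeriv 0 b (u p.1) p.2 0), ?_, fun s hs x hx =>
      indicator_of_mem (show (s, x) ∈ S from ⟨hs, hx⟩) _⟩
    refine measurable_of_tendsto_metrizable (f := fun (n : ℕ) (p : ℝ × ℂ) =>
      (timeDomain ρ θ t).indicator (fun p : ℝ × ℂ × ℂ => fullDeriv 0 b (u p.1) p.2.1 p.2.2)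
        (p.1, p.2, (((1 / ((n : ℝ) + 1)) : ℝ) : ℂ))) (fun n => ?_) (tendsto_pi_nhds.2 fun p => ?_)
    · exact (hu.measurable_fullDeriv 0 b).comp (by fun_prop)
    · by_cases hp : p ∈ S
      · rw [indicator_of_mem hp]
        refine (hu.tendsto_fullDeriv_zero hb hp.1 hp.2).congr fun n => ?_
        rw [indicator_of_mem]
        exact ⟨hp.1, hp.2, ofReal_mem_sector_diff hu.tan_pos (by positivity)⟩
      · rw [indicator_of_notMem hp]
        refine tendsto_const_nhds.congr fun n => ?_
        rw [indicator_of_notMem]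
        exact fun h => hp ⟨h.1, h.2.1⟩
  obtain ⟨g₀, hg₀, hg₀e⟩ := h0
  refine ⟨fun p => (∫ r in Ioi (0 : ℝ), reflKernel a (t - p.1) Y r * D (p.1, p.2, (r : ℂ))) -
    if a = 0 then 2 * heatKernel Y (t - p.1) * g₀ p else 0, h1.sub ?_, fun s hs x hx => ?_⟩
  · refine Measurable.stronglyMeasurable ?_
    split_ifs
    · refine Measurable.mul ?_ hg₀
      unfold heatKernel
      fun_prop
    · exact measurable_const
  · simp only [duhamelSlice, hg₀e s hs x hx]
    congr 1
    refine setIntegral_congr_fun measurableSet_Ioi fun r hr => ?_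
    simp only [hD]
    rw [indicator_of_mem]
    exact ⟨hs, hx, ofReal_mem_sector_diff hu.tan_pos hr⟩

/-- A measurable majorant, in time, of the weighted `L²` norms of an admissible derivative that is
still dominated by the (possibly non-measurable) `K`-norm: the supremum over a countable dense set
of lines and points of the sector. -/
lemma exists_majorant (hu : IsProfileFamily l ρ θ t u) (hρ : 0 < ρ) {μ : ℝ} (hμ : 0 ≤ μ) {a b : ℕ}
    (ha : a ≤ 2) (hab : a + b ≤ l) :
    ∃ N : ℝ → ℝ≥0∞, Measurable N ∧ (∀ s ∈ Ioo 0 t, N s ≤ kNorm l ρ θ μ (u s)) ∧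
      ∀ s ∈ Ioo 0 t, ∀ y ∈ Ioo (-ρ) ρ,
        (∀ Y ∈ sector θ \ {0}, ENNReal.ofReal (Real.exp (μ * Y.re)) *
          lineNorm y (fun x => fullDeriv a b (u s) x Y) ≤ N s) ∧
        (a = 0 → lineNorm y (fun x => fullDeriv 0 b (u s) x 0) ≤ N s) := by
  set D := (timeDomain ρ θ t).indicator
    (fun p : ℝ × ℂ × ℂ => fullDeriv a b (u p.1) p.2.1 p.2.2) with hD
  have hDm : Measurable D := hu.measurable_fullDeriv a b
  set S : Set (ℝ × ℂ) := Ioo (-ρ) ρ ×ˢ (sector θ \ {0}) with hS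
  have : Nonempty S := ⟨⟨(0, ((1 : ℝ) : ℂ)), ⟨by constructor <;> linarith,
    ofReal_mem_sector_diff hu.tan_pos one_pos⟩⟩⟩
  let d : ℕ → S := TopologicalSpace.denseSeq S
  set N : ℝ → ℝ≥0∞ := fun s => ⨆ n, ENNReal.ofReal (Real.exp (μ * (d n).1.2.re)) *
    lineNorm (d n).1.1 (fun x => D (s, x, (d n).1.2)) with hN
  have hDs : ∀ s ∈ Ioo 0 t, ∀ p ∈ S, lineNorm p.1 (fun x => D (s, x, p.2)) =
      lineNorm p.1 (fun x => fullDeriv a b (u s) x p.2) := fun s hs p hp =>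
    lineNorm_congr hp.1 fun x hx => by
      simp only [hD]
      rw [indicator_of_mem]
      exact ⟨hs, hx, hp.2⟩
  have hmain : ∀ s ∈ Ioo 0 t, ∀ y ∈ Ioo (-ρ) ρ, ∀ Y ∈ sector θ \ {0},
      ENNReal.ofReal (Real.exp (μ * Y.re)) *
          lineNorm y (fun x => fullDeriv a b (u s) x Y) ≤ N s := by
    intro s hs y hy Y hY
    have hcl : (⟨(y, Y), hy, hY⟩ : S) ∈ closure (range d) :=
      TopologicalSpace.denseRange_denseSeq S _
    obtain ⟨v, hv, hvlim⟩ := mem_closure_iff_seq_limit.1 hcl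
    have hvlim' : Tendsto (fun n => ((v n).1 : ℝ × ℂ)) atTop (𝓝 (y, Y)) :=
      (continuous_subtype_val.tendsto _).comp hvlim
    have hconst : ∀ (y : ℝ) (Y : ℂ), ENNReal.ofReal (Real.exp (μ * Y.re)) *
        lineNorm y (fun x => fullDeriv a b (u s) x Y) = eLpNorm (fun ξ : ℝ =>
        ((Real.exp (μ * Y.re) : ℝ) : ℂ) * fullDeriv a b (u s) ((ξ : ℂ) + (y : ℂ) * Complex.I) Y)
          2 volume := fun y Y => by
      have := lineNorm_const_mul y ((Real.exp (μ * Y.re) : ℝ) : ℂ)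
        (fun x => fullDeriv a b (u s) x Y)
      rw [← ofReal_norm, Complex.norm_real, Real.norm_eq_abs, abs_of_pos (Real.exp_pos _)] at this
      rw [← this]
      rfl
    rw [hconst]
    refine eLpNorm_le_of_tendsto (f := fun n (ξ : ℝ) =>
        ((Real.exp (μ * (v n).1.2.re) : ℝ) : ℂ) *
          fullDeriv a b (u s) ((ξ : ℂ) + ((v n).1.1 : ℂ) * Complex.I) (v n).1.2)
      (fun n => ?_) (fun ξ => ?_) fun n => ?_
    · refine continuous_const.mul (continuous_line (f := fun x => fullDeriv a b (u s) x (v n).1.2)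
        (v n).2.1 fun x hx => ?_)
      have h := (hu.analytic_fullDeriv a b hs (p := (x, (v n).1.2)) ⟨hx, (v n).2.2⟩).continuousAt
      exact (ContinuousAt.comp (g := fun p : ℂ × ℂ => fullDeriv a b (u s) p.1 p.2)
        (f := fun x => (x, (v n).1.2)) h (by fun_prop)).continuousWithinAt
    · have h := (hu.analytic_fullDeriv a b hs
        (p := ((ξ : ℂ) + (y : ℂ) * Complex.I, Y)) ⟨ofReal_add_mul_I_mem_strip hy ξ, hY⟩).continuousAt
      have hc : Continuous (fun q : ℝ × ℂ => ((Real.exp (μ * q.2.re) : ℝ) : ℂ)) := by fun_prop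
      have hq : Continuous (fun q : ℝ × ℂ => ((ξ : ℂ) + (q.1 : ℂ) * Complex.I, q.2)) := by fun_prop
      have h2 : ContinuousAt (fun q : ℝ × ℂ => ((Real.exp (μ * q.2.re) : ℝ) : ℂ) *
          fullDeriv a b (u s) ((ξ : ℂ) + (q.1 : ℂ) * Complex.I) q.2) (y, Y) :=
        hc.continuousAt.mul (ContinuousAt.comp (g := fun p : ℂ × ℂ => fullDeriv a b (u s) p.1 p.2)
          (f := fun q : ℝ × ℂ => ((ξ : ℂ) + (q.1 : ℂ) * Complex.I, q.2)) h hq.continuousAt)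
      exact h2.tendsto.comp hvlim'
    · obtain ⟨m, hm⟩ := hv n
      rw [← hconst, ← hDs s hs _ (v n).2, ← hm]
      exact le_iSup (fun n => ENNReal.ofReal (Real.exp (μ * (d n).1.2.re)) *
        lineNorm (d n).1.1 (fun x => D (s, x, (d n).1.2))) m
  refine ⟨N, ?_, fun s hs => ?_, fun s hs y hy => ⟨hmain s hs y hy, fun h0 => ?_⟩⟩
  · refine Measurable.iSup fun n => Measurable.const_mul ?_ _
    simp only [lineNorm, eLpNorm_two_eq]
    refine Measurable.pow_const ?_ _
    have : Measurable (fun p : ℝ × ℝ => ‖D (p.1, (p.2 : ℂ) + ((d n).1.1 : ℂ) * Complex.I,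
        (d n).1.2)‖ₑ ^ (2 : ℝ)) := by
      refine Measurable.pow_const (Measurable.enorm (hDm.comp ?_)) _
      fun_prop
    exact this.lintegral_prod_right'
  · refine iSup_le fun n => ?_
    rw [hDs s hs _ (d n).2]
    obtain ⟨Θ, h1, -, hw⟩ := hu.profile s hs
    refine le_trans ?_ (mul_hNorm_le_kNorm (u s) ha hab (d n).2.2.1)
    refine mul_le_mul_right ?_ _
    rw [hNorm_congr (fun x hx => mixedDeriv_eq_of_analytic hu.tan_pos hw.analytic a b hx
      (sector_diff_zero_subset h1 (d n).2.2) (d n).2.2.1)]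
    exact lineNorm_le_hNorm _ (d n).2.1
  · subst h0
    refine eLpNorm_le_of_tendsto (f := fun n (ξ : ℝ) =>
      fullDeriv 0 b (u s) ((ξ : ℂ) + (y : ℂ) * Complex.I) (((1 / ((n : ℝ) + 1)) : ℝ) : ℂ))
      (fun n => ?_) (fun ξ => hu.tendsto_fullDeriv_zero (by omega) hs
        (ofReal_add_mul_I_mem_strip hy ξ)) fun n => ?_
    · refine continuous_line (f := fun x => fullDeriv 0 b (u s) x (((1 / ((n : ℝ) + 1)) : ℝ) : ℂ))
        hy fun x hx => ?_
      have hn : (((1 / ((n : ℝ) + 1)) : ℝ) : ℂ) ∈ sector θ \ {0} :=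
        ofReal_mem_sector_diff hu.tan_pos (by positivity)
      exact (hu.hasDerivAt_fst b hs hx hn).continuousAt.continuousWithinAt
    · have hn : (((1 / ((n : ℝ) + 1)) : ℝ) : ℂ) ∈ sector θ \ {0} :=
        ofReal_mem_sector_diff hu.tan_pos (by positivity)
      refine le_trans (le_mul_of_one_le_left zero_le ?_) (hmain s hs y hy _ hn)
      rw [ENNReal.one_le_ofReal]
      refine Real.one_le_exp (mul_nonneg hμ ?_)
      rw [Complex.ofReal_re]
      positivity

end IsProfileFamily

/-! ### Integration of the slices in time -/

/-- The kernels depend continuously on `Y` in `L¹` of the half line. -/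
lemma tendsto_lintegral_reflKernel_sub {t : ℝ} (ht : 0 < t) (a : ℕ) (Y₀ : ℂ) :
    Tendsto (fun Y => (∫⁻ r in Ioi (0 : ℝ), ‖reflKernel a t Y r - reflKernel a t Y₀ r‖ₑ) +
      2 * ‖heatKernel Y t - heatKernel Y₀ t‖ₑ) (𝓝 Y₀) (𝓝 0) := by
  have h2 : Tendsto (fun Y => 2 * ‖heatKernel Y t - heatKernel Y₀ t‖ₑ) (𝓝 Y₀) (𝓝 0) := by
    have hc : Continuous (fun Y => ‖heatKernel Y t - heatKernel Y₀ t‖ₑ) :=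
      ((continuous_heatKernel t).sub continuous_const).enorm
    have := ENNReal.Tendsto.const_mul (a := 2) (hc.tendsto Y₀) (Or.inr (by norm_num))
    simpa using this
  have h1 : Tendsto (fun Y => ∫⁻ r in Ioi (0 : ℝ), ‖reflKernel a t Y r - reflKernel a t Y₀ r‖ₑ)
      (𝓝 Y₀) (𝓝 0) := by
    have hk : ∀ Y, Continuous (fun r : ℝ => reflKernel a t Y r) := fun Y =>
      continuous_reflKernel a t continuous_const Complex.continuous_ofReal
    obtain ⟨A, hA, hle⟩ := exists_norm_heatKernel_real_le (R := ‖Y₀‖ + 1) ht (by positivity)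
    have hb : ∀ Y : ℂ, ‖Y‖ ≤ ‖Y₀‖ + 1 → ∀ r ∈ Ioi (0 : ℝ),
        ‖reflKernel a t Y r‖ ≤ 2 * A * Real.exp (-r) := fun Y hY r hr => by
      obtain ⟨-, -, e1, e2⟩ := hle Y hY r hr
      linarith [norm_reflKernel_le a t Y r]
    have hint : IntegrableOn (fun r : ℝ => 4 * A * Real.exp (-r)) (Ioi 0) :=
      (integrableOn_exp_neg_Ioi 0).const_mul _
    have := tendsto_lintegral_filter_of_dominated_convergence
      (μ := volume.restrict (Ioi (0 : ℝ))) (l := 𝓝 Y₀)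
      (F := fun Y (r : ℝ) => ‖reflKernel a t Y r - reflKernel a t Y₀ r‖ₑ) (f := fun _ => 0)
      (fun r => ENNReal.ofReal (4 * A * Real.exp (-r)))
      (Eventually.of_forall fun Y => ((hk Y).sub (hk Y₀)).enorm.measurable) ?_ ?_ ?_
    · simpa using this
    · have hnear : ∀ᶠ Y in 𝓝 Y₀, ‖Y‖ ≤ ‖Y₀‖ + 1 := by
        filter_upwards [Metric.ball_mem_nhds Y₀ one_pos] with Y hY
        rw [Metric.mem_ball, dist_eq_norm] at hY
        linarith [norm_le_norm_add_norm_sub' Y Y₀]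
      filter_upwards [hnear] with Y hY
      refine (ae_restrict_iff' measurableSet_Ioi).2 (Eventually.of_forall fun r hr => ?_)
      rw [← ofReal_norm]
      refine ENNReal.ofReal_le_ofReal ?_
      have e1 := hb Y hY r hr
      have e2 := hb Y₀ (by linarith) r hr
      linarith [norm_sub_le (reflKernel a t Y r) (reflKernel a t Y₀ r)]
    · exact ne_of_lt hint.lintegral_lt_top
    · refine Eventually.of_forall fun r => ?_
      have hc : Continuous (fun Y => ‖reflKernel a t Y r - reflKernel a t Y₀ r‖ₑ) :=
        ((continuous_reflKernel a t continuous_id continuous_const).sub continuous_const).enorm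
      simpa using hc.tendsto Y₀
  simpa using h1.add h2

/-- Minkowski's inequality on a line for time integrals. -/
lemma lineNorm_setIntegral_le {ρ t y : ℝ} (hy : y ∈ Ioo (-ρ) ρ) {F : ℝ → ℂ → ℂ} {g : ℝ × ℂ → ℂ}
    (hg : StronglyMeasurable g) (hF : ∀ s ∈ Ioo 0 t, ∀ x ∈ strip ρ, g (s, x) = F s x) :
    lineNorm y (fun x => ∫ s in Ioo 0 t, F s x) ≤ ∫⁻ s in Ioo 0 t, lineNorm y (F s) := by
  have h1 : lineNorm y (fun x => ∫ s in Ioo 0 t, F s x) =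
      lineNorm y (fun x => ∫ s in Ioo 0 t, g (s, x)) :=
    lineNorm_congr hy fun x hx =>
      setIntegral_congr_fun measurableSet_Ioo fun s hs => (hF s hs x hx).symm
  have h2 : ∫⁻ s in Ioo 0 t, lineNorm y (F s) = ∫⁻ s in Ioo 0 t, lineNorm y (fun x => g (s, x)) :=
    setLIntegral_congr_fun measurableSet_Ioo fun s hs =>
      lineNorm_congr hy fun x hx => (hF s hs x hx).symm
  rw [h1, h2]
  refine eLpNorm_integral_le
    (f := fun (s : ℝ) (ξ : ℝ) => g (s, (ξ : ℂ) + (y : ℂ) * Complex.I)) ?_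
  exact (hg.comp_measurable (g := fun p : ℝ × ℝ => (p.1, (p.2 : ℂ) + (y : ℂ) * Complex.I))
    (by fun_prop)).aestronglyMeasurable

/-- The mixed derivative `∂_Y^a ∂_x^b` of `E₃(t) ∂_Y u`, as a time integral of slices. -/
noncomputable def duhamelIntegral (a b : ℕ) (t : ℝ) (u : ℝ → ℂ → ℂ → ℂ) (x Y : ℂ) : ℂ :=
  ∫ s in Ioo 0 t, duhamelSlice a b (t - s) (u s) x Y

/-- Measurable majorants in time: `N` for the derivative of `u` on which the kernel acts and `M`,
integrable, for the slices, both uniform in the line `Im x = y`. -/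
structure IsSliceMajorant (ρ θ μ t : ℝ) (u : ℝ → ℂ → ℂ → ℂ) (a b : ℕ) (N M : ℝ → ℝ≥0∞) :
    Prop where
  measurable_N : Measurable N
  measurable_M : Measurable M
  lintegral_ne_top : ∫⁻ s in Ioo 0 t, M s ≠ ∞
  N_lt_top : ∀ᵐ s ∂volume.restrict (Ioo 0 t), N s < ∞
  le_M : ∀ s ∈ Ioo 0 t, ∀ y ∈ Ioo (-ρ) ρ, ∀ Y ∈ sector θ, ENNReal.ofReal (Real.exp (μ * Y.re)) *
    lineNorm y (fun x => duhamelSlice a b (t - s) (u s) x Y) ≤ M s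
  le_N : ∀ s ∈ Ioo 0 t, ∀ y ∈ Ioo (-ρ) ρ,
    (∀ r : ℝ, 0 < r → lineNorm y (fun x => fullDeriv a b (u s) x r) ≤ N s) ∧
    (a = 0 → lineNorm y (fun x => fullDeriv 0 b (u s) x 0) ≤ N s)

namespace IsProfileFamily

variable {l : ℕ} {ρ θ t μ : ℝ} {u : ℝ → ℂ → ℂ → ℂ} {a b : ℕ} {N M : ℝ → ℝ≥0∞}

/-- A finite singular integral provides slice majorants with controlled time integral. The kernel
bound `hC` is a hypothesis so that the same constant serves all times and all sectors. -/
lemma exists_sliceMajorant (hu : IsProfileFamily l ρ θ t u) (hρ : 0 < ρ) {T μ₀ c C : ℝ}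
    (hμ : 0 ≤ μ) (hμ₀ : μ ≤ μ₀) (htT : t ≤ T) (hC0 : 0 < C)
    (hc : c ≤ (1 - Real.tan θ ^ 2) / 2)
    (hC : ∀ t ∈ Ioc 0 T, ∀ ν ∈ Icc 0 μ₀, ∀ ω : ℂ, ‖ω‖ = 1 → c ≤ (ω ^ 2).re →
      ∀ R : ℝ, 0 ≤ R →
      ENNReal.ofReal (‖heatKernel (R * ω) t‖ * Real.exp (ν * R)) ≤
        ENNReal.ofReal (C * (1 / Real.sqrt t)) ∧
      ∀ a : ℕ, ∫⁻ r in Ioi (0 : ℝ), ENNReal.ofReal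
        (‖reflKernel a t (R * ω) (r * ω)‖ * Real.exp (ν * (R - r))) ≤
          ENNReal.ofReal (C * (1 / Real.sqrt t)))
    (hfin : singularIntegral l ρ θ μ t u < ∞) (ha : a ≤ 2) (hab : a + b ≤ l) :
    ∃ N M : ℝ → ℝ≥0∞, IsSliceMajorant ρ θ μ t u a b N M ∧
      ∫⁻ s in Ioo 0 t, M s ≤ ENNReal.ofReal (3 * C) * singularIntegral l ρ θ μ t u := by
  obtain ⟨N, hNm, hNk, hN⟩ := hu.exists_majorant hρ hμ ha hab
  -- one unit of the factor `3` is the integral part, the other two are the boundary term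
  set M : ℝ → ℝ≥0∞ := fun s => 3 * (ENNReal.ofReal (C * (1 / Real.sqrt (t - s))) * N s) with hM
  have hMm : Measurable M := by
    refine Measurable.const_mul (Measurable.mul ?_ hNm) _
    fun_prop
  have hMint : ∫⁻ s in Ioo 0 t, M s ≤ ENNReal.ofReal (3 * C) * singularIntegral l ρ θ μ t u := by
    rw [singularIntegral, ← lintegral_const_mul' _ _ ENNReal.ofReal_ne_top]
    refine setLIntegral_mono' measurableSet_Ioo fun s hs => ?_
    have h3 : ENNReal.ofReal (3 * C) = 3 * ENNReal.ofReal C := by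
      rw [ENNReal.ofReal_mul (by norm_num)]
      norm_num
    rw [hM, h3]
    simp only
    rw [ENNReal.ofReal_mul hC0.le, mul_assoc, mul_assoc]
    gcongr
    exact hNk s hs
  have hMtop : ∫⁻ s in Ioo 0 t, M s ≠ ∞ :=
    ne_top_of_le_ne_top (ENNReal.mul_ne_top ENNReal.ofReal_ne_top hfin.ne) hMint
  refine ⟨N, M, ⟨hNm, hMm, hMtop, ?_, fun s hs y hy Y hY => ?_, fun s hs y hy => ⟨fun r hr => ?_,
    (hN s hs y hy).2⟩⟩, hMint⟩
  · filter_upwards [ae_lt_top hMm hMtop, ae_restrict_mem measurableSet_Ioo] with s hs hst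
    by_contra hNs
    rw [not_lt, top_le_iff] at hNs
    have hpos : 0 < C * (1 / Real.sqrt (t - s)) := by
      have : 0 < t - s := by linarith [hst.2]
      positivity
    have : M s = ∞ := by
      simp only [hM, hNs]
      rw [ENNReal.mul_top (by simpa using hpos), ENNReal.mul_top (by norm_num)]
    exact hs.ne this
  · obtain ⟨Θ, h1, h2, hw⟩ := hu.profile s hs
    obtain ⟨ω, hω, hω1, R, hR, rfl⟩ := exists_eq_mul_of_mem_sector hu.tan_pos hY
    have hω0 : ω ∈ sector θ \ {0} := ⟨hω, fun h => by
      rw [mem_singleton_iff] at h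
      simp [h] at hω1⟩
    have hre : ω.re ≤ 1 := hω1 ▸ Complex.re_le_norm ω
    have hc' : c ≤ (ω ^ 2).re := by
      have := mul_normSq_le_re_sq hu.tan_pos (h1.trans h2) hω
      rw [hω1] at this
      linarith
    -- along the ray of direction `ω` the weight `exp (μ Re Y)` is `exp (ν R)` with `ν = μ Re ω`
    obtain ⟨k0, k1⟩ := hC (t - s) ⟨by linarith [hs.2], by linarith [hs.1]⟩ (μ * ω.re)
      ⟨mul_nonneg hμ hω.1, (mul_le_of_le_one_right hμ hre).trans hμ₀⟩ ω hω1 hc' R hR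
    have hν : μ * ((R : ℂ) * ω).re = μ * ω.re * R := by
      rw [Complex.re_ofReal_mul]; ring
    rw [hν]
    refine hw.lineNorm_duhamelSlice_le (hu.tan_pos.trans h1) h2 (by linarith [hs.2]) ha hab hy
      (sector_diff_zero_subset h1 hω0) hω1 (fun r hr => ?_) (hN s hs y hy).2 k0 (k1 a)
    have hr' : (r : ℂ) * ω ∈ sector θ \ {0} := ⟨mul_ofReal_mem_sector hω hr.le,
      mul_ne_zero (Complex.ofReal_ne_zero.2 hr.ne') hω0.2⟩
    have := (hN s hs y hy).1 _ hr'
    rw [Complex.re_ofReal_mul] at this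
    rwa [show μ * ω.re * r = μ * (r * ω.re) by ring]
  · refine le_trans (le_mul_of_one_le_left zero_le ?_)
      ((hN s hs y hy).1 r (ofReal_mem_sector_diff hu.tan_pos hr))
    rw [ENNReal.one_le_ofReal]
    refine Real.one_le_exp (mul_nonneg hμ ?_)
    rw [Complex.ofReal_re]
    exact hr.le

lemma lineNorm_le_M (hm : IsSliceMajorant ρ θ μ t u a b N M) (hμ : 0 ≤ μ) {s : ℝ}
    (hs : s ∈ Ioo 0 t) {y : ℝ} (hy : y ∈ Ioo (-ρ) ρ) {Y : ℂ} (hY : Y ∈ sector θ) :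
    lineNorm y (fun x => duhamelSlice a b (t - s) (u s) x Y) ≤ M s := by
  refine le_trans (le_mul_of_one_le_left zero_le ?_) (hm.le_M s hs y hy Y hY)
  rw [ENNReal.one_le_ofReal]
  exact Real.one_le_exp (mul_nonneg hμ hY.1)

lemma differentiableOn_slice (hu : IsProfileFamily l ρ θ t u) (ha : a ≤ 2) (hab : a + b ≤ l)
    {s : ℝ} (hs : s ∈ Ioo 0 t) (Y : ℂ) :
    DifferentiableOn ℂ (fun x => duhamelSlice a b (t - s) (u s) x Y) (strip ρ) := by
  obtain ⟨Θ, h1, h2, hw⟩ := hu.profile s hs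
  exact hw.differentiableOn_duhamelSlice (hu.tan_pos.trans h1) h2 (by linarith [hs.2]) ha hab Y

/-- Pointwise domination of the slices, locally uniform in `x` and uniform in `Y`. -/
lemma exists_slice_bound (hu : IsProfileFamily l ρ θ t u)
    (hm : IsSliceMajorant ρ θ μ t u a b N M) (hμ : 0 ≤ μ) (ha : a ≤ 2) (hab : a + b ≤ l) {x₀ : ℂ}
    (hx₀ : x₀ ∈ strip ρ) : ∃ r > 0, Metric.ball x₀ r ⊆ strip ρ ∧ ∃ B : ℝ → ℝ,
      Integrable B (volume.restrict (Ioo 0 t)) ∧ ∀ᵐ s ∂volume.restrict (Ioo 0 t),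
        ∀ x ∈ Metric.ball x₀ r, ∀ Y ∈ sector θ,
          ‖duhamelSlice a b (t - s) (u s) x Y‖ ≤ B s := by
  obtain ⟨r, hr, hsub⟩ := exists_ball_subset_strip hx₀
  obtain ⟨C, hC, hCb⟩ := exists_enorm_le_mul_hNorm hr
  refine ⟨r, hr, hsub x₀ (Metric.mem_ball_self hr), fun s => C * (M s).toReal,
    (integrable_toReal_of_lintegral_ne_top hm.measurable_M.aemeasurable
      hm.lintegral_ne_top).const_mul C, ?_⟩
  filter_upwards [ae_lt_top hm.measurable_M hm.lintegral_ne_top,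
    ae_restrict_mem measurableSet_Ioo] with s hMs hs x hx Y hY
  have h1 := hCb ρ _ x (hsub x hx) (hu.differentiableOn_slice ha hab hs Y)
  have h2 : hNorm 0 ρ (fun x => duhamelSlice a b (t - s) (u s) x Y) ≤ M s := by
    rw [hNorm_zero]
    exact iSup₂_le fun y hy => lineNorm_le_M hm hμ hs hy hY
  have h3 : ‖duhamelSlice a b (t - s) (u s) x Y‖ₑ ≤ ENNReal.ofReal (C * (M s).toReal) := by
    rw [ENNReal.ofReal_mul hC, ENNReal.ofReal_toReal hMs.ne]
    exact h1.trans (by gcongr)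
  rwa [← ofReal_norm, ENNReal.ofReal_le_ofReal_iff (by positivity)] at h3

lemma aestronglyMeasurable_slice (hu : IsProfileFamily l ρ θ t u) (hab : a + b ≤ l) {x : ℂ}
    (hx : x ∈ strip ρ) (Y : ℂ) :
    AEStronglyMeasurable (fun s => duhamelSlice a b (t - s) (u s) x Y)
      (volume.restrict (Ioo 0 t)) := by
  obtain ⟨g, hg, hge⟩ := hu.exists_measurable_duhamelSlice (a := a) (b := b) (by omega) Y
  have h1 : StronglyMeasurable (fun s : ℝ => g (s, x)) :=
    hg.comp_measurable (g := fun s : ℝ => (s, x)) (by fun_prop)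
  refine h1.aestronglyMeasurable.congr ?_
  filter_upwards [ae_restrict_mem measurableSet_Ioo] with s hs using hge s hs x hx

/-- The time integral may be differentiated in `x`. -/
lemma dominatedHolomorphic_time (hu : IsProfileFamily l ρ θ t u)
    (hm : IsSliceMajorant ρ θ μ t u a b N M) (hμ : 0 ≤ μ) (ha : a ≤ 2) (hab : a + b ≤ l) {Y : ℂ}
    (hY : Y ∈ sector θ) : DominatedHolomorphic (volume.restrict (Ioo 0 t)) (strip ρ)
      (fun x s => duhamelSlice a b (t - s) (u s) x Y) := by
  refine ⟨fun x hx => hu.aestronglyMeasurable_slice hab hx Y, ?_, fun x₀ hx₀ => ?_⟩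
  · filter_upwards [ae_restrict_mem measurableSet_Ioo] with s hs
    exact hu.differentiableOn_slice ha hab hs Y
  · obtain ⟨r, hr, hsub, B, hB, hle⟩ := hu.exists_slice_bound hm hμ ha hab hx₀
    refine ⟨r, hr, hsub, B, hB, ?_⟩
    filter_upwards [hle] with s hs x hx using hs x hx Y hY

lemma iteratedDeriv_duhamelIntegral (hu : IsProfileFamily l ρ θ t u)
    (hm : IsSliceMajorant ρ θ μ t u 0 0 N M) (hμ : 0 ≤ μ) (b : ℕ) {x Y : ℂ} (hx : x ∈ strip ρ)
    (hY : Y ∈ sector θ) :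
    iteratedDeriv b (fun x => duhamelIntegral 0 0 t u x Y) x = duhamelIntegral 0 b t u x Y := by
  have hd := hu.dominatedHolomorphic_time hm hμ (by norm_num) (by omega) hY
  unfold duhamelIntegral
  rw [hd.iteratedDeriv_integral b hx]
  refine setIntegral_congr_fun measurableSet_Ioo fun s hs => ?_
  obtain ⟨Θ, h1, h2, hw⟩ := hu.profile s hs
  exact hw.iteratedDeriv_duhamelSlice (hu.tan_pos.trans h1) h2 (by linarith [hs.2]) b hx Y

/-- Differentiation of the time integral in `Y` within the closed sector. The difference quotients
are dominated, by the mean value inequality on the convex sector, by the majorant for one more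
`Y`-derivative; no bound outside the closed sector is available. -/
lemma hasDerivWithinAt_duhamelIntegral (hu : IsProfileFamily l ρ θ t u) {N' M' : ℝ → ℝ≥0∞}
    (hm : IsSliceMajorant ρ θ μ t u a b N M) (hm' : IsSliceMajorant ρ θ μ t u (a + 1) b N' M')
    (hμ : 0 ≤ μ) (ha : a + 1 ≤ 2) (hab : a + 1 + b ≤ l) {x Y : ℂ} (hx : x ∈ strip ρ)
    (hY : Y ∈ sector θ) :
    HasDerivWithinAt (duhamelIntegral a b t u x) (duhamelIntegral (a + 1) b t u x Y)
      (sector θ) Y := by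
  obtain ⟨r, hr, -, B, hB, hle⟩ := hu.exists_slice_bound hm' hμ ha hab hx
  have hint : ∀ Y ∈ sector θ, Integrable (fun s => duhamelSlice a b (t - s) (u s) x Y)
      (volume.restrict (Ioo 0 t)) := fun Y hY =>
    (hu.dominatedHolomorphic_time hm hμ (by omega) (by omega) hY).integrable hx
  have hder : ∀ s ∈ Ioo 0 t, ∀ Y, HasDerivAt (duhamelSlice a b (t - s) (u s) x)
      (duhamelSlice (a + 1) b (t - s) (u s) x Y) Y := fun s hs Y => by
    obtain ⟨Θ, h1, h2, hw⟩ := hu.profile s hs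
    exact hw.hasDerivAt_duhamelSlice (hu.tan_pos.trans h1) (by linarith [hs.2]) ha hab hx Y
  rw [hasDerivWithinAt_iff_tendsto_slope]
  have key : Tendsto (fun Y' => ∫ s in Ioo 0 t, slope (duhamelSlice a b (t - s) (u s) x) Y Y')
      (𝓝[sector θ \ {Y}] Y) (𝓝 (duhamelIntegral (a + 1) b t u x Y)) := by
    refine tendsto_integral_filter_of_dominated_convergence B ?_ ?_ hB ?_
    · filter_upwards [self_mem_nhdsWithin] with Y' hY'
      simp only [slope_def_module]
      exact AEStronglyMeasurable.const_smul ((hu.aestronglyMeasurable_slice (by omega) hx Y').sub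
        (hu.aestronglyMeasurable_slice (by omega) hx Y)) ((Y' - Y)⁻¹)
    · filter_upwards [self_mem_nhdsWithin] with Y' hY'
      filter_upwards [hle, ae_restrict_mem measurableSet_Ioo] with s hs hst
      have h1 := (convex_sector θ).norm_image_sub_le_of_norm_hasDerivWithin_le
        (fun Z _ => (hder s hst Z).hasDerivWithinAt)
        (fun Z hZ => hs x (Metric.mem_ball_self hr) Z hZ) hY hY'.1
      have h2 : 0 < ‖Y' - Y‖ := norm_pos_iff.2 (sub_ne_zero.2 hY'.2)
      rw [slope_def_module, norm_smul, norm_inv, inv_mul_le_iff₀ h2, mul_comm]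
      exact h1
    · filter_upwards [ae_restrict_mem measurableSet_Ioo] with s hst
      exact hasDerivWithinAt_iff_tendsto_slope.1 (hder s hst Y).hasDerivWithinAt
  refine key.congr' ?_
  filter_upwards [self_mem_nhdsWithin] with Y' hY'
  simp only [slope_def_module, duhamelIntegral]
  rw [integral_smul, integral_sub (hint Y' hY'.1) (hint Y hY)]

/-- `L²` estimate for the time integral. -/
lemma mul_hNorm_duhamelIntegral_le (hu : IsProfileFamily l ρ θ t u)
    (hm : IsSliceMajorant ρ θ μ t u a b N M) (hab : a + b ≤ l) {Y : ℂ} (hY : Y ∈ sector θ) :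
    ENNReal.ofReal (Real.exp (μ * Y.re)) * hNorm 0 ρ (fun x => duhamelIntegral a b t u x Y) ≤
      ∫⁻ s in Ioo 0 t, M s := by
  obtain ⟨g, hg, hge⟩ := hu.exists_measurable_duhamelSlice (a := a) (b := b) (by omega) Y
  rw [hNorm_zero, ENNReal.mul_iSup]
  refine iSup_le fun y => ?_
  rw [ENNReal.mul_iSup]
  refine iSup_le fun hy => ?_
  refine (mul_le_mul_right (lineNorm_setIntegral_le hy hg hge) _).trans ?_
  rw [← lintegral_const_mul' _ _ ENNReal.ofReal_ne_top]
  exact setLIntegral_mono' measurableSet_Ioo fun s hs => hm.le_M s hs y hy Y hY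

/-- Continuity of the time integral in `Y`, up to the boundary of the sector, with values in
`H^{0,ρ}`. -/
lemma tendsto_hNorm_duhamelIntegral_sub (hu : IsProfileFamily l ρ θ t u)
    (hm : IsSliceMajorant ρ θ μ t u a b N M) (hμ : 0 ≤ μ) (ha : a ≤ 2) (hab : a + b ≤ l) {Y₀ : ℂ}
    (hY₀ : Y₀ ∈ sector θ) :
    Tendsto (fun Y => hNorm 0 ρ (fun x => duhamelIntegral a b t u x Y -
      duhamelIntegral a b t u x Y₀)) (𝓝[sector θ] Y₀) (𝓝 0) := by
  set κ : ℂ → ℝ → ℝ≥0∞ := fun Y s =>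
    (∫⁻ r in Ioi (0 : ℝ), ‖reflKernel a (t - s) Y r - reflKernel a (t - s) Y₀ r‖ₑ) +
      2 * ‖heatKernel Y (t - s) - heatKernel Y₀ (t - s)‖ₑ with hκ
  have hκm : ∀ Y, Measurable (κ Y) := fun Y => by
    refine Measurable.add ?_ ?_
    · have : Measurable (fun p : ℝ × ℝ =>
          ‖reflKernel a (t - p.1) Y p.2 - reflKernel a (t - p.1) Y₀ p.2‖ₑ) := by
        unfold reflKernel heatKernelDeriv heatKernel
        fun_prop
      exact this.lintegral_prod_right'
    · unfold heatKernel
      fun_prop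
  -- `κ Y s * N s` tends to zero for each `s` but is not dominated near `s = t`; `2 * M s` is the
  -- trivial bound and supplies the domination
  have hlim : Tendsto (fun Y => ∫⁻ s in Ioo 0 t, min (κ Y s * N s) (2 * M s))
      (𝓝[sector θ] Y₀) (𝓝 0) := by
    have := tendsto_lintegral_filter_of_dominated_convergence
      (μ := volume.restrict (Ioo 0 t)) (l := 𝓝[sector θ] Y₀)
      (F := fun Y s => min (κ Y s * N s) (2 * M s)) (f := fun _ => 0)
      (fun s => 2 * M s)
      (Eventually.of_forall fun Y => ((hκm Y).mul hm.measurable_N).min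
        (hm.measurable_M.const_mul _))
      (Eventually.of_forall fun Y => Eventually.of_forall fun s => min_le_right _ _) ?_ ?_
    · simpa using this
    · rw [lintegral_const_mul _ hm.measurable_M]
      exact ENNReal.mul_ne_top (by norm_num) hm.lintegral_ne_top
    · filter_upwards [hm.N_lt_top, ae_restrict_mem measurableSet_Ioo] with s hN hs
      have h1 := (tendsto_lintegral_reflKernel_sub (t := t - s) (by linarith [hs.2]) a Y₀).mono_left
        (nhdsWithin_le_nhds (s := sector θ))
      have h2 := ENNReal.Tendsto.mul_const (b := N s) h1 (Or.inr hN.ne)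
      rw [zero_mul] at h2
      exact tendsto_of_tendsto_of_tendsto_of_le_of_le tendsto_const_nhds h2
        (fun _ => zero_le) (fun Y => min_le_left _ _)
  refine tendsto_of_tendsto_of_tendsto_of_le_of_le' tendsto_const_nhds hlim
    (Eventually.of_forall fun _ => zero_le) ?_
  filter_upwards [self_mem_nhdsWithin] with Y hY
  obtain ⟨g, hg, hge⟩ := hu.exists_measurable_duhamelSlice (a := a) (b := b) (by omega) Y
  obtain ⟨g₀, hg₀, hge₀⟩ := hu.exists_measurable_duhamelSlice (a := a) (b := b) (by omega) Y₀
  have hsub : EqOn (fun x => duhamelIntegral a b t u x Y - duhamelIntegral a b t u x Y₀)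
      (fun x => ∫ s in Ioo 0 t, (duhamelSlice a b (t - s) (u s) x Y -
        duhamelSlice a b (t - s) (u s) x Y₀)) (strip ρ) := fun x hx =>
    (integral_sub ((hu.dominatedHolomorphic_time hm hμ ha hab hY).integrable hx)
      ((hu.dominatedHolomorphic_time hm hμ ha hab hY₀).integrable hx)).symm
  rw [hNorm_congr hsub, hNorm_zero]
  refine iSup₂_le fun y hy => ?_
  refine (lineNorm_setIntegral_le hy (hg.sub hg₀) (fun s hs x hx => by
    rw [Pi.sub_apply, hge s hs x hx, hge₀ s hs x hx])).trans ?_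
  refine setLIntegral_mono' measurableSet_Ioo fun s hs => le_min ?_ ?_
  · obtain ⟨Θ, h1, h2, hw⟩ := hu.profile s hs
    exact hw.lineNorm_duhamelSlice_sub_le (hu.tan_pos.trans h1) h2 (by linarith [hs.2]) ha hab hy
      (hm.le_N s hs y hy).1 (hm.le_N s hs y hy).2 Y Y₀
  · have hd := fun Y => (hu.differentiableOn_slice ha hab hs Y).continuousOn
    refine (lineNorm_sub_le hy (hd Y) (hd Y₀)).trans ?_
    rw [two_mul]
    exact add_le_add (lineNorm_le_M hm hμ hs hy hY) (lineNorm_le_M hm hμ hs hy hY₀)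

/-- Joint analyticity of the time integral in the interior. -/
lemma analyticOnNhd_duhamelIntegral (hu : IsProfileFamily l ρ θ t u) (hl : 1 ≤ l) {N' M' : ℝ → ℝ≥0∞}
    (hm : IsSliceMajorant ρ θ μ t u 0 0 N M) (hm' : IsSliceMajorant ρ θ μ t u 1 0 N' M')
    (hμ : 0 ≤ μ) :
    AnalyticOnNhd ℂ (fun p : ℂ × ℂ => duhamelIntegral 0 0 t u p.1 p.2)
      (strip ρ ×ˢ interior (sector θ)) := by
  rintro ⟨x₀, Y₀⟩ ⟨hx₀, hY₀⟩
  obtain ⟨r, hr, hsub, B, hB, hle⟩ := hu.exists_slice_bound hm hμ (by norm_num) (by omega) hx₀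
  obtain ⟨e, he, hesub⟩ := Metric.isOpen_iff.1 isOpen_interior Y₀ hY₀
  have hr' : Metric.ball x₀ (min r e) ⊆ Metric.ball x₀ r := Metric.ball_subset_ball (min_le_left _ _)
  have he' : Metric.ball Y₀ (min r e) ⊆ interior (sector θ) :=
    (Metric.ball_subset_ball (min_le_right _ _)).trans hesub
  refine analyticAt_of_separately (R := min r e) (B := ∫ s in Ioo 0 t, B s) (lt_min hr he)
    (fun Y hY => ?_) (fun x hx Y hY => ?_) fun x hx Y hY => ?_
  · exact (hu.dominatedHolomorphic_time hm hμ (by norm_num) (by omega)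
      (interior_subset (he' hY))).differentiableOn.mono (hr'.trans hsub)
  · have h := hu.hasDerivWithinAt_duhamelIntegral hm hm' hμ (by norm_num) (by omega)
      (hsub (hr' hx)) (interior_subset (he' hY))
    exact (h.hasDerivAt (mem_interior_iff_mem_nhds.1 (he' hY))).differentiableAt
      |>.differentiableWithinAt
  · refine norm_integral_le_of_norm_le hB ?_
    filter_upwards [hle] with s hs using hs x (hr' hx) Y (interior_subset (he' hY))

/-- The mixed derivatives of the time integral in the closed sector. -/
lemma mixedDeriv_duhamelIntegral (hu : IsProfileFamily l ρ θ t u) (hμ : 0 ≤ μ)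
    (hm : ∀ a b : ℕ, a ≤ 2 → a + b ≤ l → ∃ N M, IsSliceMajorant ρ θ μ t u a b N M)
    (ha : a ≤ 2) (hab : a + b ≤ l) {x Y : ℂ} (hx : x ∈ strip ρ) (hY : Y ∈ sector θ) :
    mixedDeriv θ a b (duhamelIntegral 0 0 t u) x Y = duhamelIntegral a b t u x Y := by
  obtain ⟨N, M, h00⟩ := hm 0 0 (by norm_num) (by omega)
  have h0 : EqOn (fun Y' => iteratedDeriv b (fun x' => duhamelIntegral 0 0 t u x' Y') x)
      (duhamelIntegral 0 b t u x) (sector θ) := fun Y' hY' =>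
    hu.iteratedDeriv_duhamelIntegral h00 hμ b hx hY'
  unfold mixedDeriv
  rw [iteratedDerivWithin_congr h0 hY]
  induction a generalizing Y with
  | zero => simp
  | succ a ih =>
    obtain ⟨N₁, M₁, h1⟩ := hm a b (by omega) (by omega)
    obtain ⟨N₂, M₂, h2⟩ := hm (a + 1) b ha hab
    rw [iteratedDerivWithin_succ, derivWithin_congr (fun Z hZ => ih (by omega) (by omega) hZ)
      (ih (by omega) (by omega) hY)]
    exact (hu.hasDerivWithinAt_duhamelIntegral h1 h2 hμ ha hab hx hY).derivWithin
      (uniqueDiffOn_sector hu.tan_pos Y hY)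

end IsProfileFamily

/-! ### The Duhamel operator -/

lemma dY_eq_fullDeriv (u : ℝ → ℂ → ℂ → ℂ) (s : ℝ) (x Y : ℂ) :
    dY u s x Y = fullDeriv 1 0 (u s) x Y := by
  rw [fullDeriv_succ, fullDeriv_zero_zero]
  rfl

lemma IsProfile.integrableOn_E3Integrand {l : ℕ} {P θ s t : ℝ} {u : ℝ → ℂ → ℂ → ℂ} {x : ℂ}
    (hw : IsProfile l P θ (u s)) (hθ : 0 < Real.tan θ) (hst : s < t) (hl : 1 ≤ l)
    (hx : x ∈ strip P) (Y : ℂ) : IntegrableOn (E3Integrand (dY u) t x Y s) (Ioi 0) := by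
  have h := hw.integrableOn_heatKernel hθ (sub_pos.2 hst) (b := 0) (by omega) hx Y
  refine h.congr_fun (fun r _ => ?_) measurableSet_Ioi
  simp only [E3Integrand, dY_eq_fullDeriv]

lemma IsProfile.integral_E3Integrand {l : ℕ} {P θ s t : ℝ} {u : ℝ → ℂ → ℂ → ℂ} {x : ℂ}
    (hw : IsProfile l P θ (u s)) (hθ : 0 < Real.tan θ) (hst : s < t) (hl : 1 ≤ l)
    (hx : x ∈ strip P) (Y : ℂ) :
    ∫ r in Ioi (0 : ℝ), E3Integrand (dY u) t x Y s r = duhamelSlice 0 0 (t - s) (u s) x Y := by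
  rw [hw.duhamelSlice_zero_eq hθ (sub_pos.2 hst) (b := 0) (by omega) hx Y]
  simp only [E3Integrand, dY_eq_fullDeriv, one_mul]

/-- `mixedDeriv` depends only on the values for `x` in the strip; equality is needed for every `Y`
because the `Y`-derivative is taken of the `x`-derivative. -/
lemma mixedDeriv_congr_strip {ρ θ : ℝ} {f g : ℂ → ℂ → ℂ} (h : ∀ x ∈ strip ρ, ∀ Y, f x Y = g x Y)
    (a b : ℕ) {x : ℂ} (hx : x ∈ strip ρ) (Y : ℂ) :
    mixedDeriv θ a b f x Y = mixedDeriv θ a b g x Y := by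
  have : (fun Y' => iteratedDeriv b (fun x' => f x' Y') x) =
      fun Y' => iteratedDeriv b (fun x' => g x' Y') x := by
    funext Y'
    refine Filter.EventuallyEq.iteratedDeriv_eq b ?_
    filter_upwards [(isOpen_strip ρ).mem_nhds hx] with x' hx' using h x' hx' Y'
  rw [mixedDeriv, mixedDeriv, this]

namespace IsProfileFamily

variable {l : ℕ} {ρ θ t μ : ℝ} {u : ℝ → ℂ → ℂ → ℂ}

lemma E3_eq_duhamelIntegral (hu : IsProfileFamily l ρ θ t u) (ht : 0 ≤ t) (hl : 1 ≤ l) {x : ℂ}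
    (hx : x ∈ strip ρ) (Y : ℂ) : E3 t (dY u) x Y = duhamelIntegral 0 0 t u x Y := by
  rw [E3, duhamelIntegral, intervalIntegral.integral_of_le ht, integral_Ioc_eq_integral_Ioo]
  refine setIntegral_congr_fun measurableSet_Ioo fun s hs => ?_
  obtain ⟨Θ, h1, -, hw⟩ := hu.profile s hs
  exact hw.integral_E3Integrand (hu.tan_pos.trans h1) hs.2 hl hx Y

lemma intervalIntegrable_E3Integrand (hu : IsProfileFamily l ρ θ t u) (ht : 0 ≤ t) (hl : 1 ≤ l)
    {N M : ℝ → ℝ≥0∞} (hm : IsSliceMajorant ρ θ μ t u 0 0 N M) (hμ : 0 ≤ μ) {x Y : ℂ}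
    (hx : x ∈ strip ρ) (hY : Y ∈ sector θ) :
    IntervalIntegrable (fun s => ∫ r in Ioi (0 : ℝ), E3Integrand (dY u) t x Y s r) volume 0 t := by
  rw [intervalIntegrable_iff_integrableOn_Ioo_of_le ht]
  refine ((hu.dominatedHolomorphic_time hm hμ (by norm_num) (by omega) hY).integrable
    hx).congr ?_
  filter_upwards [ae_restrict_mem measurableSet_Ioo] with s hs
  obtain ⟨Θ, h1, -, hw⟩ := hu.profile s hs
  exact (hw.integral_E3Integrand (hu.tan_pos.trans h1) hs.2 hl hx Y).symm

/-- Membership of `E₃(t) ∂_Y u` in the space, from finiteness of its norm and the existence of slice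
majorants for all admissible derivatives. -/
lemma memK_E3 (hu : IsProfileFamily l ρ θ t u) (ht : 0 ≤ t) (hl : 1 ≤ l) (hμ : 0 ≤ μ)
    (hm : ∀ a b : ℕ, a ≤ 2 → a + b ≤ l → ∃ N M, IsSliceMajorant ρ θ μ t u a b N M)
    (hfin : kNorm l ρ θ μ (E3 t (dY u)) < ∞) : MemK l ρ θ μ (E3 t (dY u)) := by
  have hE : ∀ x ∈ strip ρ, ∀ Y, E3 t (dY u) x Y = duhamelIntegral 0 0 t u x Y := fun x hx Y =>
    hu.E3_eq_duhamelIntegral ht hl hx Y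
  have hmix : ∀ a b : ℕ, a ≤ 2 → a + b ≤ l → ∀ Y ∈ sector θ,
      EqOn (fun x => mixedDeriv θ a b (E3 t (dY u)) x Y) (fun x => duhamelIntegral a b t u x Y)
        (strip ρ) := fun a b ha hab Y hY x hx => by
    simp only
    rw [mixedDeriv_congr_strip hE a b hx Y, hu.mixedDeriv_duhamelIntegral hμ hm ha hab hx hY]
  obtain ⟨N₀, M₀, h0⟩ := hm 0 0 (by norm_num) (by omega)
  obtain ⟨N₁, M₁, h1⟩ := hm 1 0 (by norm_num) (by omega)
  refine ⟨?_, fun a b ha hab Y hY => ?_, fun a b ha hab Y₀ hY₀ => ?_, hfin⟩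
  · refine (hu.analyticOnNhd_duhamelIntegral hl h0 h1 hμ).congr
      ((isOpen_strip ρ).prod isOpen_interior) fun p hp => (hE p.1 hp.1 p.2).symm
  · obtain ⟨N, M, h⟩ := hm a b ha hab
    have hd := (hu.dominatedHolomorphic_time h hμ ha hab hY).differentiableOn
    have hnorm : hNorm 0 ρ (fun x => mixedDeriv θ a b (E3 t (dY u)) x Y) < ∞ := by
      rw [hNorm_congr (hmix a b ha hab Y hY)]
      have hexp : 1 ≤ ENNReal.ofReal (Real.exp (μ * Y.re)) := by
        rw [ENNReal.one_le_ofReal]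
        exact Real.one_le_exp (mul_nonneg hμ hY.1)
      have hle := hu.mul_hNorm_duhamelIntegral_le h hab hY
      have h1le : hNorm 0 ρ (fun x => duhamelIntegral a b t u x Y) ≤
          ENNReal.ofReal (Real.exp (μ * Y.re)) *
            hNorm 0 ρ (fun x => duhamelIntegral a b t u x Y) := by
        generalize hNorm 0 ρ (fun x => duhamelIntegral a b t u x Y) = B
        exact le_mul_of_one_le_left zero_le hexp
      exact (h1le.trans hle).trans_lt h.lintegral_ne_top.lt_top
    have han : AnalyticOnNhd ℂ (fun x => mixedDeriv θ a b (E3 t (dY u)) x Y) (strip ρ) :=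
      (hd.analyticOnNhd (isOpen_strip ρ)).congr (isOpen_strip ρ) (hmix a b ha hab Y hY).symm
    refine ⟨han, fun α hα y hy => ?_, hnorm⟩
    obtain rfl : α = 0 := by omega
    generalize (fun x => mixedDeriv θ a b (E3 t (dY u)) x Y) = f at han hnorm
    rw [iteratedDeriv_zero]
    exact ⟨(continuous_line hy han.continuousOn).aestronglyMeasurable,
      (lineNorm_le_hNorm f hy).trans_lt hnorm⟩
  · obtain ⟨N, M, h⟩ := hm a b ha hab
    refine (hu.tendsto_hNorm_duhamelIntegral_sub h hμ ha hab hY₀).congr' ?_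
    filter_upwards [self_mem_nhdsWithin] with Y hY
    refine hNorm_congr fun x hx => ?_
    have e1 := hmix a b ha hab Y hY hx
    have e2 := hmix a b ha hab Y₀ hY₀ hx
    simp only at e1 e2 ⊢
    rw [e1, e2]

/-- The `K`-norm of `E₃(t) ∂_Y u` from a common bound of the integrated majorants; the norm has at
most `3 (l + 1)` terms. -/
lemma kNorm_E3_le (hu : IsProfileFamily l ρ θ t u) (ht : 0 ≤ t) (hl : 1 ≤ l) (hμ : 0 ≤ μ)
    {A : ℝ≥0∞} (hm : ∀ a b : ℕ, a ≤ 2 → a + b ≤ l → ∃ N M, IsSliceMajorant ρ θ μ t u a b N M ∧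
      ∫⁻ s in Ioo 0 t, M s ≤ A) :
    kNorm l ρ θ μ (E3 t (dY u)) ≤ 3 * ((l + 1) * A) := by
  have hterm : ∀ a ∈ Finset.range (min 2 l + 1), ∀ b ∈ Finset.range (l - a + 1),
      ⨆ Y ∈ sector θ, ENNReal.ofReal (Real.exp (μ * Y.re)) *
        hNorm 0 ρ (fun x => mixedDeriv θ a b (E3 t (dY u)) x Y) ≤ A := by
    intro a ha b hb
    rw [Finset.mem_range] at ha hb
    have ha2 : a ≤ 2 := by omega
    have hab : a + b ≤ l := by omega
    refine iSup₂_le fun Y hY => ?_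
    obtain ⟨N, M, h, hA⟩ := hm a b ha2 hab
    have hmix : EqOn (fun x => mixedDeriv θ a b (E3 t (dY u)) x Y)
        (fun x => duhamelIntegral a b t u x Y) (strip ρ) := fun x hx => by
      simp only
      rw [mixedDeriv_congr_strip (fun x hx Y => hu.E3_eq_duhamelIntegral ht hl hx Y) a b hx Y,
        hu.mixedDeriv_duhamelIntegral hμ (fun a b ha hab => by
          obtain ⟨N, M, h, -⟩ := hm a b ha hab
          exact ⟨N, M, h⟩) ha2 hab hx hY]
    rw [hNorm_congr hmix]
    exact (hu.mul_hNorm_duhamelIntegral_le h hab hY).trans hA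
  unfold kNorm
  calc _ ≤ ∑ a ∈ Finset.range (min 2 l + 1), ((l + 1 : ℕ) : ℝ≥0∞) * A := by
        refine Finset.sum_le_sum fun a ha => ?_
        refine (Finset.sum_le_card_nsmul _ _ A (hterm a ha)).trans ?_
        rw [Finset.card_range, nsmul_eq_mul]
        refine mul_le_mul_left (Nat.cast_le.2 ?_) _
        omega
    _ ≤ ((3 : ℕ) : ℝ≥0∞) * (((l + 1 : ℕ) : ℝ≥0∞) * A) := by
        rw [Finset.sum_const, Finset.card_range, nsmul_eq_mul]
        refine mul_le_mul_left (Nat.cast_le.2 ?_) _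
        omega
    _ = 3 * ((l + 1) * A) := by push_cast; rfl

end IsProfileFamily

end PrandtlRobin

open PrandtlRobin

theorem lemma3p5 (l : ℕ) (hl : 1 ≤ l) (ρ θ μ β T : ℝ) (hT : 0 < T) (hβ : 0 ≤ β)
    (hρ : β * T < ρ) (hθ : β * T < θ) (hμ : β * T < μ) (hθ4 : θ < Real.pi / 4) :
    ∃ C : ℝ, 0 < C ∧ ∀ u : ℝ → ℂ → ℂ → ℂ,
      Measurable ((PrandtlRobin.shrinkingDomain ρ θ β T).domRestrict
        (fun p : ℝ × ℂ × ℂ => u p.1 p.2.1 p.2.2)) →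
      (∀ s ∈ Set.Icc 0 T, PrandtlRobin.MemK l (ρ - β * s) (θ - β * s) (μ - β * s) (u s)) →
      ∀ t ∈ Set.Icc 0 T, ∀ ρ' θ' μ' : ℝ,
        0 < ρ' → ρ' < ρ - β * t → 0 < θ' → θ' < θ - β * t → 0 < μ' → μ' < μ - β * t →
        -- the inner integrals defining `E₃(t) ∂_Y u` converge absolutely
        (∀ x ∈ PrandtlRobin.strip ρ', ∀ Y ∈ PrandtlRobin.sector θ', ∀ s ∈ Set.Ico 0 t,
          MeasureTheory.IntegrableOn
            (PrandtlRobin.E3Integrand (PrandtlRobin.dY u) t x Y s) (Set.Ioi 0)) ∧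
        -- if the right-hand side is finite, `E₃(t) ∂_Y u` is well defined and in the space
        (PrandtlRobin.singularIntegral l ρ' θ' μ' t u < ⊤ →
          (∀ x ∈ PrandtlRobin.strip ρ', ∀ Y ∈ PrandtlRobin.sector θ',
            IntervalIntegrable (fun s => ∫ Y' in Set.Ioi (0 : ℝ),
              PrandtlRobin.E3Integrand (PrandtlRobin.dY u) t x Y s Y')
              MeasureTheory.volume 0 t) ∧
          PrandtlRobin.MemK l ρ' θ' μ' (PrandtlRobin.E3 t (PrandtlRobin.dY u))) ∧
        -- the estimate
        PrandtlRobin.kNorm l ρ' θ' μ' (PrandtlRobin.E3 t (PrandtlRobin.dY u)) ≤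
          ENNReal.ofReal C * PrandtlRobin.singularIntegral l ρ' θ' μ' t u := by
  have hβT : 0 ≤ β * T := by positivity
  have hθ0 : 0 < θ := hβT.trans_lt hθ
  have hpi : Real.pi / 4 < Real.pi / 2 := by linarith [Real.pi_pos]
  have htan : ∀ {θ₁ θ₂ : ℝ}, 0 < θ₁ → θ₁ < θ₂ → θ₂ ≤ Real.pi / 4 → Real.tan θ₁ < Real.tan θ₂ :=
    fun h1 h2 h3 => Real.tan_lt_tan_of_lt_of_lt_pi_div_two (by linarith) (by linarith) h2
  have hθt : 0 < Real.tan θ := Real.tan_pos_of_pos_of_lt_pi_div_two hθ0 (by linarith)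
  have hθt1 : Real.tan θ < 1 := Real.tan_pi_div_four ▸ htan hθ0 hθ4 le_rfl
  have hc : 0 < (1 - Real.tan θ ^ 2) / 2 := by nlinarith
  -- `C` bounds the kernels along all directions of the largest sector `Σ(θ)`, hence of all `Σ(θ')`
  obtain ⟨C, hC0, hC⟩ := exists_lintegral_reflKernel_le (μ := μ) hc hT
  refine ⟨3 * ((l + 1) * (3 * C)), by positivity, fun u hmeas hu t ht ρ' θ' μ' hρ'0 hρ' hθ'0 hθ'
    hμ'0 hμ' => ?_⟩
  have hβs : ∀ s, 0 ≤ s → s ≤ t → 0 ≤ β * s ∧ β * s ≤ β * t ∧ β * t ≤ β * T := fun s h0 hs =>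
    ⟨by positivity, by gcongr, by gcongr; exact ht.2⟩
  have hprof : ∀ s ∈ Ico 0 t, Real.tan θ' < Real.tan (θ - β * s) ∧
      Real.tan (θ - β * s) < 1 ∧ IsProfile l ρ' (θ - β * s) (u s) := by
    intro s hs
    obtain ⟨b1, b2, b3⟩ := hβs s hs.1 hs.2.le
    refine ⟨htan hθ'0 (by linarith) (by linarith),
      Real.tan_pi_div_four ▸ htan (by linarith) (by linarith) le_rfl, ?_⟩
    exact ((hu s ⟨hs.1, hs.2.le.trans ht.2⟩).isProfile (by linarith)).mono_strip (by linarith)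
  have hθ't : 0 < Real.tan θ' := by
    obtain ⟨b1, b2, b3⟩ := hβs t ht.1 le_rfl
    exact Real.tan_pos_of_pos_of_lt_pi_div_two hθ'0 (by linarith)
  -- `u(s)` is analytic on a sector larger than `Σ(θ')`, so only `Y = 0` is a true boundary point
  have hfam : IsProfileFamily l ρ' θ' t u := by
    refine ⟨hθ't, fun s hs => ⟨_, hprof s ⟨hs.1.le, hs.2⟩⟩, ?_⟩
    have hsub : timeDomain ρ' θ' t ⊆ shrinkingDomain ρ θ β T := by
      intro p hp
      have hs : p.1 ∈ Ioo 0 t := hp.1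
      obtain ⟨b1, b2, b3⟩ := hβs p.1 hs.1.le hs.2.le
      obtain ⟨h1, -, -⟩ := hprof p.1 ⟨hs.1.le, hs.2⟩
      refine ⟨⟨hs.1.le, hs.2.le.trans ht.2⟩, ⟨?_, ?_⟩, ?_⟩
      · have := hp.2.1.1
        linarith
      · have := hp.2.1.2
        linarith
      · exact openSector_subset_sector _ (sector_diff_zero_subset h1 hp.2.2)
    exact hmeas.comp (measurable_inclusion hsub)
  refine ⟨fun x hx Y _ s hs => (hprof s hs).2.2.integrableOn_E3Integrand
    (hθ't.trans (hprof s hs).1) hs.2 hl hx Y, ?_⟩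
  rcases eq_or_ne (singularIntegral l ρ' θ' μ' t u) ⊤ with hinf | hfin
  · refine ⟨fun h => absurd hinf h.ne, ?_⟩
    rw [hinf, ENNReal.mul_top (by simpa using (by positivity : 0 < 3 * (((l : ℝ) + 1) * (3 * C))))]
    exact le_top
  have htanle : (1 - Real.tan θ ^ 2) / 2 ≤ (1 - Real.tan θ' ^ 2) / 2 := by
    obtain ⟨b1, b2, b3⟩ := hβs t ht.1 le_rfl
    have := htan hθ'0 (show θ' < θ by linarith) hθ4.le
    nlinarith
  have hmaj : ∀ a b : ℕ, a ≤ 2 → a + b ≤ l → ∃ N M, IsSliceMajorant ρ' θ' μ' t u a b N M ∧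
      ∫⁻ s in Ioo 0 t, M s ≤ ENNReal.ofReal (3 * C) * singularIntegral l ρ' θ' μ' t u := by
    intro a b ha hab
    obtain ⟨b1, b2, b3⟩ := hβs t ht.1 le_rfl
    exact hfam.exists_sliceMajorant hρ'0 hμ'0.le (by linarith) ht.2 hC0 htanle hC
      (lt_top_iff_ne_top.2 hfin) ha hab
  have hmaj' : ∀ a b : ℕ, a ≤ 2 → a + b ≤ l → ∃ N M, IsSliceMajorant ρ' θ' μ' t u a b N M :=
    fun a b ha hab => by
      obtain ⟨N, M, h, -⟩ := hmaj a b ha hab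
      exact ⟨N, M, h⟩
  have hnorm := hfam.kNorm_E3_le ht.1 hl hμ'0.le hmaj
  have hconst : (3 : ℝ≥0∞) * ((l + 1) * (ENNReal.ofReal (3 * C) *
      singularIntegral l ρ' θ' μ' t u)) = ENNReal.ofReal (3 * ((l + 1) * (3 * C))) *
        singularIntegral l ρ' θ' μ' t u := by
    have h3C : 0 ≤ 3 * C := by positivity
    generalize 3 * C = D at h3C
    rw [ENNReal.ofReal_mul (p := 3) (by norm_num),
      ENNReal.ofReal_mul (p := (l : ℝ) + 1) (by positivity),
      ENNReal.ofReal_add (by positivity) zero_le_one, ENNReal.ofReal_natCast, ENNReal.ofReal_one,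
      show ENNReal.ofReal 3 = 3 by norm_num]
    ring
  rw [hconst] at hnorm
  refine ⟨fun _ => ⟨fun x hx Y hY => ?_, ?_⟩, hnorm⟩
  · obtain ⟨N, M, h⟩ := hmaj' 0 0 (by norm_num) (by omega)
    exact hfam.intervalIntegrable_E3Integrand ht.1 hl h hμ'0.le hx hY
  · exact hfam.memK_E3 ht.1 hl hμ'0.le hmaj' (hnorm.trans_lt
      (ENNReal.mul_lt_top ENNReal.ofReal_lt_top (lt_top_iff_ne_top.2 hfin)))
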